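/- Let $(X_n)_{n\ge 1}$ be a time-homogeneous Markov chain on a finite or countable state space $\mathcal X$ with transition kernel $P$. Assume that $P$ is ergodic (for all $x,y$ there is $m_0$ with $P^m(x,y)>0$ for all $m\ge m_0$), that $\mu$ is its stationary distribution, and that $X_1\sim\mu$. Let $\gamma\in(0,1)$, $\lambda\in(0,1)$, let $r:\mathcal X\to\mathbb R$ satisfy $|r|\le R_{\max}$, put $V_{\max}=\frac{R_{\max}}{1-\gamma}$, and let $v(x)=\mathbb E\big[\sum_{j\ge0}\gamma^j r(X_j)\,\big|\,X_0=x\big]$. Let $\phi_1,\dots,\phi_d:\mathcal X\to\mathbb R$ be linearly independent with $|\phi_j|\le L$, put $\phi(x)=(\phi_1(x),\dots,\phi_d(x))^T$ and $\Phi\theta=\sum_j\theta_j\phi_j$, let $\|f\|_\mu=\big(\sum_x |f(x)|^2\mu(x)\big)^{1/2}$, let $\Pi$ be the orthogonal projection onto $\mathrm{span}(\phi_1,\dots,\phi_d)$ with respect to $\|\cdot\|_\mu$, and let $\nu$ be the smallest eigenvalue of the Gram matrix $\big(\sum_x\mu(x)\phi_j(x)\phi_k(x)\big)_{j,k}$.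 Assume that $(X_n)_{n\ge1}$ is $\beta$-mixing at an exponential rate: there are $\overline\beta,b,\kappa>0$ such that the coefficients $$\beta_i=\sup_{t\ge1}\mathbb E\Big[\sup_{B\in\sigma(X_{t+i},X_{t+i+1},\dots)}\big|\mathbb P(B\mid\sigma(X_1,\dots,X_t))-\mathbb P(B)\big|\Big]$$ tend to $0$ and satisfy $\beta_i\le\overline\beta e^{-b i^\kappa}$ for all $i\ge1$. For $n\ge2$ define $z_i=\sum_{k=1}^i(\lambda\gamma)^{i-k}\phi(X_k)$, $$\hat A=\frac1{n-1}\sum_{i=1}^{n-1}z_i\big(\phi(X_i)-\gamma\phi(X_{i+1})\big)^T,\qquad \hat b=\frac1{n-1}\sum_{i=1}^{n-1}z_i\,r(X_i),\qquad \hat v_{LSTD(\lambda)}=\Phi\hat A^{-1}\hat b .$$ For $n\ge1$ and $\delta\in(0,1)$ define $$\Lambda(n,\delta)=\log\Big(\frac{8n^2}{\delta}\Big)+\log\big(\max\{4e^2,n\overline\beta\}\big),\qquad I(n,\delta)=32\,\Lambda(n,\delta)\max\Big\{\frac{\Lambda(n,\delta)}{b},1\Big\}^{1/\kappa},$$ let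 $m(n)=\Big\lceil\frac{\log(n-1)}{\log(1/(\lambda\gamma))}\Big\rceil$ for $n\ge 2$, and let $n_0(\delta)$ be the smallest integer $N\ge2$ such that for all $n\ge N$ $$\frac{2dL^2}{(1-\gamma)\nu}\left[\frac{2}{\sqrt{n-1}}\sqrt{(m(n)+1)\,I(n-1,\delta)}+\frac1{(n-1)(1-\lambda\gamma)}+\frac{2}{n-1}\,m(n)\right]<1 .$$ Then there is a function $h(n,\delta)$, depending only on $n,\delta,d,L,R_{\max},\gamma,\lambda,\nu,\overline\beta,b,\kappa$, such that for each fixed $\delta\in(0,1)$ one has $h(n,\delta)=\tilde O(1/n)$ as $n\to\infty$ (that is, $h(n,\delta)=O((\log n)^k/n)$ for some $k$), and such that for every $\delta\in(0,1)$, with probability at least $1-\delta$, for all $n\ge n_0(\delta)$, the matrix $\hat A$ is invertible and $$\|v-\hat v_{LSTD(\lambda)}\|_\mu\le\frac{1-\lambda\gamma}{1-\gamma}\,\|v-\Pi v\|_\mu+\frac{4V_{\max}dL^2}{\sqrt{n-1}\,(1-\gamma)\nu}\sqrt{(m(n)+1)\,I(n-1,\delta)}+h(n,\delta).$$ -/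

import Mathlib

open MeasureTheory ProbabilityTheory Filter Asymptotics
open scoped ENNReal Topology Matrix

noncomputable section

namespace LSTD

/-! ### The Markov chain, its value function, and mixing -/

section Chain

variable {S : Type*} [MeasurableSpace S]

/-- Ergodicity (irreducibility and aperiodicity) of a kernel on a countable state space:
every `n`-step transition probability `P^n(x, y)` is positive for all large `n`. -/
def IsErgodic (P : Kernel S S) : Prop :=
  ∀ x y : S, ∃ n₀ : ℕ, ∀ n ≥ n₀, 0 < (P ^ n) x {y}

/-- The law on `ℕ → S` of the trajectory `(X_0, X_1, …)` with `X_0 = x` and transition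
kernel `P`. -/
def trajLaw (P : Kernel S S) [IsMarkovKernel P] (x : S) : Measure (ℕ → S) :=
  Kernel.traj (X := fun _ => S)
    (fun n => P.comap (fun h : (Finset.Iic n → S) => h ⟨n, Finset.mem_Iic.2 le_rfl⟩)
      (measurable_pi_apply _)) 0 (fun _ => x)

/-- The value function `v(x) = E[∑_{j ≥ 0} γ^j r(X_j) | X_0 = x]`. -/
def valueFun (P : Kernel S S) [IsMarkovKernel P] (γ : ℝ) (r : S → ℝ) (x : S) : ℝ :=
  ∫ ω, ∑' j : ℕ, γ ^ j * r (ω j) ∂(trajLaw P x)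

/-- `(X_n)_{n ≥ 1}` is, under `Pr`, a time-homogeneous Markov chain with transition kernel `P` on
a countable state space (the variable `X 0` plays no role):
`Pr(X_1 = x_1, …, X_{n+1} = x_{n+1}) = Pr(X_1 = x_1, …, X_n = x_n) P(x_n, x_{n+1})`. -/
def IsMarkovChain {Ω : Type*} [MeasurableSpace Ω] (Pr : Measure Ω) (P : Kernel S S)
    (X : ℕ → Ω → S) : Prop :=
  (∀ n ≥ 1, Measurable (X n)) ∧
  ∀ n ≥ 1, ∀ x : ℕ → S,
    Pr {ω | ∀ k ∈ Finset.Icc 1 (n + 1), X k ω = x k} =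
      Pr {ω | ∀ k ∈ Finset.Icc 1 n, X k ω = x k} * P (x n) {x (n + 1)}

/-- The σ-algebra `σ(X_1, …, X_t)`. -/
abbrev past {Ω : Type*} (X : ℕ → Ω → S) (t : ℕ) : MeasurableSpace Ω :=
  ⨆ k ∈ Set.Icc 1 t, MeasurableSpace.comap (X k) inferInstance

/-- The σ-algebra `σ(X_s, X_{s+1}, …)`. -/
abbrev future {Ω : Type*} (X : ℕ → Ω → S) (s : ℕ) : MeasurableSpace Ω :=
  ⨆ k ∈ Set.Ici s, MeasurableSpace.comap (X k) inferInstance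

/-- The `i`-th β-mixing coefficient of `(X_n)_{n ≥ 1}`:
`β_i = sup_{t ≥ 1} E[ sup_{B ∈ σ(X_{t+i}, X_{t+i+1}, …)} |Pr(B | σ(X_1, …, X_t)) - Pr(B)| ]`. -/
def betaCoeff {Ω : Type*} [MeasurableSpace Ω] (Pr : Measure Ω) (X : ℕ → Ω → S) (i : ℕ) : ℝ≥0∞ :=
  ⨆ t : ℕ, ⨆ _ : 1 ≤ t, ∫⁻ ω, ⨆ B : Set Ω, ⨆ _ : MeasurableSet[future X (t + i)] B,
    ENNReal.ofReal |(Pr⟦B | past X t⟧) ω - Pr.real B| ∂Pr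

/-- `(X_n)_{n ≥ 1}` is β-mixing, at an exponential rate with parameters `βbar`, `b`, `κ`. -/
def IsExpBetaMixing {Ω : Type*} [MeasurableSpace Ω] (Pr : Measure Ω) (X : ℕ → Ω → S)
    (βbar b κ : ℝ) : Prop :=
  Tendsto (betaCoeff Pr X) atTop (𝓝 0) ∧
  ∀ i ≥ 1, betaCoeff Pr X i ≤ ENNReal.ofReal (βbar * Real.exp (-b * (i : ℝ) ^ κ))

end Chain

/-! ### The geometry of `L²(μ)` and of the features -/

section Geometry

variable {S : Type*} [MeasurableSpace S]

/-- The weighted inner product `∑_x f(x) g(x) μ(x)`. -/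
def muInner (μ : Measure S) (f g : S → ℝ) : ℝ :=
  ∑' x, f x * g x * μ.real {x}

/-- The weighted quadratic norm `‖f‖_μ = (∑_x |f(x)|² μ(x))^{1/2}`. -/
def muNorm (μ : Measure S) (f : S → ℝ) : ℝ :=
  Real.sqrt (∑' x, |f x| ^ 2 * μ.real {x})

variable {d : ℕ}

/-- The function `Φ θ = ∑_j θ_j φ_j`. -/
def featureMap (φ : Fin d → S → ℝ) (θ : Fin d → ℝ) : S → ℝ :=
  fun x => ∑ j, θ j * φ j x

/-- The Gram matrix `Φᵀ D_μ Φ`. -/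
def gram (μ : Measure S) (φ : Fin d → S → ℝ) : Matrix (Fin d) (Fin d) ℝ :=
  Matrix.of fun j k => muInner μ (φ j) (φ k)

/-- The projection `Π = Φ (Φᵀ D_μ Φ)⁻¹ Φᵀ D_μ` onto the span of the features. It is the
orthogonal projection with respect to `‖·‖_μ`: see `proj_mem_span` and `muInner_sub_proj`. -/
def proj (μ : Measure S) (φ : Fin d → S → ℝ) (f : S → ℝ) : S → ℝ :=
  featureMap φ ((gram μ φ)⁻¹ *ᵥ fun j => muInner μ (φ j) f)

theorem proj_mem_span (μ : Measure S) (φ : Fin d → S → ℝ) (f : S → ℝ) :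
    proj μ φ f ∈ Submodule.span ℝ (Set.range φ) := by
  have h : ∀ θ : Fin d → ℝ, featureMap φ θ = ∑ j, θ j • φ j := by
    intro θ
    funext x
    simp [featureMap, Finset.sum_apply]
  rw [proj, h]
  exact Submodule.sum_mem _ fun j _ => Submodule.smul_mem _ _ (Submodule.subset_span ⟨j, rfl⟩)

theorem summable_muInner [Countable S] [MeasurableSingletonClass S] (μ : Measure S)
    [IsProbabilityMeasure μ] {f g : S → ℝ} {K L : ℝ} (hf : ∀ x, |f x| ≤ K) (hg : ∀ x, |g x| ≤ L) :
    Summable fun x => f x * g x * μ.real {x} := by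
  have h1 : Summable fun x => μ.real {x} := by
    have h : ∑' x, μ {x} ≠ ∞ := by
      have h' := Measure.tsum_indicator_apply_singleton μ Set.univ MeasurableSet.univ
      simp only [Set.indicator_univ] at h'
      rw [h']
      exact measure_ne_top _ _
    exact ENNReal.summable_toReal h
  refine Summable.of_norm_bounded (h1.mul_left (K * L)) fun x => ?_
  have hw : 0 ≤ μ.real {x} := measureReal_nonneg
  rw [Real.norm_eq_abs, abs_mul, abs_mul, abs_of_nonneg hw]
  have := mul_le_mul (hf x) (hg x) (abs_nonneg _) ((abs_nonneg _).trans (hf x))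
  exact mul_le_mul_of_nonneg_right this hw

/-- For bounded functions and an invertible Gram matrix, `f - Π f` is orthogonal to the features. -/
theorem muInner_sub_proj [Countable S] [MeasurableSingletonClass S] (μ : Measure S)
    [IsProbabilityMeasure μ] {φ : Fin d → S → ℝ} {f : S → ℝ} {K L : ℝ}
    (hφ : ∀ j x, |φ j x| ≤ L) (hf : ∀ x, |f x| ≤ K) (hdet : IsUnit (gram μ φ).det) (k : Fin d) :
    muInner μ (φ k) (fun x => f x - proj μ φ f x) = 0 := by
  set c : Fin d → ℝ := (gram μ φ)⁻¹ *ᵥ fun j => muInner μ (φ j) f with hc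
  have h1 : gram μ φ *ᵥ c = fun j => muInner μ (φ j) f := by
    rw [hc, Matrix.mulVec_mulVec, Matrix.mul_nonsing_inv _ hdet, Matrix.one_mulVec]
  have h2 : ∑ j, muInner μ (φ k) (φ j) * c j = muInner μ (φ k) f := congrFun h1 k
  have h3 : ∀ x, φ k x * (f x - proj μ φ f x) * μ.real {x} =
      φ k x * f x * μ.real {x} - ∑ j, φ k x * φ j x * μ.real {x} * c j := by
    intro x
    have h : proj μ φ f x = ∑ j, c j * φ j x := rfl
    rw [h, mul_sub, sub_mul, Finset.mul_sum, Finset.sum_mul]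
    congr 1
    exact Finset.sum_congr rfl fun j _ => by ring
  have s1 := summable_muInner μ (hφ k) hf
  have s2 : ∀ j, Summable fun x => φ k x * φ j x * μ.real {x} * c j :=
    fun j => (summable_muInner μ (hφ k) (hφ j)).mul_right _
  rw [muInner, tsum_congr h3, s1.tsum_sub (summable_sum fun j _ => s2 j),
    Summable.tsum_finsetSum fun j _ => s2 j, sub_eq_zero]
  simp only [tsum_mul_right]
  exact h2.symm

end Geometry

/-! ### The LSTD(λ) estimate -/

section Estimate

variable {S Ω : Type*} {d : ℕ}

/-- The eligibility trace `z_i = ∑_{k=1}^{i} (λγ)^{i-k} φ(X_k)` along the trajectory `X`. -/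
def trace (φ : Fin d → S → ℝ) (lam γ : ℝ) (X : ℕ → S) (i : ℕ) : Fin d → ℝ :=
  fun j => ∑ k ∈ Finset.Icc 1 i, (lam * γ) ^ (i - k) * φ j (X k)

/-- `Â = (1/(n-1)) ∑_{i=1}^{n-1} z_i (φ(X_i) - γ φ(X_{i+1}))ᵀ`, for `n ≥ 2`. -/
def Ahat (φ : Fin d → S → ℝ) (lam γ : ℝ) (X : ℕ → S) (n : ℕ) : Matrix (Fin d) (Fin d) ℝ :=
  (1 / ((n : ℝ) - 1)) • ∑ i ∈ Finset.Icc 1 (n - 1),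
    Matrix.vecMulVec (trace φ lam γ X i) (fun j => φ j (X i) - γ * φ j (X (i + 1)))

/-- `b̂ = (1/(n-1)) ∑_{i=1}^{n-1} z_i r(X_i)`, for `n ≥ 2`. -/
def bhat (φ : Fin d → S → ℝ) (r : S → ℝ) (lam γ : ℝ) (X : ℕ → S) (n : ℕ) : Fin d → ℝ :=
  (1 / ((n : ℝ) - 1)) • ∑ i ∈ Finset.Icc 1 (n - 1), r (X i) • trace φ lam γ X i

/-- The LSTD(λ) estimate `v̂ = Φ Â⁻¹ b̂` (meaningful when `Â` is invertible). -/
def vhat (φ : Fin d → S → ℝ) (r : S → ℝ) (lam γ : ℝ) (X : ℕ → S) (n : ℕ) : S → ℝ :=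
  featureMap φ ((Ahat φ lam γ X n)⁻¹ *ᵥ bhat φ r lam γ X n)

end Estimate

/-! ### The quantities that appear in the bound -/

section Bounds

/-- `Λ(n, δ) = log(8n²/δ) + log(max{4e², n βbar})`. -/
def Lambda (βbar : ℝ) (n : ℕ) (δ : ℝ) : ℝ :=
  Real.log (8 * (n : ℝ) ^ 2 / δ) + Real.log (max (4 * Real.exp 1 ^ 2) (n * βbar))

/-- `I(n, δ) = 32 Λ(n, δ) max{Λ(n, δ)/b, 1}^{1/κ}`. -/
def mixI (βbar b κ : ℝ) (n : ℕ) (δ : ℝ) : ℝ :=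
  32 * Lambda βbar n δ * max (Lambda βbar n δ / b) 1 ^ (1 / κ)

/-- `⌈log(n-1) / log(1/(λγ))⌉`. -/
def window (lam γ : ℝ) (n : ℕ) : ℝ :=
  (⌈Real.log ((n : ℝ) - 1) / Real.log (1 / (lam * γ))⌉ : ℤ)

/-- The condition `(2dL²/((1-γ)ν)) [ (2/√(n-1)) √((⌈log(n-1)/log(1/(λγ))⌉ + 1) I(n-1, δ))
  + 1/((n-1)(1-λγ)) + (2/(n-1)) ⌈log(n-1)/log(1/(λγ))⌉ ] < 1`, for `n ≥ 2`. -/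
def SampleCond (d : ℕ) (L γ lam ν βbar b κ δ : ℝ) (n : ℕ) : Prop :=
  2 * d * L ^ 2 / ((1 - γ) * ν) *
    (2 / Real.sqrt ((n : ℝ) - 1) *
        Real.sqrt ((window lam γ n + 1) * mixI βbar b κ (n - 1) δ) +
      1 / (((n : ℝ) - 1) * (1 - lam * γ)) +
      2 / ((n : ℝ) - 1) * window lam γ n) < 1

/-- `n₀(δ)`, the smallest integer (at least `2`, so that the condition makes sense) from which on
the condition always holds. -/
def nZero (d : ℕ) (L γ lam ν βbar b κ δ : ℝ) : ℕ :=
  sInf {N : ℕ | 2 ≤ N ∧ ∀ n ≥ N, SampleCond d L γ lam ν βbar b κ δ n}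

/-- `u(n) = Õ(1/n)`: it is `O((log n)^k / n)` for some `k`. -/
def IsSoftOInv (u : ℕ → ℝ) : Prop :=
  ∃ k : ℕ, u =O[atTop] fun n : ℕ => Real.log n ^ k / n

end Bounds

end LSTD

set_option linter.unusedSectionVars false

/-! Write α = λγ, and let norms and inner products be those of L²(μ). The population counterpart of
LSTD(λ) is a Galerkin problem in the span of the features for the form `tdMean`, and `tdMean g f f`
equals ⟨g, f⟩ - (γ-α) ∑ α^l ⟨g, P^(l+1) f⟩. By invariance P contracts L²(μ), so the form is the
identity minus an operator of norm at most (γ-α)/(1-α). It is therefore coercive with constant τ =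
(1-γ)/(1-α) (`le_tdMean_self`). A Céa-type argument, sharpened by the orthogonality of v - Πv to the
features, gives a solution Φθ with ‖v - Φθ‖ ≤ ((1-α)/(1-γ)) ‖v - Πv‖ (`muNorm_sub_fixedPoint_le`).
The Bellman equation gives ‖Φθ‖ ≤ V_max (`muNorm_fixedPoint_le`).

The empirical system is a perturbation of this one. If Â is within ε of the population matrix in
Frobenius norm and ρ = ε/(τν) < 1, then coercivity survives. So Â is invertible, and Φθ differs from
the estimate by at most η/(√ν τ (1-ρ)), where η bounds the residual Âθ - b̂
(`norm_le_of_perturbation`). This residual is itself a single temporal-difference sum with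
stationary mean zero (`residual_apply`, `tdMean_sub_reward`), so its fluctuation gives η = V_max
ε/√ν. The error is then V_max ρ/(1-ρ). Its leading square-root term is the displayed one, and
`lowerOrder` is exactly the remainder.

For the concentration, traces are cut to the last w = m(n) terms, which is cheap because (n-1) α^w ≤
1. A cut summand depends on w+1 consecutive states. With a gap k and a = w+k, subtract from each
summand its conditional mean given the past a steps earlier. Along each residue class mod a the
differences form martingale increments, handled by Azuma-Hoeffding
(`measure_abs_sum_sub_condExp_ge_le`). The conditional means are close in L¹ to the means by mixing
over the gap k (`integral_abs_condExp_sub_le`), and Markov's inequality controls their sum. No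
coupling with independent blocks is needed. Each of the two sums fails with probability at most
δ/(8N²), N = n-1, and δ/(4N²) is summable over N to at most δ. -/

namespace LSTD

/-! ### Bounded functions on a countable space -/

section Bounded

variable {S : Type*}

/-- A real function is bounded. -/
def IsBdd (f : S → ℝ) : Prop := ∃ K : ℝ, ∀ x, |f x| ≤ K

theorem IsBdd.of_abs_le {f : S → ℝ} {K : ℝ} (h : ∀ x, |f x| ≤ K) : IsBdd f := ⟨K, h⟩

theorem IsBdd.add {f g : S → ℝ} (hf : IsBdd f) (hg : IsBdd g) : IsBdd fun x => f x + g x := by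
  obtain ⟨K, hK⟩ := hf
  obtain ⟨M, hM⟩ := hg
  exact ⟨K + M, fun x => (abs_add_le _ _).trans (add_le_add (hK x) (hM x))⟩

theorem IsBdd.const_mul {f : S → ℝ} (c : ℝ) (hf : IsBdd f) : IsBdd fun x => c * f x := by
  obtain ⟨K, hK⟩ := hf
  exact ⟨|c| * K, fun x => by
    rw [abs_mul]; exact mul_le_mul_of_nonneg_left (hK x) (abs_nonneg _)⟩

theorem IsBdd.neg {f : S → ℝ} (hf : IsBdd f) : IsBdd fun x => -f x := by
  simpa using hf.const_mul (-1)

theorem IsBdd.sub {f g : S → ℝ} (hf : IsBdd f) (hg : IsBdd g) : IsBdd fun x => f x - g x := by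
  simpa [sub_eq_add_neg] using hf.add hg.neg

theorem IsBdd.mul {f g : S → ℝ} (hf : IsBdd f) (hg : IsBdd g) : IsBdd fun x => f x * g x := by
  obtain ⟨K, hK⟩ := hf
  obtain ⟨M, hM⟩ := hg
  exact ⟨K * M, fun x => by
    rw [abs_mul]; exact mul_le_mul (hK x) (hM x) (abs_nonneg _) ((abs_nonneg _).trans (hK x))⟩

theorem isBdd_sum {ι : Type*} (s : Finset ι) {f : ι → S → ℝ} (hf : ∀ i, IsBdd (f i)) :
    IsBdd fun x => ∑ i ∈ s, f i x := by
  choose K hK using hf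
  exact ⟨∑ i ∈ s, K i, fun x =>
    (Finset.abs_sum_le_sum_abs _ _).trans (Finset.sum_le_sum fun i _ => hK i x)⟩

theorem isBdd_featureMap {d : ℕ} {φ : Fin d → S → ℝ} (hφ : ∀ j, IsBdd (φ j)) (θ : Fin d → ℝ) :
    IsBdd (featureMap φ θ) :=
  isBdd_sum _ fun j => (hφ j).const_mul (θ j)

variable [Countable S] [MeasurableSpace S] [MeasurableSingletonClass S]

theorem IsBdd.integrable {f : S → ℝ} (hf : IsBdd f) (μ : Measure S) [IsFiniteMeasure μ] :
    Integrable f μ := by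
  obtain ⟨K, hK⟩ := hf
  exact Integrable.of_bound (Measurable.of_discrete).aestronglyMeasurable K
    (Eventually.of_forall hK)

/-- Cauchy-Schwarz from the discriminant of t ↦ ∫ (t f + g)², a nonnegative quadratic. -/
theorem sq_integral_mul_le {f g : S → ℝ} (hf : IsBdd f) (hg : IsBdd g) (μ : Measure S)
    [IsFiniteMeasure μ] :
    (∫ x, f x * g x ∂μ) ^ 2 ≤ (∫ x, f x ^ 2 ∂μ) * ∫ x, g x ^ 2 ∂μ := by
  have hff : Integrable (fun x => f x ^ 2) μ := by simpa [sq] using (hf.mul hf).integrable μ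
  have hgg : Integrable (fun x => g x ^ 2) μ := by simpa [sq] using (hg.mul hg).integrable μ
  have hfg := (hf.mul hg).integrable μ
  have key : ∀ t : ℝ, 0 ≤ (∫ x, f x ^ 2 ∂μ) * (t * t) + (2 * ∫ x, f x * g x ∂μ) * t
      + ∫ x, g x ^ 2 ∂μ := by
    intro t
    have h : ∫ x, (t * f x + g x) ^ 2 ∂μ = (∫ x, f x ^ 2 ∂μ) * (t * t)
        + (2 * ∫ x, f x * g x ∂μ) * t + ∫ x, g x ^ 2 ∂μ := by
      have e : ∀ x, (t * f x + g x) ^ 2 =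
          (t * t) * f x ^ 2 + (2 * t) * (f x * g x) + g x ^ 2 := fun x => by ring
      simp_rw [e]
      have hs : Integrable (fun x => (t * t) * f x ^ 2 + (2 * t) * (f x * g x)) μ :=
        (hff.const_mul _).add (hfg.const_mul _)
      rw [integral_add hs hgg, integral_add (hff.const_mul _) (hfg.const_mul _), integral_const_mul, integral_const_mul]
      ring
    rw [← h]
    exact integral_nonneg fun x => sq_nonneg _
  have := discrim_le_zero key
  rw [discrim] at this
  nlinarith

theorem integral_eq_tsum_mul {f : S → ℝ} (hf : IsBdd f) (μ : Measure S) [IsFiniteMeasure μ] :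
    ∫ x, f x ∂μ = ∑' x, f x * μ.real {x} := by
  rw [integral_countable (hf.integrable μ)]
  simp [mul_comm]

theorem muInner_eq_integral {f g : S → ℝ} (hf : IsBdd f) (hg : IsBdd g) (μ : Measure S)
    [IsFiniteMeasure μ] : muInner μ f g = ∫ x, f x * g x ∂μ := by
  rw [integral_eq_tsum_mul (hf.mul hg), muInner]

theorem sq_muNorm {f : S → ℝ} (hf : IsBdd f) (μ : Measure S) [IsFiniteMeasure μ] :
    muNorm μ f ^ 2 = ∫ x, f x * f x ∂μ := by
  have h : muNorm μ f = Real.sqrt (∫ x, f x * f x ∂μ) := by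
    rw [integral_eq_tsum_mul (hf.mul hf), muNorm]
    simp [sq]
  rw [h, Real.sq_sqrt (integral_nonneg fun x => mul_self_nonneg _)]

theorem muNorm_nonneg (μ : Measure S) (f : S → ℝ) : 0 ≤ muNorm μ f := Real.sqrt_nonneg _

theorem abs_integral_mul_le {f g : S → ℝ} (hf : IsBdd f) (hg : IsBdd g) (μ : Measure S)
    [IsFiniteMeasure μ] : |∫ x, f x * g x ∂μ| ≤ muNorm μ f * muNorm μ g := by
  apply abs_le_of_sq_le_sq _ (mul_nonneg (muNorm_nonneg _ _) (muNorm_nonneg _ _))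
  rw [mul_pow, sq_muNorm hf, sq_muNorm hg]
  simpa only [sq] using sq_integral_mul_le hf hg μ

theorem muNorm_add_le {f g : S → ℝ} (hf : IsBdd f) (hg : IsBdd g) (μ : Measure S)
    [IsFiniteMeasure μ] : muNorm μ (fun x => f x + g x) ≤ muNorm μ f + muNorm μ g := by
  apply le_of_sq_le_sq _ (add_nonneg (muNorm_nonneg _ _) (muNorm_nonneg _ _))
  have h : muNorm μ (fun x => f x + g x) ^ 2 =
      muNorm μ f ^ 2 + 2 * (∫ x, f x * g x ∂μ) + muNorm μ g ^ 2 := by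
    rw [sq_muNorm (hf.add hg), sq_muNorm hf, sq_muNorm hg]
    have e : ∀ x, (f x + g x) * (f x + g x) = f x * f x + 2 * (f x * g x) + g x * g x :=
      fun x => by ring
    simp_rw [e]
    have hs : Integrable (fun x => f x * f x + 2 * (f x * g x)) μ :=
      ((hf.mul hf).integrable μ).add (((hf.mul hg).integrable μ).const_mul 2)
    rw [integral_add hs ((hg.mul hg).integrable μ), integral_add ((hf.mul hf).integrable μ)
      (((hf.mul hg).integrable μ).const_mul 2), integral_const_mul]
  have := (le_abs_self _).trans (abs_integral_mul_le hf hg μ)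
  rw [h]
  nlinarith

theorem muNorm_le_of_abs_le {f : S → ℝ} {K : ℝ} (hK : 0 ≤ K) (hf : ∀ x, |f x| ≤ K)
    (μ : Measure S) [IsProbabilityMeasure μ] : muNorm μ f ≤ K := by
  apply le_of_sq_le_sq _ hK
  rw [sq_muNorm ⟨K, hf⟩]
  calc ∫ x, f x * f x ∂μ ≤ ∫ _, K ^ 2 ∂μ := by
        refine integral_mono (((IsBdd.of_abs_le hf).mul ⟨K, hf⟩).integrable μ)
          (integrable_const _) fun x => ?_
        have := abs_le.1 (hf x)
        nlinarith
    _ = K ^ 2 := by simp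

end Bounded

/-! ### The Markov operator -/

section MarkovOperator

variable {S : Type*} [MeasurableSpace S]

/-- The action `(P f)(x) = ∑_y P(x, y) f(y)` of a kernel on functions. -/
def meanOp (P : Kernel S S) (f : S → ℝ) (x : S) : ℝ := ∫ y, f y ∂(P x)

theorem abs_meanOp_le (P : Kernel S S) [IsMarkovKernel P] {f : S → ℝ} {K : ℝ}
    (hf : ∀ x, |f x| ≤ K) (x : S) : |meanOp P f x| ≤ K := by
  have h := norm_integral_le_of_norm_le_const (μ := P x) (f := f) (Eventually.of_forall hf)
  simpa [meanOp] using h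

theorem abs_iterate_meanOp_le (P : Kernel S S) [IsMarkovKernel P] {f : S → ℝ} {K : ℝ}
    (hf : ∀ x, |f x| ≤ K) (l : ℕ) (x : S) : |(meanOp P)^[l] f x| ≤ K := by
  induction l generalizing f with
  | zero => exact hf x
  | succ l ih => exact ih (abs_meanOp_le P hf)

theorem IsBdd.meanOp {f : S → ℝ} (hf : IsBdd f) (P : Kernel S S) [IsMarkovKernel P] :
    IsBdd (meanOp P f) := by
  obtain ⟨K, hK⟩ := hf
  exact ⟨K, abs_meanOp_le P hK⟩

theorem IsBdd.iterate_meanOp {f : S → ℝ} (hf : IsBdd f) (P : Kernel S S) [IsMarkovKernel P]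
    (l : ℕ) : IsBdd ((LSTD.meanOp P)^[l] f) := by
  obtain ⟨K, hK⟩ := hf
  exact ⟨K, abs_iterate_meanOp_le P hK l⟩

variable [Countable S] [MeasurableSingletonClass S]

theorem iterate_meanOp_add (P : Kernel S S) [IsMarkovKernel P] {f g : S → ℝ} (hf : IsBdd f)
    (hg : IsBdd g) (l : ℕ) : (meanOp P)^[l] (fun x => f x + g x) =
      fun x => (meanOp P)^[l] f x + (meanOp P)^[l] g x := by
  induction l generalizing f g with
  | zero => rfl
  | succ l ih =>
    simp only [Function.iterate_succ, Function.comp]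
    rw [← ih (hf.meanOp P) (hg.meanOp P)]
    congr 1
    funext x
    exact integral_add (hf.integrable _) (hg.integrable _)

theorem iterate_meanOp_const_mul (P : Kernel S S) (c : ℝ) (f : S → ℝ) (l : ℕ) :
    (meanOp P)^[l] (fun x => c * f x) = fun x => c * (meanOp P)^[l] f x := by
  induction l generalizing f with
  | zero => rfl
  | succ l ih =>
    simp only [Function.iterate_succ, Function.comp]
    rw [← ih]
    congr 1
    funext x
    exact integral_const_mul _ _

theorem integral_meanOp {P : Kernel S S} [IsMarkovKernel P] {μ : Measure S}
    [IsProbabilityMeasure μ] (hP : P.Invariant μ) {f : S → ℝ} (hf : IsBdd f) :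
    ∫ x, meanOp P f x ∂μ = ∫ x, f x ∂μ := by
  have h : μ.bind P = μ := hP
  conv_rhs => rw [← h]
  rw [Measure.comp_eq_comp_const_apply, Kernel.integral_comp, Kernel.const_apply]
  · rfl
  · rw [← Measure.comp_eq_comp_const_apply, h]; exact hf.integrable μ

/-- Cauchy-Schwarz against the constant 1 under P(x, ·) gives (Pf)² ≤ P(f²) pointwise; integrating,
invariance removes P on the right. -/
theorem muNorm_meanOp_le {P : Kernel S S} [IsMarkovKernel P] {μ : Measure S}
    [IsProbabilityMeasure μ] (hP : P.Invariant μ) {f : S → ℝ} (hf : IsBdd f) :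
    muNorm μ (meanOp P f) ≤ muNorm μ f := by
  apply le_of_sq_le_sq _ (muNorm_nonneg _ _)
  rw [sq_muNorm (hf.meanOp P), sq_muNorm hf, ← integral_meanOp hP (hf.mul hf)]
  refine integral_mono (((hf.meanOp P).mul (hf.meanOp P)).integrable μ)
    (((hf.mul hf).meanOp P).integrable μ) fun x => ?_
  have h := sq_integral_mul_le hf (g := fun _ => 1) ⟨1, by simp⟩ (P x)
  simp only [mul_one, one_pow, integral_const, probReal_univ, smul_eq_mul] at h
  simp only [meanOp]
  simpa only [sq] using h

theorem muNorm_iterate_meanOp_le {P : Kernel S S} [IsMarkovKernel P] {μ : Measure S}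
    [IsProbabilityMeasure μ] (hP : P.Invariant μ) {f : S → ℝ} (hf : IsBdd f) (l : ℕ) :
    muNorm μ ((meanOp P)^[l] f) ≤ muNorm μ f := by
  induction l generalizing f with
  | zero => exact le_rfl
  | succ l ih => exact (ih (hf.meanOp P)).trans (muNorm_meanOp_le hP hf)

/-- The lagged correlation `⟨g, P^l f⟩_μ`. -/
def stepCorr (P : Kernel S S) (μ : Measure S) (l : ℕ) (g f : S → ℝ) : ℝ :=
  ∫ x, g x * (meanOp P)^[l] f x ∂μ

section StepCorr

variable {P : Kernel S S} [IsMarkovKernel P] {μ : Measure S} [IsProbabilityMeasure μ]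

theorem stepCorr_meanOp (l : ℕ) (g f : S → ℝ) :
    stepCorr P μ l g (meanOp P f) = stepCorr P μ (l + 1) g f := rfl

theorem stepCorr_add_right (l : ℕ) {g f₁ f₂ : S → ℝ} (hg : IsBdd g) (h₁ : IsBdd f₁)
    (h₂ : IsBdd f₂) : stepCorr P μ l g (fun x => f₁ x + f₂ x) =
      stepCorr P μ l g f₁ + stepCorr P μ l g f₂ := by
  simp only [stepCorr]
  rw [iterate_meanOp_add P h₁ h₂]
  simp_rw [mul_add]
  exact integral_add ((hg.mul (h₁.iterate_meanOp P l)).integrable μ)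
    ((hg.mul (h₂.iterate_meanOp P l)).integrable μ)

theorem stepCorr_const_mul_right (l : ℕ) (g f : S → ℝ) (c : ℝ) :
    stepCorr P μ l g (fun x => c * f x) = c * stepCorr P μ l g f := by
  simp only [stepCorr]
  rw [iterate_meanOp_const_mul, ← integral_const_mul]
  congr 1
  funext x
  ring

theorem stepCorr_add_left (l : ℕ) {g₁ g₂ f : S → ℝ} (h₁ : IsBdd g₁) (h₂ : IsBdd g₂)
    (hf : IsBdd f) : stepCorr P μ l (fun x => g₁ x + g₂ x) f =
      stepCorr P μ l g₁ f + stepCorr P μ l g₂ f := by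
  simp only [stepCorr]
  simp_rw [add_mul]
  exact integral_add ((h₁.mul (hf.iterate_meanOp P l)).integrable μ)
    ((h₂.mul (hf.iterate_meanOp P l)).integrable μ)

theorem stepCorr_const_mul_left (l : ℕ) (g f : S → ℝ) (c : ℝ) :
    stepCorr P μ l (fun x => c * g x) f = c * stepCorr P μ l g f := by
  simp only [stepCorr]
  rw [← integral_const_mul]
  congr 1
  funext x
  ring

theorem abs_stepCorr_le (hP : P.Invariant μ) (l : ℕ) {g f : S → ℝ} (hg : IsBdd g)
    (hf : IsBdd f) : |stepCorr P μ l g f| ≤ muNorm μ g * muNorm μ f :=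
  (abs_integral_mul_le hg (hf.iterate_meanOp P l) μ).trans
    (mul_le_mul_of_nonneg_left (muNorm_iterate_meanOp_le hP hf l) (muNorm_nonneg _ _))

end StepCorr

end MarkovOperator

/-! ### The bilinear form of temporal differences -/

section TDForm

variable {S : Type*} [MeasurableSpace S]

/-- The stationary mean of the products of the eligibility trace of `ψ` and the temporal
difference `f(X_i) - γ g(X_{i+1})`. -/
def tdMean (P : Kernel S S) (μ : Measure S) (α γ : ℝ) (ψ f g : S → ℝ) : ℝ :=
  ∑' l : ℕ, α ^ l * (stepCorr P μ l ψ f - γ * stepCorr P μ (l + 1) ψ g)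

variable [Countable S] [MeasurableSingletonClass S] {P : Kernel S S} [IsMarkovKernel P]
  {μ : Measure S} [IsProbabilityMeasure μ] {α γ : ℝ}

theorem summable_pow_mul_of_abs_le {u : ℕ → ℝ} {C : ℝ} (h0 : 0 ≤ α) (h1 : α < 1)
    (hu : ∀ l, |u l| ≤ C) : Summable fun l => α ^ l * u l := by
  refine Summable.of_norm_bounded ((summable_geometric_of_lt_one h0 h1).mul_right C) fun l => ?_
  rw [Real.norm_eq_abs, abs_mul, abs_of_nonneg (pow_nonneg h0 l)]
  exact mul_le_mul_of_nonneg_left (hu l) (pow_nonneg h0 l)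

theorem abs_tsum_pow_mul_le {u : ℕ → ℝ} {C : ℝ} (h0 : 0 ≤ α) (h1 : α < 1)
    (hu : ∀ l, |u l| ≤ C) : |∑' l, α ^ l * u l| ≤ C / (1 - α) := by
  have hg := (hasSum_geometric_of_lt_one h0 h1).mul_right C
  have := tsum_of_norm_bounded hg (f := fun l => α ^ l * u l) fun l => by
    rw [Real.norm_eq_abs, abs_mul, abs_of_nonneg (pow_nonneg h0 l)]
    exact mul_le_mul_of_nonneg_left (hu l) (pow_nonneg h0 l)
  rw [div_eq_inv_mul]
  exact this

theorem summable_stepCorr (h0 : 0 ≤ α) (h1 : α < 1) (hP : P.Invariant μ) {g f : S → ℝ}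
    (hg : IsBdd g) (hf : IsBdd f) (k : ℕ) : Summable fun l => α ^ l * stepCorr P μ (l + k) g f :=
  summable_pow_mul_of_abs_le h0 h1 fun l => abs_stepCorr_le hP (l + k) hg hf

theorem summable_tdMean (h0 : 0 ≤ α) (h1 : α < 1) (hP : P.Invariant μ) {ψ f g : S → ℝ}
    (hψ : IsBdd ψ) (hf : IsBdd f) (hg : IsBdd g) :
    Summable fun l : ℕ => α ^ l * (stepCorr P μ l ψ f - γ * stepCorr P μ (l + 1) ψ g) := by
  have e := (summable_stepCorr h0 h1 hP hψ hf 0).sub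
    ((summable_stepCorr h0 h1 hP hψ hg 1).mul_left γ)
  refine e.congr fun l => ?_
  rw [add_zero]
  ring

theorem tdMean_add_right (h0 : 0 ≤ α) (h1 : α < 1) (hP : P.Invariant μ) {ψ f₁ f₂ : S → ℝ}
    (hψ : IsBdd ψ) (h₁ : IsBdd f₁) (h₂ : IsBdd f₂) :
    tdMean P μ α γ ψ (fun x => f₁ x + f₂ x) (fun x => f₁ x + f₂ x) =
      tdMean P μ α γ ψ f₁ f₁ + tdMean P μ α γ ψ f₂ f₂ := by
  simp only [tdMean]
  rw [← (summable_tdMean h0 h1 hP hψ h₁ h₁).tsum_add (summable_tdMean h0 h1 hP hψ h₂ h₂)]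
  refine tsum_congr fun l => ?_
  rw [stepCorr_add_right _ hψ h₁ h₂, stepCorr_add_right _ hψ h₁ h₂]
  ring

theorem tdMean_const_mul_right (ψ f : S → ℝ) (c : ℝ) :
    tdMean P μ α γ ψ (fun x => c * f x) (fun x => c * f x) = c * tdMean P μ α γ ψ f f := by
  simp only [tdMean]
  rw [← tsum_mul_left]
  refine tsum_congr fun l => ?_
  rw [stepCorr_const_mul_right, stepCorr_const_mul_right]
  ring

theorem tdMean_add_left (h0 : 0 ≤ α) (h1 : α < 1) (hP : P.Invariant μ) {ψ₁ ψ₂ f g : S → ℝ}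
    (h₁ : IsBdd ψ₁) (h₂ : IsBdd ψ₂) (hf : IsBdd f) (hg : IsBdd g) :
    tdMean P μ α γ (fun x => ψ₁ x + ψ₂ x) f g =
      tdMean P μ α γ ψ₁ f g + tdMean P μ α γ ψ₂ f g := by
  simp only [tdMean]
  rw [← (summable_tdMean h0 h1 hP h₁ hf hg).tsum_add (summable_tdMean h0 h1 hP h₂ hf hg)]
  refine tsum_congr fun l => ?_
  rw [stepCorr_add_left _ h₁ h₂ hf, stepCorr_add_left _ h₁ h₂ hg]
  ring

theorem tdMean_const_mul_left (ψ f g : S → ℝ) (c : ℝ) :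
    tdMean P μ α γ (fun x => c * ψ x) f g = c * tdMean P μ α γ ψ f g := by
  simp only [tdMean]
  rw [← tsum_mul_left]
  refine tsum_congr fun l => ?_
  rw [stepCorr_const_mul_left, stepCorr_const_mul_left]
  ring

theorem tdMean_sum_left (h0 : 0 ≤ α) (h1 : α < 1) (hP : P.Invariant μ) {ι : Type*}
    (s : Finset ι) {ψ : ι → S → ℝ} {f g : S → ℝ} (hψ : ∀ i, IsBdd (ψ i)) (hf : IsBdd f)
    (hg : IsBdd g) (c : ι → ℝ) :
    tdMean P μ α γ (fun x => ∑ i ∈ s, c i * ψ i x) f g =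
      ∑ i ∈ s, c i * tdMean P μ α γ (ψ i) f g := by
  classical
  induction s using Finset.induction_on with
  | empty => simp [tdMean, stepCorr]
  | insert i s hi ih =>
    simp_rw [Finset.sum_insert hi]
    rw [tdMean_add_left h0 h1 hP ((hψ i).const_mul _)
      (isBdd_sum s fun j => (hψ j).const_mul (c j)) hf hg, ih, tdMean_const_mul_left]

theorem tdMean_sum_right (h0 : 0 ≤ α) (h1 : α < 1) (hP : P.Invariant μ) {ι : Type*}
    (s : Finset ι) {ψ : S → ℝ} {f : ι → S → ℝ} (hψ : IsBdd ψ) (hf : ∀ i, IsBdd (f i))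
    (c : ι → ℝ) :
    tdMean P μ α γ ψ (fun x => ∑ i ∈ s, c i * f i x) (fun x => ∑ i ∈ s, c i * f i x) =
      ∑ i ∈ s, c i * tdMean P μ α γ ψ (f i) (f i) := by
  classical
  induction s using Finset.induction_on with
  | empty =>
    have := tdMean_const_mul_right (P := P) (μ := μ) (α := α) (γ := γ) ψ (fun _ => 0) 0
    simpa using this
  | insert i s hi ih =>
    simp_rw [Finset.sum_insert hi]
    rw [tdMean_add_right h0 h1 hP hψ ((hf i).const_mul _)
      (isBdd_sum s fun j => (hf j).const_mul (c j)), ih, tdMean_const_mul_right]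

/-- Splitting off the term l = 0 and shifting the index merges the two series: the coefficient of
⟨g, P^(l+1) f⟩ is α^(l+1) - γ α^l = -(γ-α) α^l. -/
theorem tdMean_eq_integral_sub (h0 : 0 ≤ α) (h1 : α < 1) (hP : P.Invariant μ) {g f : S → ℝ}
    (hg : IsBdd g) (hf : IsBdd f) : tdMean P μ α γ g f f =
      ∫ x, g x * f x ∂μ - (γ - α) * ∑' l, α ^ l * stepCorr P μ (l + 1) g f := by
  have s0 := summable_stepCorr h0 h1 hP hg hf 0
  have s1 := summable_stepCorr h0 h1 hP hg hf 1
  have e : tdMean P μ α γ g f f = (∑' l, α ^ l * stepCorr P μ (l + 0) g f)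
      - γ * ∑' l, α ^ l * stepCorr P μ (l + 1) g f := by
    rw [← tsum_mul_left, ← s0.tsum_sub (s1.mul_left γ), tdMean]
    refine tsum_congr fun l => ?_
    rw [add_zero]
    ring
  have e0 : stepCorr P μ 0 g f = ∫ x, g x * f x ∂μ := rfl
  rw [e, s0.tsum_eq_zero_add, pow_zero, one_mul, zero_add, e0]
  have e1 : ∑' l, α ^ (l + 1) * stepCorr P μ (l + 1 + 0) g f =
      α * ∑' l, α ^ l * stepCorr P μ (l + 1) g f := by
    rw [← tsum_mul_left]
    exact tsum_congr fun l => by rw [add_zero, pow_succ]; ring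
  rw [e1]
  ring

theorem abs_tdMean_sub_integral_le (h0 : 0 ≤ α) (h1 : α < 1) (hα : α ≤ γ) (hP : P.Invariant μ)
    {g f : S → ℝ} (hg : IsBdd g) (hf : IsBdd f) :
    |tdMean P μ α γ g f f - ∫ x, g x * f x ∂μ| ≤
      (γ - α) / (1 - α) * (muNorm μ g * muNorm μ f) := by
  rw [tdMean_eq_integral_sub h0 h1 hP hg hf, sub_sub_cancel_left, abs_neg, abs_mul,
    abs_of_nonneg (sub_nonneg.2 hα), div_mul_eq_mul_div, mul_div_assoc]
  exact mul_le_mul_of_nonneg_left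
    (abs_tsum_pow_mul_le h0 h1 fun l => abs_stepCorr_le hP (l + 1) hg hf) (sub_nonneg.2 hα)

/-- Coercivity: the constant is 1 - (γ-α)/(1-α). -/
theorem le_tdMean_self (h0 : 0 ≤ α) (h1 : α < 1) (hα : α ≤ γ) (hP : P.Invariant μ)
    {g : S → ℝ} (hg : IsBdd g) :
    (1 - γ) / (1 - α) * muNorm μ g ^ 2 ≤ tdMean P μ α γ g g g := by
  have h := (abs_le.1 (abs_tdMean_sub_integral_le h0 h1 hα hP hg hg)).1
  rw [← sq_muNorm hg μ] at h
  have e : (1 - γ) / (1 - α) = 1 - (γ - α) / (1 - α) := by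
    rw [eq_sub_iff_add_eq, ← add_div]
    have : 1 - α ≠ 0 := by linarith
    field_simp
    ring
  rw [e]
  linarith

/-- If `v = r + γ P v`, the reward may be exchanged for the value function. -/
theorem tdMean_sub_reward {ψ f r v : S → ℝ} (hψ : IsBdd ψ) (hf : IsBdd f) (hr : IsBdd r)
    (hv : IsBdd v) (hvr : ∀ x, v x = r x + γ * meanOp P v x) :
    tdMean P μ α γ ψ (fun x => f x - r x) f =
      tdMean P μ α γ ψ (fun x => f x - v x) (fun x => f x - v x) := by
  refine tsum_congr fun l => ?_
  have e1 : stepCorr P μ l ψ v = stepCorr P μ l ψ r + γ * stepCorr P μ (l + 1) ψ v := by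
    conv_lhs => rw [show v = fun x => r x + γ * meanOp P v x from funext hvr]
    rw [stepCorr_add_right _ hψ hr ((hv.meanOp P).const_mul γ), stepCorr_const_mul_right,
      stepCorr_meanOp]
  have sub : ∀ k, ∀ g : S → ℝ, IsBdd g → stepCorr P μ k ψ (fun x => f x - g x) =
      stepCorr P μ k ψ f - stepCorr P μ k ψ g := by
    intro k g hg
    have := stepCorr_add_right (P := P) (μ := μ) k hψ hf (hg.const_mul (-1))
    rw [stepCorr_const_mul_right] at this
    simp only [neg_mul, one_mul, ← sub_eq_add_neg] at this
    exact this
  rw [sub l r hr, sub l v hv, sub (l + 1) v hv, e1]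
  ring

/-- The Bellman equation collapses the l-th term to α^l ⟨g, P^l r⟩, so the bound involves the reward
instead of the larger value function. -/
theorem abs_tdMean_value_le (h0 : 0 ≤ α) (h1 : α < 1) (hP : P.Invariant μ) {g r v : S → ℝ}
    {R : ℝ} (hR : 0 ≤ R) (hg : IsBdd g) (hr : ∀ x, |r x| ≤ R)
    (hv : IsBdd v) (hvr : ∀ x, v x = r x + γ * meanOp P v x) :
    |tdMean P μ α γ g v v| ≤ muNorm μ g * R / (1 - α) := by
  have hr' : IsBdd r := ⟨R, hr⟩
  refine abs_tsum_pow_mul_le h0 h1 fun l => ?_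
  have e1 : stepCorr P μ l g v = stepCorr P μ l g r + γ * stepCorr P μ (l + 1) g v := by
    conv_lhs => rw [show v = fun x => r x + γ * meanOp P v x from funext hvr]
    rw [stepCorr_add_right _ hg hr' ((hv.meanOp P).const_mul γ), stepCorr_const_mul_right,
      stepCorr_meanOp]
  rw [e1, add_sub_cancel_right]
  exact (abs_stepCorr_le hP l hg hr').trans
    (mul_le_mul_of_nonneg_left (muNorm_le_of_abs_le hR hr μ) (muNorm_nonneg _ _))

end TDForm

/-! ### The population fixed point -/

section FixedPoint

variable {S : Type*} [MeasurableSpace S] [Countable S] [MeasurableSingletonClass S]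
  {P : Kernel S S} [IsMarkovKernel P] {μ : Measure S} [IsProbabilityMeasure μ] {α γ : ℝ}
  {d : ℕ} {φ : Fin d → S → ℝ}

theorem featureMap_sub (θ η : Fin d → ℝ) :
    featureMap φ (θ - η) = fun x => featureMap φ θ x - featureMap φ η x := by
  funext x
  simp [featureMap, sub_mul]

/-- The population matrix of LSTD(λ). -/
def tdMatrix (P : Kernel S S) (μ : Measure S) (α γ : ℝ) (φ : Fin d → S → ℝ) :
    Matrix (Fin d) (Fin d) ℝ :=
  Matrix.of fun j k => tdMean P μ α γ (φ j) (φ k) (φ k)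

theorem dotProduct_tdMatrix (h0 : 0 ≤ α) (h1 : α < 1) (hP : P.Invariant μ)
    (hφ : ∀ j, IsBdd (φ j)) (c e : Fin d → ℝ) :
    c ⬝ᵥ (tdMatrix P μ α γ φ *ᵥ e) =
      tdMean P μ α γ (featureMap φ c) (featureMap φ e) (featureMap φ e) := by
  have hb := isBdd_featureMap hφ e
  have h : tdMean P μ α γ (featureMap φ c) (featureMap φ e) (featureMap φ e) =
      ∑ j, c j * tdMean P μ α γ (φ j) (featureMap φ e) (featureMap φ e) :=
    tdMean_sum_left h0 h1 hP _ hφ hb hb c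
  rw [h]
  refine Finset.sum_congr rfl fun j _ => ?_
  congr 1
  have h' : tdMean P μ α γ (φ j) (featureMap φ e) (featureMap φ e) =
      ∑ k, e k * tdMean P μ α γ (φ j) (φ k) (φ k) :=
    tdMean_sum_right h0 h1 hP _ (hφ j) hφ e
  rw [h']
  simp only [Matrix.mulVec, dotProduct, tdMatrix, Matrix.of_apply]
  exact Finset.sum_congr rfl fun k _ => mul_comm _ _

theorem le_dotProduct_tdMatrix (h0 : 0 ≤ α) (h1 : α < 1) (hα : α ≤ γ) (hP : P.Invariant μ)
    (hφ : ∀ j, IsBdd (φ j)) (c : Fin d → ℝ) :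
    (1 - γ) / (1 - α) * muNorm μ (featureMap φ c) ^ 2 ≤ c ⬝ᵥ (tdMatrix P μ α γ φ *ᵥ c) := by
  rw [dotProduct_tdMatrix h0 h1 hP hφ]
  exact le_tdMean_self h0 h1 hα hP (isBdd_featureMap hφ c)

/-- Galerkin orthogonality extends from the features to their span. -/
theorem tdMean_featureMap_eq_zero (h0 : 0 ≤ α) (h1 : α < 1) (hP : P.Invariant μ)
    (hφ : ∀ j, IsBdd (φ j)) {f : S → ℝ} (hf : IsBdd f)
    (h : ∀ j, tdMean P μ α γ (φ j) f f = 0) (c : Fin d → ℝ) :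
    tdMean P μ α γ (featureMap φ c) f f = 0 := by
  have e : tdMean P μ α γ (featureMap φ c) f f = ∑ j, c j * tdMean P μ α γ (φ j) f f :=
    tdMean_sum_left h0 h1 hP _ hφ hf hf c
  rw [e]
  simp [h]

theorem exists_fixedPoint (h0 : 0 ≤ α) (h1 : α < 1) (hP : P.Invariant μ)
    (hφ : ∀ j, IsBdd (φ j)) (hA : IsUnit (tdMatrix P μ α γ φ)) {v : S → ℝ} (hv : IsBdd v) :
    ∃ θ : Fin d → ℝ, ∀ j, tdMean P μ α γ (φ j) (fun x => featureMap φ θ x - v x)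
      (fun x => featureMap φ θ x - v x) = 0 := by
  refine ⟨(tdMatrix P μ α γ φ)⁻¹ *ᵥ fun j => tdMean P μ α γ (φ j) v v, fun j => ?_⟩
  set θ := (tdMatrix P μ α γ φ)⁻¹ *ᵥ fun j => tdMean P μ α γ (φ j) v v with hθ
  have e1 : tdMatrix P μ α γ φ *ᵥ θ = fun j => tdMean P μ α γ (φ j) v v := by
    rw [hθ, Matrix.mulVec_mulVec, Matrix.mul_nonsing_inv _ ((Matrix.isUnit_iff_isUnit_det _).1 hA),
      Matrix.one_mulVec]
  have e2 : tdMean P μ α γ (φ j) (featureMap φ θ) (featureMap φ θ) =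
      ∑ k, θ k * tdMean P μ α γ (φ j) (φ k) (φ k) :=
    tdMean_sum_right h0 h1 hP _ (hφ j) hφ θ
  have e3 : ∑ k, tdMean P μ α γ (φ j) (φ k) (φ k) * θ k = tdMean P μ α γ (φ j) v v := congrFun e1 j
  have e4 := tdMean_add_right (γ := γ) h0 h1 hP (hφ j) (isBdd_featureMap hφ θ) (hv.const_mul (-1))
  rw [tdMean_const_mul_right] at e4
  simp only [neg_mul, one_mul, ← sub_eq_add_neg] at e4
  rw [e4, e2, ← e3, sub_eq_zero]
  exact Finset.sum_congr rfl fun k _ => mul_comm _ _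

/-- With e = Φθ - Πv and w = v - Πv, orthogonality kills ⟨e, w⟩, so only the operator of norm
(γ-α)/(1-α) remains on the right of the Galerkin identity. Coercivity gives (1-γ)‖e‖ ≤ (γ-α)‖w‖, and
the triangle inequality adds up to (1-γ) + (γ-α) = 1-α. -/
theorem muNorm_sub_fixedPoint_le (h0 : 0 ≤ α) (h1 : α < 1) (hα : α ≤ γ) (hγ : γ < 1)
    (hP : P.Invariant μ) {L : ℝ} (hφ : ∀ j x, |φ j x| ≤ L) (hdet : IsUnit (gram μ φ).det)
    {v : S → ℝ} (hv : IsBdd v) {θ : Fin d → ℝ}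
    (hθ : ∀ j, tdMean P μ α γ (φ j) (fun x => featureMap φ θ x - v x)
      (fun x => featureMap φ θ x - v x) = 0) :
    muNorm μ (fun x => v x - featureMap φ θ x) ≤
      (1 - α) / (1 - γ) * muNorm μ (fun x => v x - proj μ φ v x) := by
  have hφb : ∀ j, IsBdd (φ j) := fun j => ⟨L, hφ j⟩
  obtain ⟨K, hK⟩ := id hv
  set c : Fin d → ℝ := (gram μ φ)⁻¹ *ᵥ fun j => muInner μ (φ j) v with hc
  have hproj : proj μ φ v = featureMap φ c := rfl
  have hpb : IsBdd (proj μ φ v) := isBdd_featureMap hφb c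
  set w : S → ℝ := fun x => v x - proj μ φ v x with hw
  have hwb : IsBdd w := hv.sub hpb
  set e : S → ℝ := featureMap φ (θ - c) with he
  have heb : IsBdd e := isBdd_featureMap hφb _
  have hex : ∀ x, e x = featureMap φ θ x - proj μ φ v x := fun x => by
    rw [he, featureMap_sub, hproj]
  have horth : ∫ x, e x * w x ∂μ = 0 := by
    have e1 : ∀ x, e x * w x = ∑ j, (θ - c) j * (φ j x * w x) := fun x => by
      rw [he, featureMap, Finset.sum_mul]
      exact Finset.sum_congr rfl fun j _ => by ring
    simp_rw [e1]
    rw [integral_finsetSum _ fun j _ => (((hφb j).mul hwb).const_mul _).integrable μ]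
    refine Finset.sum_eq_zero fun j _ => ?_
    rw [integral_const_mul, ← muInner_eq_integral (hφb j) hwb,
      muInner_sub_proj μ hφ hK hdet j, mul_zero]
  -- Galerkin orthogonality tested with e, since e = (Φθ - v) + w.
  have hgal : tdMean P μ α γ e e e = tdMean P μ α γ e w w := by
    have hdiff : IsBdd fun x => featureMap φ θ x - v x := (isBdd_featureMap hφb θ).sub hv
    have h := tdMean_add_right (γ := γ) h0 h1 hP heb hdiff hwb
    rw [tdMean_featureMap_eq_zero h0 h1 hP hφb hdiff hθ, zero_add] at h
    rw [← h]
    congr 1 <;> (funext x; simp only [hex, hw]; ring)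
  have hle := le_tdMean_self h0 h1 hα hP heb
  have hup := (abs_le.1 (abs_tdMean_sub_integral_le h0 h1 hα hP heb hwb)).2
  rw [horth, sub_zero, ← hgal] at hup
  have hα1 : 0 < 1 - α := by linarith
  have hγ1 : 0 < 1 - γ := by linarith
  have hen : (1 - γ) * muNorm μ e ≤ (γ - α) * muNorm μ w := by
    rcases (muNorm_nonneg μ e).eq_or_lt with h | h
    · rw [← h, mul_zero]
      exact mul_nonneg (by linarith) (muNorm_nonneg _ _)
    · have h2 := hle.trans hup
      rw [div_mul_eq_mul_div, div_mul_eq_mul_div, div_le_div_iff_of_pos_right hα1] at h2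
      nlinarith
  have htri : muNorm μ (fun x => v x - featureMap φ θ x) ≤ muNorm μ w + muNorm μ e := by
    have h := muNorm_add_le hwb (heb.neg) μ
    have e2 : muNorm μ (fun x => -e x) = muNorm μ e := by simp [muNorm]
    rw [e2] at h
    convert h using 2
    funext x
    rw [hex, hw]
    ring
  refine htri.trans ?_
  rw [div_mul_eq_mul_div, le_div_iff₀ hγ1]
  nlinarith

/-- Testing the Galerkin equation with Φθ itself puts the coercive form between τ ‖Φθ‖² and ‖Φθ‖
R/(1-α). -/
theorem muNorm_fixedPoint_le (h0 : 0 ≤ α) (h1 : α < 1) (hα : α ≤ γ) (hγ : γ < 1)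
    (hP : P.Invariant μ) (hφ : ∀ j, IsBdd (φ j)) {r v : S → ℝ} {R : ℝ} (hR : 0 ≤ R)
    (hr : ∀ x, |r x| ≤ R) (hv : IsBdd v) (hvr : ∀ x, v x = r x + γ * meanOp P v x)
    {θ : Fin d → ℝ}
    (hθ : ∀ j, tdMean P μ α γ (φ j) (fun x => featureMap φ θ x - v x)
      (fun x => featureMap φ θ x - v x) = 0) :
    muNorm μ (featureMap φ θ) ≤ R / (1 - γ) := by
  have hb := isBdd_featureMap hφ θ
  have hdiff : IsBdd fun x => featureMap φ θ x - v x := hb.sub hv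
  have h := tdMean_add_right (γ := γ) h0 h1 hP hb hdiff hv
  rw [tdMean_featureMap_eq_zero h0 h1 hP hφ hdiff hθ, zero_add] at h
  simp only [sub_add_cancel] at h
  have h2 := le_tdMean_self h0 h1 hα hP hb
  rw [show (fun x => featureMap φ θ x) = featureMap φ θ from rfl] at h
  rw [h] at h2
  have h3 := h2.trans ((le_abs_self _).trans
    (abs_tdMean_value_le h0 h1 hP hR hb hr hv hvr))
  have hα1 : 0 < 1 - α := by linarith
  have hγ1 : 0 < 1 - γ := by linarith
  rw [div_mul_eq_mul_div, div_le_div_iff_of_pos_right hα1] at h3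
  rw [le_div_iff₀ hγ1]
  rcases (muNorm_nonneg μ (featureMap φ θ)).eq_or_lt with h | h
  · rw [← h, zero_mul]; exact hR
  · nlinarith

end FixedPoint

/-! ### Perturbation of the linear system -/

section Perturbation

variable {d : ℕ}

theorem sq_dotProduct_le (x y : Fin d → ℝ) : (x ⬝ᵥ y) ^ 2 ≤ (x ⬝ᵥ x) * (y ⬝ᵥ y) := by
  simpa [dotProduct, sq] using Finset.sum_mul_sq_le_sq_mul_sq Finset.univ x y

/-- The Frobenius norm dominates the operator norm. -/
theorem abs_dotProduct_mulVec_le {E : Matrix (Fin d) (Fin d) ℝ} {ε : ℝ} (hε : 0 ≤ ε)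
    (hE : ∑ p : Fin d × Fin d, E p.1 p.2 ^ 2 ≤ ε ^ 2) (c : Fin d → ℝ) :
    |c ⬝ᵥ (E *ᵥ c)| ≤ ε * (c ⬝ᵥ c) := by
  have hcc : 0 ≤ c ⬝ᵥ c := Finset.sum_nonneg fun i _ => mul_self_nonneg _
  apply abs_le_of_sq_le_sq _ (mul_nonneg hε hcc)
  have h1 : (E *ᵥ c) ⬝ᵥ (E *ᵥ c) ≤ ε ^ 2 * (c ⬝ᵥ c) := by
    calc (E *ᵥ c) ⬝ᵥ (E *ᵥ c) = ∑ i, (E i ⬝ᵥ c) ^ 2 := by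
          simp [dotProduct, Matrix.mulVec, sq]
      _ ≤ ∑ i, (E i ⬝ᵥ E i) * (c ⬝ᵥ c) := Finset.sum_le_sum fun i _ => sq_dotProduct_le _ _
      _ = (∑ p : Fin d × Fin d, E p.1 p.2 ^ 2) * (c ⬝ᵥ c) := by
          rw [← Finset.sum_mul, Fintype.sum_prod_type]
          simp [dotProduct, sq]
      _ ≤ ε ^ 2 * (c ⬝ᵥ c) := mul_le_mul_of_nonneg_right hE hcc
  calc (c ⬝ᵥ (E *ᵥ c)) ^ 2 ≤ (c ⬝ᵥ c) * ((E *ᵥ c) ⬝ᵥ (E *ᵥ c)) := sq_dotProduct_le _ _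
    _ ≤ (c ⬝ᵥ c) * (ε ^ 2 * (c ⬝ᵥ c)) := mul_le_mul_of_nonneg_left h1 hcc
    _ = (ε * (c ⬝ᵥ c)) ^ 2 := by ring

theorem isUnit_of_le_dotProduct {B : Matrix (Fin d) (Fin d) ℝ} {τ : ℝ} (hτ : 0 < τ)
    (hB : ∀ c, τ * (c ⬝ᵥ c) ≤ c ⬝ᵥ (B *ᵥ c)) : IsUnit B := by
  rw [← Matrix.mulVec_injective_iff_isUnit]
  intro x y hxy
  rw [← sub_eq_zero]
  have h := hB (x - y)
  rw [Matrix.mulVec_sub, hxy, sub_self, dotProduct_zero] at h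
  have h0 : (x - y) ⬝ᵥ (x - y) = 0 := by
    have : 0 ≤ (x - y) ⬝ᵥ (x - y) := Finset.sum_nonneg fun i _ => mul_self_nonneg _
    nlinarith
  exact dotProduct_self_eq_zero.1 h0

variable {A B : Matrix (Fin d) (Fin d) ℝ} {s : (Fin d → ℝ) → ℝ} {τ ν ε : ℝ}

/-- Here s c stands for ‖Φc‖. Coercivity is measured in s but the perturbation in the Euclidean
norm; the exchange costs a factor 1/ν, whence the relative error ε/(τν). -/
theorem le_dotProduct_of_perturbation (hτ : 0 < τ) (hν : 0 < ν)
    (hA : ∀ c, τ * s c ^ 2 ≤ c ⬝ᵥ (A *ᵥ c)) (hs : ∀ c, ν * (c ⬝ᵥ c) ≤ s c ^ 2) (hε : 0 ≤ ε)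
    (hE : ∑ p : Fin d × Fin d, (B p.1 p.2 - A p.1 p.2) ^ 2 ≤ ε ^ 2) (c : Fin d → ℝ) :
    τ * (1 - ε / (τ * ν)) * s c ^ 2 ≤ c ⬝ᵥ (B *ᵥ c) := by
  have h := (abs_le.1 (abs_dotProduct_mulVec_le (E := B - A) hε hE c)).1
  rw [Matrix.sub_mulVec, dotProduct_sub] at h
  have h1 := hA c
  have h2 : ε * (c ⬝ᵥ c) ≤ ε / ν * s c ^ 2 := by
    rw [div_mul_eq_mul_div, le_div_iff₀ hν]
    nlinarith [hs c]
  have h3 : τ * (1 - ε / (τ * ν)) = τ - ε / ν := by field_simp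
  rw [h3]
  nlinarith

theorem isUnit_of_perturbation (hτ : 0 < τ) (hν : 0 < ν)
    (hA : ∀ c, τ * s c ^ 2 ≤ c ⬝ᵥ (A *ᵥ c)) (hs : ∀ c, ν * (c ⬝ᵥ c) ≤ s c ^ 2) (hε : 0 ≤ ε)
    (hE : ∑ p : Fin d × Fin d, (B p.1 p.2 - A p.1 p.2) ^ 2 ≤ ε ^ 2) (hρ : ε / (τ * ν) < 1) :
    IsUnit B := by
  refine isUnit_of_le_dotProduct (mul_pos (mul_pos hτ (by linarith : 0 < 1 - ε / (τ * ν))) hν)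
    fun c => ?_
  refine le_trans ?_ (le_dotProduct_of_perturbation hτ hν hA hs hε hE c)
  rw [mul_assoc]
  exact mul_le_mul_of_nonneg_left (hs c) (mul_pos hτ (by linarith)).le

/-- Coercivity of B bounds s(e)² by e·Be ≤ |e| η ≤ s(e) η/√ν. Using the Euclidean norm only once on
e is what leaves √ν instead of ν. -/
theorem norm_le_of_perturbation (hτ : 0 < τ) (hν : 0 < ν) (hs0 : ∀ c, 0 ≤ s c)
    (hA : ∀ c, τ * s c ^ 2 ≤ c ⬝ᵥ (A *ᵥ c)) (hs : ∀ c, ν * (c ⬝ᵥ c) ≤ s c ^ 2) (hε : 0 ≤ ε)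
    (hE : ∑ p : Fin d × Fin d, (B p.1 p.2 - A p.1 p.2) ^ 2 ≤ ε ^ 2) (hρ : ε / (τ * ν) < 1)
    {e : Fin d → ℝ} {η : ℝ} (hη : 0 ≤ η) (he : ∑ j, (B *ᵥ e) j ^ 2 ≤ η ^ 2) :
    s e ≤ η / (Real.sqrt ν * τ * (1 - ε / (τ * ν))) := by
  have h1 := le_dotProduct_of_perturbation hτ hν hA hs hε hE e
  have hpos : 0 < τ * (1 - ε / (τ * ν)) := mul_pos hτ (by linarith)
  have hsν := Real.sqrt_pos.2 hν
  have h2 : e ⬝ᵥ (B *ᵥ e) ≤ s e / Real.sqrt ν * η := by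
    refine le_of_sq_le_sq ?_ (by have := hs0 e; positivity)
    have h3 : (B *ᵥ e) ⬝ᵥ (B *ᵥ e) ≤ η ^ 2 := by simpa [dotProduct, sq] using he
    have h4 : e ⬝ᵥ e ≤ s e ^ 2 / ν := by
      rw [le_div_iff₀ hν, mul_comm]; exact hs e
    calc (e ⬝ᵥ (B *ᵥ e)) ^ 2 ≤ (e ⬝ᵥ e) * ((B *ᵥ e) ⬝ᵥ (B *ᵥ e)) := sq_dotProduct_le _ _
      _ ≤ s e ^ 2 / ν * η ^ 2 := by
          refine mul_le_mul h4 h3 (Finset.sum_nonneg fun i _ => mul_self_nonneg _) (by positivity)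
      _ = (s e / Real.sqrt ν * η) ^ 2 := by
          rw [mul_pow, div_pow, Real.sq_sqrt hν.le]
  rcases (hs0 e).eq_or_lt with h | h
  · rw [← h]; positivity
  · rw [le_div_iff₀ (by rw [mul_assoc]; positivity)]
    have h5 := h1.trans h2
    rw [div_mul_eq_mul_div, le_div_iff₀ hsν] at h5
    have h6 : s e * (s e * (Real.sqrt ν * τ * (1 - ε / (τ * ν)))) ≤ s e * η := by
      calc _ = τ * (1 - ε / (τ * ν)) * s e ^ 2 * Real.sqrt ν := by ring
        _ ≤ _ := h5
    exact le_of_mul_le_mul_left h6 h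

end Perturbation

/-! ### The Gram matrix -/

section Gram

variable {S : Type*} [MeasurableSpace S] [Countable S] [MeasurableSingletonClass S]
  {μ : Measure S} [IsProbabilityMeasure μ] {d : ℕ} {φ : Fin d → S → ℝ}

theorem invariant_pow {P : Kernel S S} (hP : P.Invariant μ) (n : ℕ) : (P ^ n).Invariant μ := by
  induction n with
  | zero =>
    rw [pow_zero]
    change μ.bind Kernel.id = μ
    exact Measure.id_comp
  | succ n ih =>
    rw [pow_succ]
    exact Kernel.Invariant.comp ih hP

/-- Some point x₀ has mass, it reaches y with positive probability in n steps, and μ is invariant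
under P^n. -/
theorem measure_singleton_pos_of_isErgodic {P : Kernel S S} (hP : P.Invariant μ)
    (herg : IsErgodic P) (y : S) : 0 < μ {y} := by
  obtain ⟨x₀, hx₀⟩ : ∃ x₀, μ {x₀} ≠ 0 := by
    by_contra! h
    have h1 : μ (⋃ x : S, {x}) = 0 := measure_iUnion_null h
    rw [Set.iUnion_of_singleton, measure_univ] at h1
    exact one_ne_zero h1
  obtain ⟨n, hn⟩ := herg x₀ y
  rw [pos_iff_ne_zero]
  intro h0
  have h1 : μ.bind (P ^ n) {y} = 0 := by rw [invariant_pow hP n, h0]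
  rw [Measure.bind_apply (measurableSet_singleton y) (Kernel.aemeasurable _),
    lintegral_eq_zero_iff Measurable.of_discrete, Filter.EventuallyEq, ae_iff_of_countable] at h1
  exact (hn n le_rfl).ne' (h1 x₀ hx₀)

theorem gram_isHermitian (μ : Measure S) (φ : Fin d → S → ℝ) : (gram μ φ).IsHermitian := by
  ext j k
  simp only [gram, Matrix.conjTranspose_apply, Matrix.of_apply, star_trivial, muInner]
  exact tsum_congr fun x => by ring

theorem dotProduct_gram (hφ : ∀ j, IsBdd (φ j)) (c : Fin d → ℝ) :
    c ⬝ᵥ (gram μ φ *ᵥ c) = muNorm μ (featureMap φ c) ^ 2 := by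
  rw [sq_muNorm (isBdd_featureMap hφ c)]
  have e : ∀ x, featureMap φ c x * featureMap φ c x =
      ∑ j, ∑ k, (c j * c k) * (φ j x * φ k x) := fun x => by
    rw [featureMap, Finset.sum_mul_sum]
    exact Finset.sum_congr rfl fun j _ => Finset.sum_congr rfl fun k _ => by ring
  simp_rw [e]
  rw [integral_finsetSum _ fun j _ => (isBdd_sum _ fun k =>
    ((hφ j).mul (hφ k)).const_mul _).integrable μ, dotProduct]
  refine Finset.sum_congr rfl fun j _ => ?_
  rw [integral_finsetSum _ fun k _ => (((hφ j).mul (hφ k)).const_mul _).integrable μ,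
    Matrix.mulVec, dotProduct, Finset.mul_sum]
  refine Finset.sum_congr rfl fun k _ => ?_
  rw [integral_const_mul, gram, Matrix.of_apply, muInner_eq_integral (hφ j) (hφ k)]
  ring

variable {ν : ℝ}

/-- Rayleigh's bound: the Gram matrix minus ν is positive semidefinite because its eigenvalues are
those of the Gram matrix shifted by -ν. -/
theorem mul_dotProduct_le_sq_muNorm (hφ : ∀ j, IsBdd (φ j))
    (hν : ν ∈ lowerBounds {a : ℝ | Module.End.HasEigenvalue (Matrix.toLin' (gram μ φ)) a})
    (c : Fin d → ℝ) : ν * (c ⬝ᵥ c) ≤ muNorm μ (featureMap φ c) ^ 2 := by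
  have hH : (gram μ φ - algebraMap ℝ _ ν).IsHermitian := by
    refine (gram_isHermitian μ φ).sub ?_
    rw [Algebra.algebraMap_eq_smul_one]
    ext i j
    simp [Matrix.one_apply, eq_comm]
  have hpsd : (gram μ φ - algebraMap ℝ _ ν).PosSemidef := by
    rw [hH.posSemidef_iff_eigenvalues_nonneg]
    intro i
    have h1 := hH.eigenvalues_mem_spectrum_real i
    have h2 : hH.eigenvalues i + ν ∈ spectrum ℝ (gram μ φ) := by
      rw [spectrum.mem_iff] at h1 ⊢
      convert h1 using 2
      rw [map_add]
      abel
    rw [← Matrix.spectrum_toLin', ← Module.End.hasEigenvalue_iff_mem_spectrum] at h2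
    have h3 : ν ≤ hH.eigenvalues i + ν := hν h2
    simpa using h3
  have h := hpsd.dotProduct_mulVec_nonneg c
  rw [star_trivial, Matrix.sub_mulVec, dotProduct_sub, dotProduct_gram hφ,
    Algebra.algebraMap_eq_smul_one, Matrix.smul_mulVec, Matrix.one_mulVec, dotProduct_smul,
    smul_eq_mul] at h
  linarith

theorem eq_zero_of_muNorm_eq_zero (hpos : ∀ x, 0 < μ {x}) {f : S → ℝ} (hf : IsBdd f)
    (h : muNorm μ f = 0) : f = 0 := by
  have h1 : ∫ x, f x * f x ∂μ = 0 := by rw [← sq_muNorm hf, h]; simp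
  rw [integral_eq_zero_iff_of_nonneg (fun x => mul_self_nonneg _) ((hf.mul hf).integrable μ),
    Filter.EventuallyEq, ae_iff_of_countable] at h1
  funext x
  exact mul_self_eq_zero.1 (h1 x (hpos x).ne')

/-- An eigenvector c of a nonpositive eigenvalue would have ‖Φc‖ = 0. As μ charges every point, Φc =
0 everywhere, against linear independence. -/
theorem eigenvalue_pos (hφ : ∀ j, IsBdd (φ j)) (hpos : ∀ x, 0 < μ {x})
    (hli : LinearIndependent ℝ φ)
    (hν : Module.End.HasEigenvalue (Matrix.toLin' (gram μ φ)) ν) : 0 < ν := by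
  obtain ⟨c, hc⟩ := hν.exists_hasEigenvector
  have h1 : gram μ φ *ᵥ c = ν • c := by
    rw [← Matrix.toLin'_apply]; exact hc.apply_eq_smul
  have h2 := dotProduct_gram (μ := μ) hφ c
  rw [h1, dotProduct_smul, smul_eq_mul] at h2
  have h3 : 0 < c ⬝ᵥ c := lt_of_le_of_ne (Finset.sum_nonneg fun i _ => mul_self_nonneg _)
    fun h => hc.2 (dotProduct_self_eq_zero.1 h.symm)
  by_contra! hle
  have h4 : muNorm μ (featureMap φ c) = 0 := by
    have := sq_nonneg (muNorm μ (featureMap φ c))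
    exact pow_eq_zero_iff (two_ne_zero) |>.1 (by nlinarith)
  have h5 := eq_zero_of_muNorm_eq_zero hpos (isBdd_featureMap hφ c) h4
  refine hc.2 (funext (Fintype.linearIndependent_iff.1 hli c ?_))
  funext x
  have := congrFun h5 x
  simpa [featureMap, Finset.sum_apply] using this

theorem pos_of_eigenvalue (hν : Module.End.HasEigenvalue (Matrix.toLin' (gram μ φ)) ν) :
    0 < d := by
  obtain ⟨c, hc⟩ := hν.exists_hasEigenvector
  rcases Nat.eq_zero_or_pos d with h | h
  · subst h
    exact absurd (Subsingleton.elim c 0) hc.2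
  · exact h

/-- Rayleigh quotient at the first basis vector. The bound ν ≤ L² later absorbs several constants.
-/
theorem smallest_eigenvalue_le_sq {L : ℝ} (hd : 0 < d) (hφ : ∀ j x, |φ j x| ≤ L)
    (hν : ν ∈ lowerBounds {a : ℝ | Module.End.HasEigenvalue (Matrix.toLin' (gram μ φ)) a}) :
    ν ≤ L ^ 2 := by
  have h := mul_dotProduct_le_sq_muNorm (μ := μ) (fun j => ⟨L, hφ j⟩) hν (Pi.single ⟨0, hd⟩ 1)
  have e : featureMap φ (Pi.single ⟨0, hd⟩ 1) = φ ⟨0, hd⟩ := by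
    funext x
    simp [featureMap, Pi.single_apply]
  rw [e] at h
  simp only [dotProduct_single, Pi.single_eq_same, mul_one] at h
  have hne : Nonempty S := by
    by_contra hS
    rw [not_nonempty_iff] at hS
    have h1 : μ Set.univ = 0 := by rw [Set.univ_eq_empty_iff.2 hS, measure_empty]
    rw [measure_univ] at h1
    exact one_ne_zero h1
  have hL : 0 ≤ L := (abs_nonneg _).trans (hφ ⟨0, hd⟩ hne.some)
  refine h.trans ?_
  exact pow_le_pow_left₀ (muNorm_nonneg _ _) (muNorm_le_of_abs_le hL (hφ _) μ) 2

theorem isUnit_det_gram (hφ : ∀ j, IsBdd (φ j)) (h0 : 0 < ν)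
    (hν : ν ∈ lowerBounds {a : ℝ | Module.End.HasEigenvalue (Matrix.toLin' (gram μ φ)) a}) :
    IsUnit (gram μ φ).det := by
  rw [← Matrix.isUnit_iff_isUnit_det]
  refine isUnit_of_le_dotProduct h0 fun c => ?_
  rw [dotProduct_gram hφ]
  exact mul_dotProduct_le_sq_muNorm hφ hν c

end Gram

/-! ### The value function -/

section Value

variable {S : Type*} [MeasurableSpace S] [Countable S] [MeasurableSingletonClass S]
  (P : Kernel S S) [IsMarkovKernel P]

instance (x : S) : IsProbabilityMeasure (trajLaw P x) := by
  unfold trajLaw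
  infer_instance

theorem integrable_eval_trajLaw (x : S) {f : S → ℝ} (hf : IsBdd f) (j : ℕ) :
    Integrable (fun ω : ℕ → S => f (ω j)) (trajLaw P x) := by
  obtain ⟨K, hK⟩ := hf
  exact Integrable.of_bound
    ((Measurable.of_discrete (f := f)).comp (measurable_pi_apply j)).aestronglyMeasurable K
    (Eventually.of_forall fun ω => hK (ω j))

/-- By the Ionescu-Tulcea construction, the history up to j together with the state at j+1 has the
law of the history composed with P. -/
theorem integral_eval_succ_trajLaw (x : S) {f : S → ℝ} (hf : IsBdd f) (j : ℕ) :
    ∫ ω, f (ω (j + 1)) ∂(trajLaw P x) = ∫ ω, meanOp P f (ω j) ∂(trajLaw P x) := by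
  have hfm : Measurable f := Measurable.of_discrete
  have hgm : Measurable (meanOp P f) := Measurable.of_discrete
  have key := Kernel.partialTraj_compProd_eq_map_traj (X := fun _ => S)
    (κ := fun n => P.comap (fun h : (Finset.Iic n → S) => h ⟨n, Finset.mem_Iic.2 le_rfl⟩)
      (measurable_pi_apply _)) (Nat.zero_le j) (x₀ := fun _ => x)
  have hm : Measurable fun p : (Finset.Iic j → S) × S => f p.2 := hfm.comp measurable_snd
  have h1 : ∫ ω, f (ω (j + 1)) ∂(trajLaw P x) = ∫ p, f p.2 ∂((trajLaw P x).map
      fun ω => (Preorder.frestrictLe j ω, ω (j + 1))) := by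
    rw [integral_map (by fun_prop) hm.aestronglyMeasurable]
  have h2 : Integrable (fun p : (Finset.Iic j → S) × S => f p.2) ((trajLaw P x).map
      fun ω => (Preorder.frestrictLe j ω, ω (j + 1))) := by
    rw [integrable_map_measure hm.aestronglyMeasurable (by fun_prop)]
    exact integrable_eval_trajLaw P x hf (j + 1)
  rw [h1]
  unfold trajLaw at h2 ⊢
  rw [← key] at h2 ⊢
  rw [Measure.integral_compProd h2, ← Kernel.traj_map_frestrictLe_apply,
    integral_map (by fun_prop)]
  · rfl
  · exact (hgm.comp (measurable_pi_apply (⟨j, Finset.mem_Iic.2 le_rfl⟩ : Finset.Iic j))).aestronglyMeasurable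

theorem integral_eval_zero_trajLaw (x : S) (f : S → ℝ) :
    ∫ ω, f (ω 0) ∂(trajLaw P x) = f x := by
  have hfm : Measurable f := Measurable.of_discrete
  have hm : Measurable fun p : Finset.Iic 0 → S => f (p ⟨0, Finset.mem_Iic.2 le_rfl⟩) :=
    hfm.comp (measurable_pi_apply _)
  have h1 : ∫ ω, f (ω 0) ∂(trajLaw P x) = ∫ p, f (p ⟨0, Finset.mem_Iic.2 le_rfl⟩)
      ∂((trajLaw P x).map (Preorder.frestrictLe 0)) := by
    rw [integral_map (by fun_prop) hm.aestronglyMeasurable]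
    rfl
  rw [h1, trajLaw, Kernel.traj_map_frestrictLe_apply, Kernel.partialTraj_self, Kernel.id_apply,
    integral_dirac' _ _ hm.stronglyMeasurable]

theorem integral_eval_trajLaw (x : S) {f : S → ℝ} (hf : IsBdd f) (j : ℕ) :
    ∫ ω, f (ω j) ∂(trajLaw P x) = (meanOp P)^[j] f x := by
  induction j generalizing f with
  | zero => exact integral_eval_zero_trajLaw P x f
  | succ j ih => rw [integral_eval_succ_trajLaw P x hf, ih (hf.meanOp P)]; rfl

theorem integral_tsum_pow_mul {Ω : Type*} [MeasurableSpace Ω] (Q : Measure Ω)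
    [IsProbabilityMeasure Q] {γ K : ℝ} (h0 : 0 ≤ γ) (h1 : γ < 1) {u : ℕ → Ω → ℝ}
    (hu : ∀ j, Integrable (u j) Q) (hK : ∀ j ω, |u j ω| ≤ K) :
    ∫ ω, ∑' j : ℕ, γ ^ j * u j ω ∂Q = ∑' j : ℕ, γ ^ j * ∫ ω, u j ω ∂Q := by
  rw [← integral_tsum_of_summable_integral_norm fun j => (hu j).const_mul (γ ^ j)]
  · exact tsum_congr fun j => integral_const_mul _ _
  · refine Summable.of_nonneg_of_le (fun j => integral_nonneg fun _ => norm_nonneg _) (fun j => ?_)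
      ((summable_geometric_of_lt_one h0 h1).mul_right K)
    have : ∫ ω, ‖γ ^ j * u j ω‖ ∂Q ≤ ∫ _, γ ^ j * K ∂Q := by
      refine integral_mono ((hu j).const_mul _).norm (integrable_const _) fun ω => ?_
      rw [Real.norm_eq_abs, abs_mul, abs_of_nonneg (pow_nonneg h0 j)]
      exact mul_le_mul_of_nonneg_left (hK j ω) (pow_nonneg h0 j)
    simpa using this

variable {γ R : ℝ} {r : S → ℝ}

theorem valueFun_eq_tsum (h0 : 0 ≤ γ) (h1 : γ < 1) (hr : ∀ x, |r x| ≤ R) (x : S) :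
    valueFun P γ r x = ∑' j : ℕ, γ ^ j * (meanOp P)^[j] r x := by
  rw [valueFun, integral_tsum_pow_mul (trajLaw P x) h0 h1 (u := fun j ω => r (ω j))
    (fun j => integrable_eval_trajLaw P x ⟨R, hr⟩ j) fun j ω => hr (ω j)]
  exact tsum_congr fun j => by rw [integral_eval_trajLaw P x ⟨R, hr⟩]

theorem abs_valueFun_le (h0 : 0 ≤ γ) (h1 : γ < 1) (hr : ∀ x, |r x| ≤ R) (x : S) :
    |valueFun P γ r x| ≤ R / (1 - γ) := by
  rw [valueFun_eq_tsum P h0 h1 hr]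
  exact abs_tsum_pow_mul_le h0 h1 fun l => abs_iterate_meanOp_le P hr l x

/-- The Bellman equation. Together with boundedness it is all that the error analysis needs to know
about the value function. -/
theorem valueFun_eq_add (h0 : 0 ≤ γ) (h1 : γ < 1) (hr : ∀ x, |r x| ≤ R) (x : S) :
    valueFun P γ r x = r x + γ * meanOp P (valueFun P γ r) x := by
  have e : meanOp P (valueFun P γ r) x = ∑' j : ℕ, γ ^ j * (meanOp P)^[j + 1] r x := by
    rw [meanOp]
    simp_rw [valueFun_eq_tsum P h0 h1 hr]
    rw [integral_tsum_pow_mul (P x) h0 h1 (u := fun j y => (meanOp P)^[j] r y)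
      (fun j => ((IsBdd.of_abs_le hr).iterate_meanOp P j).integrable _)
      fun j y => abs_iterate_meanOp_le P hr j y]
    refine tsum_congr fun j => ?_
    rw [Function.iterate_succ_apply']
    rfl
  rw [e, valueFun_eq_tsum P h0 h1 hr, (summable_pow_mul_of_abs_le h0 h1
    fun l => abs_iterate_meanOp_le P hr l x).tsum_eq_zero_add, ← tsum_mul_left]
  simp only [pow_zero, one_mul, Function.iterate_zero, id_eq]
  congr 1
  exact tsum_congr fun j => by rw [pow_succ]; ring

end Value

/-! ### Correlations along the stationary chain -/

section ChainCorrelation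

variable {S : Type*} [MeasurableSpace S] [Countable S] [MeasurableSingletonClass S]
  {P : Kernel S S} [IsMarkovKernel P] {Ω : Type*} [MeasurableSpace Ω] {Pr : Measure Ω}
  [IsProbabilityMeasure Pr] {X : ℕ → Ω → S}

/-- The path-probability form of the Markov property says precisely that the two laws agree on
singletons, which suffices on a countable space. -/
theorem IsMarkovChain.map_history (hX : IsMarkovChain Pr P X) {n : ℕ} (hn : 1 ≤ n) :
    Pr.map (fun ω => ((fun k : Finset.Icc 1 n => X k ω), X (n + 1) ω)) =
      (Pr.map fun ω => (fun k : Finset.Icc 1 n => X k ω)) ⊗ₘ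
        (P.comap (fun h : Finset.Icc 1 n → S => h ⟨n, Finset.mem_Icc.2 ⟨hn, le_rfl⟩⟩)
          (measurable_pi_apply _)) := by
  have hm : Measurable fun ω => (fun k : Finset.Icc 1 n => X k ω) :=
    measurable_pi_lambda _ fun k => hX.1 k (Finset.mem_Icc.1 k.2).1
  have hm1 : Measurable (X (n + 1)) := hX.1 _ (by omega)
  have := Measure.isProbabilityMeasure_map (μ := Pr) hm.aemeasurable
  refine Measure.ext_of_singleton fun p => ?_
  obtain ⟨h, y⟩ := p
  rw [← Set.singleton_prod_singleton, Measure.compProd_apply_prod (measurableSet_singleton _)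
    (measurableSet_singleton _), lintegral_singleton, Kernel.comap_apply,
    Measure.map_apply hm (measurableSet_singleton _), Set.singleton_prod_singleton,
    Measure.map_apply (hm.prodMk hm1) (measurableSet_singleton _)]
  -- The history h extended by the value y; the values beyond n+1 are irrelevant.
  set x : ℕ → S := fun k => if hk : k ∈ Finset.Icc 1 n then h ⟨k, hk⟩ else y with hx
  have hxn : x (n + 1) = y := by simp [hx]
  have hxk : ∀ k (hk : k ∈ Finset.Icc 1 n), x k = h ⟨k, hk⟩ := fun k hk => by
    simp only [hx]; rw [dif_pos hk]
  have hhist : (fun ω => (fun k : Finset.Icc 1 n => X k ω)) ⁻¹' {h} =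
      {ω | ∀ k ∈ Finset.Icc 1 n, X k ω = x k} := by
    ext ω
    simp only [Set.mem_preimage, Set.mem_singleton_iff, Set.mem_ofPred_eq, funext_iff,
      Subtype.forall]
    exact forall₂_congr fun k hk => by rw [hxk k hk]
  have hpair : (fun ω => ((fun k : Finset.Icc 1 n => X k ω), X (n + 1) ω)) ⁻¹' {(h, y)} =
      {ω | ∀ k ∈ Finset.Icc 1 (n + 1), X k ω = x k} := by
    ext ω
    rw [Set.mem_preimage, Set.mem_singleton_iff, Prod.mk.injEq]
    have := Set.ext_iff.1 hhist ω
    simp only [Set.mem_preimage, Set.mem_singleton_iff, Set.mem_ofPred_eq] at this ⊢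
    rw [this]
    constructor
    · rintro ⟨h1, h2⟩ k hk
      rcases eq_or_ne k (n + 1) with rfl | hne
      · rw [h2, hxn]
      · exact h1 k (by rw [Finset.mem_Icc] at hk ⊢; omega)
    · intro h1
      refine ⟨fun k hk => h1 k ?_, ?_⟩
      · rw [Finset.mem_Icc] at hk ⊢; omega
      · rw [h1 (n + 1) (by rw [Finset.mem_Icc]; omega), hxn]
  rw [hpair, hhist, hX.2 n hn x, hxn, hxk n (Finset.mem_Icc.2 ⟨hn, le_rfl⟩), mul_comm]

theorem IsMarkovChain.integral_mul_eval_succ (hX : IsMarkovChain Pr P X) {k n : ℕ} (hk : 1 ≤ k)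
    (hkn : k ≤ n) {f g : S → ℝ} (hf : IsBdd f) (hg : IsBdd g) :
    ∫ ω, f (X k ω) * g (X (n + 1) ω) ∂Pr = ∫ ω, f (X k ω) * meanOp P g (X n ω) ∂Pr := by
  have hn : 1 ≤ n := hk.trans hkn
  have hm : Measurable fun ω => (fun k : Finset.Icc 1 n => X k ω) :=
    measurable_pi_lambda _ fun k => hX.1 k (Finset.mem_Icc.1 k.2).1
  have hm1 : Measurable (X (n + 1)) := hX.1 _ (by omega)
  have := Measure.isProbabilityMeasure_map (μ := Pr) hm.aemeasurable
  set F : (Finset.Icc 1 n → S) × S → ℝ := fun p => f (p.1 ⟨k, Finset.mem_Icc.2 ⟨hk, hkn⟩⟩) * g p.2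
    with hF
  have hFb : IsBdd F := by
    obtain ⟨K, hK⟩ := hf
    obtain ⟨M, hM⟩ := hg
    exact IsBdd.mul ⟨K, fun p => hK _⟩ ⟨M, fun p => hM _⟩
  have h1 : ∫ ω, f (X k ω) * g (X (n + 1) ω) ∂Pr =
      ∫ p, F p ∂(Pr.map (fun ω => ((fun k : Finset.Icc 1 n => X k ω), X (n + 1) ω))) := by
    rw [integral_map (hm.prodMk hm1).aemeasurable
      (Measurable.of_discrete (f := F)).aestronglyMeasurable]
  rw [h1, hX.map_history hn, Measure.integral_compProd (hFb.integrable _),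
    integral_map hm.aemeasurable Measurable.of_discrete.aestronglyMeasurable]
  congr 1
  funext ω
  simp only [hF, Kernel.comap_apply]
  exact integral_const_mul _ _

variable {μ : Measure S} [IsProbabilityMeasure μ]

theorem IsMarkovChain.integral_eval (hX : IsMarkovChain Pr P X) (hP : P.Invariant μ)
    (h1 : Pr.map (X 1) = μ) {k : ℕ} (hk : 1 ≤ k) {f : S → ℝ} (hf : IsBdd f) :
    ∫ ω, f (X k ω) ∂Pr = ∫ x, f x ∂μ := by
  induction k, hk using Nat.le_induction generalizing f with
  | base =>
    rw [← h1, integral_map (hX.1 1 le_rfl).aemeasurable Measurable.of_discrete.aestronglyMeasurable]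
  | succ n hn ih =>
    have h := hX.integral_mul_eval_succ hn le_rfl (f := fun _ => 1) ⟨1, by simp⟩ hf
    simp only [one_mul] at h
    rw [h, ih (hf.meanOp P), integral_meanOp hP hf]

/-- Each step of lag is traded for one application of P to g, down to lag zero, where stationarity
of X_k applies. -/
theorem IsMarkovChain.integral_mul_eval (hX : IsMarkovChain Pr P X) (hP : P.Invariant μ)
    (h1 : Pr.map (X 1) = μ) {k : ℕ} (hk : 1 ≤ k) {f g : S → ℝ} (hf : IsBdd f) (hg : IsBdd g)
    (l : ℕ) : ∫ ω, f (X k ω) * g (X (k + l) ω) ∂Pr = stepCorr P μ l f g := by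
  induction l generalizing g with
  | zero => exact hX.integral_eval hP h1 hk (hf.mul hg)
  | succ l ih =>
    rw [← add_assoc, hX.integral_mul_eval_succ hk (Nat.le_add_right k l) hf hg, ih (hg.meanOp P)]
    rfl

end ChainCorrelation

/-! ### An Azuma–Hoeffding inequality along residue classes -/

section Azuma

variable {Ω : Type*} {mΩ : MeasurableSpace Ω} {Pr : Measure Ω} [IsProbabilityMeasure Pr]

/-- Convexity of exp: on [-c, c] the graph lies below its chord, whose equation is the right-hand
side. -/
theorem exp_mul_le_cosh_add {c : ℝ} (hc : 0 < c) {x : ℝ} (hx : |x| ≤ c) (s : ℝ) :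
    Real.exp (s * x) ≤ Real.cosh (s * c) + Real.sinh (s * c) / c * x := by
  obtain ⟨h1, h2⟩ := abs_le.1 hx
  have p1 : 0 ≤ (c + x) / (2 * c) := div_nonneg (by linarith) (by linarith)
  have p2 : 0 ≤ (c - x) / (2 * c) := div_nonneg (by linarith) (by linarith)
  have p3 : (c + x) / (2 * c) + (c - x) / (2 * c) = 1 := by field_simp; ring
  have h := convexOn_exp.2 (Set.mem_univ (s * c)) (Set.mem_univ (-(s * c))) p1 p2 p3
  simp only [smul_eq_mul] at h
  have e : (c + x) / (2 * c) * (s * c) + (c - x) / (2 * c) * -(s * c) = s * x := by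
    field_simp; ring
  rw [e] at h
  refine h.trans (le_of_eq ?_)
  rw [Real.cosh_eq, Real.sinh_eq]
  field_simp
  ring

theorem integrable_exp_mul_of_abs_le {f : Ω → ℝ} {K : ℝ} (hf : AEStronglyMeasurable f Pr)
    (hK : ∀ᵐ ω ∂Pr, |f ω| ≤ K) (s : ℝ) : Integrable (fun ω => Real.exp (s * f ω)) Pr := by
  refine Integrable.of_bound
    (Real.continuous_exp.comp_aestronglyMeasurable (hf.const_mul s)) (Real.exp (|s| * K)) ?_
  filter_upwards [hK] with ω h
  rw [Real.norm_eq_abs, Real.abs_exp, Real.exp_le_exp]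
  calc s * f ω ≤ |s * f ω| := le_abs_self _
    _ = |s| * |f ω| := abs_mul _ _
    _ ≤ |s| * K := mul_le_mul_of_nonneg_left h (abs_nonneg _)

theorem ae_abs_sum_le {Y : ℕ → Ω → ℝ} {c : ℝ} (hc : ∀ j, ∀ᵐ ω ∂Pr, |Y j ω| ≤ c) (J : ℕ) :
    ∀ᵐ ω ∂Pr, |∑ j ∈ Finset.range J, Y j ω| ≤ J * c := by
  filter_upwards [ae_all_iff.2 hc] with ω h
  calc |∑ j ∈ Finset.range J, Y j ω| ≤ ∑ j ∈ Finset.range J, |Y j ω| :=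
        Finset.abs_sum_le_sum_abs _ _
    _ ≤ ∑ _j ∈ Finset.range J, c := Finset.sum_le_sum fun j _ => h j
    _ = J * c := by simp

variable {Y : ℕ → Ω → ℝ} {c : ℝ}

/-- Hoeffding's argument uses the martingale property only through `horth`: it removes the linear
term of the chord bound, so each increment multiplies the exponential moment by at most cosh(sc) ≤
exp((sc)²/2). -/
theorem mgf_sum_le_of_orthogonal (hc0 : 0 < c) (hY : ∀ j, AEStronglyMeasurable (Y j) Pr)
    (hc : ∀ j, ∀ᵐ ω ∂Pr, |Y j ω| ≤ c)
    (horth : ∀ J (s : ℝ), ∫ ω, Real.exp (s * ∑ j ∈ Finset.range J, Y j ω) * Y J ω ∂Pr = 0)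
    (s : ℝ) (J : ℕ) :
    ∫ ω, Real.exp (s * ∑ j ∈ Finset.range J, Y j ω) ∂Pr ≤ Real.exp (J * (s * c) ^ 2 / 2) := by
  have hint : ∀ J, Integrable (fun ω => Real.exp (s * ∑ j ∈ Finset.range J, Y j ω)) Pr := fun J =>
    integrable_exp_mul_of_abs_le
      (Finset.aestronglyMeasurable_fun_sum _ fun j _ => hY j) (ae_abs_sum_le hc J) s
  induction J with
  | zero => simp
  | succ J ih =>
    have hZY : Integrable (fun ω => Real.exp (s * ∑ j ∈ Finset.range J, Y j ω) * Y J ω) Pr :=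
      (hint J).mul_bdd (c := c) (hY J) (hc J)
    calc ∫ ω, Real.exp (s * ∑ j ∈ Finset.range (J + 1), Y j ω) ∂Pr
        ≤ ∫ ω, (Real.cosh (s * c) * Real.exp (s * ∑ j ∈ Finset.range J, Y j ω) +
            Real.sinh (s * c) / c *
              (Real.exp (s * ∑ j ∈ Finset.range J, Y j ω) * Y J ω)) ∂Pr := by
          refine integral_mono_ae (hint _) (((hint J).const_mul _).add (hZY.const_mul _)) ?_
          filter_upwards [hc J] with ω h
          rw [Finset.sum_range_succ, mul_add, Real.exp_add]
          have := mul_le_mul_of_nonneg_left (exp_mul_le_cosh_add hc0 h s)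
            (Real.exp_pos (s * ∑ j ∈ Finset.range J, Y j ω)).le
          linarith
      _ = Real.cosh (s * c) * ∫ ω, Real.exp (s * ∑ j ∈ Finset.range J, Y j ω) ∂Pr := by
          rw [integral_add ((hint J).const_mul _) (hZY.const_mul _), integral_const_mul,
            integral_const_mul, horth, mul_zero, add_zero]
      _ ≤ Real.exp ((s * c) ^ 2 / 2) * Real.exp (J * (s * c) ^ 2 / 2) :=
          mul_le_mul (Real.cosh_le_exp_half_sq _) ih (integral_nonneg fun _ => (Real.exp_pos _).le)
            (Real.exp_pos _).le
      _ = Real.exp ((J + 1 : ℕ) * (s * c) ^ 2 / 2) := by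
          rw [← Real.exp_add]
          congr 1
          push_cast
          ring

theorem measure_sum_ge_le_of_orthogonal (hc0 : 0 < c) (hY : ∀ j, AEStronglyMeasurable (Y j) Pr)
    (hc : ∀ j, ∀ᵐ ω ∂Pr, |Y j ω| ≤ c)
    (horth : ∀ J (s : ℝ), ∫ ω, Real.exp (s * ∑ j ∈ Finset.range J, Y j ω) * Y J ω ∂Pr = 0)
    {J : ℕ} (hJ : 0 < J) {ε : ℝ} (hε : 0 ≤ ε) :
    Pr.real {ω | ε ≤ ∑ j ∈ Finset.range J, Y j ω} ≤ Real.exp (-(ε ^ 2 / (2 * J * c ^ 2))) := by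
  have hJ' : (0 : ℝ) < J := Nat.cast_pos.2 hJ
  -- The minimiser of -sε + J(sc)²/2 in the Chernoff bound.
  set s : ℝ := ε / (J * c ^ 2) with hs
  have hs0 : 0 ≤ s := by positivity
  have h := measure_ge_le_exp_mul_mgf (μ := Pr) (X := fun ω => ∑ j ∈ Finset.range J, Y j ω) ε hs0
    (integrable_exp_mul_of_abs_le (Finset.aestronglyMeasurable_fun_sum _ fun j _ => hY j)
      (ae_abs_sum_le hc J) s)
  refine h.trans ((mul_le_mul_of_nonneg_left
    (mgf_sum_le_of_orthogonal hc0 hY hc horth s J) (Real.exp_pos _).le).trans (le_of_eq ?_))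
  rw [← Real.exp_add, hs]
  congr 1
  field_simp
  ring

theorem measure_abs_sum_ge_le_of_orthogonal (hc0 : 0 < c)
    (hY : ∀ j, AEStronglyMeasurable (Y j) Pr) (hc : ∀ j, ∀ᵐ ω ∂Pr, |Y j ω| ≤ c)
    (horth : ∀ J (s : ℝ), ∫ ω, Real.exp (s * ∑ j ∈ Finset.range J, Y j ω) * Y J ω ∂Pr = 0)
    {J : ℕ} (hJ : 0 < J) {ε : ℝ} (hε : 0 ≤ ε) :
    Pr.real {ω | ε ≤ |∑ j ∈ Finset.range J, Y j ω|} ≤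
      2 * Real.exp (-(ε ^ 2 / (2 * J * c ^ 2))) := by
  have h1 := measure_sum_ge_le_of_orthogonal hc0 hY hc horth hJ hε
  have h2 := measure_sum_ge_le_of_orthogonal (Y := fun j ω => -Y j ω) hc0 (fun j => (hY j).neg)
    (fun j => by simpa using hc j) (fun J s => by
      have := horth J (-s)
      simp only [Finset.sum_neg_distrib, mul_neg, integral_neg, neg_eq_zero]
      simpa [neg_mul] using this) hJ hε
  have hsub : {ω | ε ≤ |∑ j ∈ Finset.range J, Y j ω|} ⊆
      {ω | ε ≤ ∑ j ∈ Finset.range J, Y j ω} ∪ {ω | ε ≤ ∑ j ∈ Finset.range J, -Y j ω} := by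
    intro ω hω
    rcases le_abs.1 (show ε ≤ |∑ j ∈ Finset.range J, Y j ω| from hω) with h | h
    · exact Or.inl h
    · exact Or.inr (by simpa using h)
  refine (measureReal_mono hsub).trans ((measureReal_union_le _ _).trans ?_)
  linarith

theorem sum_range_mul_eq (f : ℕ → ℝ) (a J : ℕ) :
    ∑ i ∈ Finset.range (J * a), f i =
      ∑ r ∈ Finset.range a, ∑ j ∈ Finset.range J, f (r + j * a) := by
  induction J with
  | zero => simp
  | succ J ih =>
    rw [Nat.succ_mul, Finset.sum_range_add, ih, ← Finset.sum_add_distrib]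
    exact Finset.sum_congr rfl fun r _ => by rw [Finset.sum_range_succ, add_comm (J * a) r]

theorem integral_mul_sub_condExp {m : MeasurableSpace Ω} (hm : m ≤ mΩ) {Z g : Ω → ℝ}
    (hZ : StronglyMeasurable[m] Z) (hg : Integrable g Pr) (hZg : Integrable (Z * g) Pr) :
    ∫ ω, Z ω * (g ω - (Pr[g|m]) ω) ∂Pr = 0 := by
  have h1 := condExp_mul_of_stronglyMeasurable_left (μ := Pr) hZ hZg hg
  have h2 : Integrable (fun ω => Z ω * (Pr[g|m]) ω) Pr := integrable_condExp.congr h1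
  simp_rw [mul_sub]
  have h3 : ∫ ω, Z ω * (Pr[g|m]) ω ∂Pr = ∫ ω, Z ω * g ω ∂Pr := by
    rw [← integral_condExp hm (f := fun ω => Z ω * g ω)]
    exact integral_congr_ae h1.symm
  have h4 : Integrable (fun ω => Z ω * g ω) Pr := hZg
  rw [integral_sub h4 h2, h3, sub_self]

/-- Deviations of a bounded adapted sequence from its conditional means `a` steps before. -/
theorem measure_abs_sum_sub_condExp_ge_le {F : ℕ → MeasurableSpace Ω} (hF : Monotone F)
    (hFle : ∀ t, F t ≤ mΩ) {G : ℕ → Ω → ℝ} (hc0 : 0 < c) (hG : ∀ i ω, |G i ω| ≤ c)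
    (hGm : ∀ i, Measurable[F (i + 2)] (G i)) {a : ℕ} (ha : 0 < a) (N : ℕ) {ε : ℝ} (hε : 0 < ε) :
    Pr.real {ω | ε ≤ |∑ i ∈ Finset.range N, (G i ω - (Pr[G i|F (i + 2 - a)]) ω)|} ≤
      a * (2 * Real.exp (-((ε / a) ^ 2 / (2 * ((N / a + 1 : ℕ) : ℝ) * (2 * c) ^ 2)))) := by
  have ha' : (0 : ℝ) < a := Nat.cast_pos.2 ha
  have hGint : ∀ i, Integrable (G i) Pr := fun i => Integrable.of_bound
    ((hGm i).mono (hFle _) le_rfl).aestronglyMeasurable c (Eventually.of_forall (hG i))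
  -- Increments are set to zero from N on, so that every residue class mod a has the same number J
  -- of terms.
  set D : ℕ → Ω → ℝ := fun i ω => if i < N then G i ω - (Pr[G i|F (i + 2 - a)]) ω else 0 with hD
  have hDm : ∀ i, StronglyMeasurable[F (i + 2)] (D i) := fun i => by
    by_cases h : i < N
    · simp only [hD, h, if_true]
      exact (hGm i).stronglyMeasurable.sub
        (stronglyMeasurable_condExp.mono (hF (Nat.sub_le _ _)))
    · simp only [hD, h, if_false]
      exact stronglyMeasurable_const
  have hDb : ∀ i, ∀ᵐ ω ∂Pr, |D i ω| ≤ 2 * c := fun i => by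
    by_cases h : i < N
    · have := ae_bdd_abs_condExp_of_ae_bdd_abs (m := F (i + 2 - a)) (μ := Pr)
        (Eventually.of_forall (hG i))
      filter_upwards [this] with ω hω
      simp only [hD, h, if_true]
      have := abs_sub (G i ω) ((Pr[G i|F (i + 2 - a)]) ω)
      linarith [hG i ω]
    · simp only [hD, h, if_false, abs_zero]
      exact Eventually.of_forall fun _ => by positivity
  set J : ℕ := N / a + 1 with hJ
  have hsum : ∀ ω, ∑ i ∈ Finset.range N, (G i ω - (Pr[G i|F (i + 2 - a)]) ω) =
      ∑ r ∈ Finset.range a, ∑ j ∈ Finset.range J, D (r + j * a) ω := by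
    intro ω
    rw [← sum_range_mul_eq fun i => D i ω]
    have hNJ : N ≤ J * a := by
      rw [hJ, mul_comm]; exact (Nat.lt_mul_div_succ N ha).le
    rw [← Finset.sum_subset (Finset.range_mono hNJ)]
    · refine Finset.sum_congr rfl fun i hi => ?_
      simp only [hD, Finset.mem_range.1 hi, if_true]
    · intro i _ hi
      rw [Finset.mem_range] at hi
      simp only [hD, hi, if_false]
  have hres : ∀ r, Pr.real {ω | ε / a ≤ |∑ j ∈ Finset.range J, D (r + j * a) ω|} ≤
      2 * Real.exp (-((ε / a) ^ 2 / (2 * (J : ℝ) * (2 * c) ^ 2))) := fun r => by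
    refine measure_abs_sum_ge_le_of_orthogonal (Y := fun j => D (r + j * a)) (by positivity)
      (fun j => ((hDm _).mono (hFle _)).aestronglyMeasurable) (fun j => hDb _) (fun K s => ?_)
      (Nat.succ_pos _) (by positivity)
    by_cases h : r + K * a < N
    · have e : ∀ ω, D (r + K * a) ω =
          G (r + K * a) ω - (Pr[G (r + K * a)|F (r + K * a + 2 - a)]) ω := fun ω => by
        simp only [hD, h, if_true]
      simp_rw [e]
      -- Earlier indices of the class are at most r + Ka - a, so their increments are known at time
      -- r + Ka + 2 - a, the time of the conditioning.
      have hZ : StronglyMeasurable[F (r + K * a + 2 - a)]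
          fun ω => Real.exp (s * ∑ j ∈ Finset.range K, D (r + j * a) ω) := by
        refine Real.continuous_exp.comp_stronglyMeasurable (StronglyMeasurable.const_mul ?_ s)
        refine Finset.stronglyMeasurable_fun_sum _ fun j hj => (hDm _).mono (hF ?_)
        rw [Finset.mem_range] at hj
        have : (j + 1) * a ≤ K * a := Nat.mul_le_mul_right a hj
        rw [Nat.succ_mul] at this
        omega
      refine integral_mul_sub_condExp (hFle _) hZ (hGint _) ?_
      exact (integrable_exp_mul_of_abs_le ((Finset.aestronglyMeasurable_fun_sum _ fun j _ =>
        ((hDm _).mono (hFle _)).aestronglyMeasurable)) (ae_abs_sum_le (fun j => hDb _) K) s).mul_bdd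
        (c := c) (hGint _).aestronglyMeasurable (Eventually.of_forall (hG _))
    · simp only [hD, h, if_false, mul_zero, integral_zero]
  have hsub : {ω | ε ≤ |∑ i ∈ Finset.range N, (G i ω - (Pr[G i|F (i + 2 - a)]) ω)|} ⊆
      ⋃ r ∈ Finset.range a, {ω | ε / a ≤ |∑ j ∈ Finset.range J, D (r + j * a) ω|} := by
    intro ω hω
    replace hω : ε ≤ |∑ i ∈ Finset.range N, (G i ω - (Pr[G i|F (i + 2 - a)]) ω)| := hω
    by_contra hcon
    simp only [Set.mem_iUnion, not_exists] at hcon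
    have hcon' : ∀ r ∈ Finset.range a, |∑ j ∈ Finset.range J, D (r + j * a) ω| < ε / a :=
      fun r hr => not_le.1 (hcon r hr)
    rw [hsum] at hω
    have := (Finset.abs_sum_le_sum_abs _ _).trans_lt
      (Finset.sum_lt_sum_of_nonempty (Finset.nonempty_range_iff.2 ha.ne') hcon')
    rw [Finset.sum_const, Finset.card_range, nsmul_eq_mul, mul_div_cancel₀ _ ha'.ne'] at this
    linarith
  calc _ ≤ _ := measureReal_mono hsub (measure_ne_top _ _)
    _ ≤ _ := measureReal_biUnion_finset_le _ _
    _ ≤ ∑ _r ∈ Finset.range a, _ := Finset.sum_le_sum fun r _ => hres r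
    _ = _ := by rw [Finset.sum_const, Finset.card_range, nsmul_eq_mul]

end Azuma

/-! ### Conditional means under mixing -/

section Mixing

variable {Ω : Type*} {m 𝓖 : MeasurableSpace Ω} {mΩ : MeasurableSpace Ω} {Pr : Measure Ω} [IsProbabilityMeasure Pr]

/-- Layer-cake formula: the left side is the integral over t in (0, K] of the covariance of A with
the event h ≥ t. -/
theorem setIntegral_sub_le_of_mixing {A : Set Ω} (h𝓖 : 𝓖 ≤ mΩ) {β K : ℝ}
    (hK : 0 ≤ K) {h : Ω → ℝ} (hh0 : ∀ ω, 0 ≤ h ω) (hhK : ∀ ω, h ω ≤ K) (hhm : Measurable[𝓖] h)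
    (hβ : ∀ B, MeasurableSet[𝓖] B → Pr.real (A ∩ B) - Pr.real A * Pr.real B ≤ β) :
    ∫ ω in A, h ω ∂Pr - Pr.real A * ∫ ω, h ω ∂Pr ≤ K * β := by
  have hint : Integrable h Pr := Integrable.of_bound (hhm.mono h𝓖 le_rfl).aestronglyMeasurable K
    (Eventually.of_forall fun ω => by rw [Real.norm_eq_abs, abs_of_nonneg (hh0 ω)]; exact hhK ω)
  have hset : ∀ t : ℝ, MeasurableSet[𝓖] {ω | t ≤ h ω} := fun t =>
    hhm measurableSet_Ici
  have e1 := hint.integral_eq_integral_Ioc_meas_le (Eventually.of_forall hh0)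
    (Eventually.of_forall hhK)
  have e2 := (hint.restrict (s := A)).integral_eq_integral_Ioc_meas_le
    (Eventually.of_forall hh0) (Eventually.of_forall hhK)
  have anti1 : Antitone fun t : ℝ => Pr.real {ω | t ≤ h ω} := fun s t hst =>
    measureReal_mono fun ω (hω : t ≤ h ω) => hst.trans hω
  have anti2 : Antitone fun t : ℝ => (Pr.restrict A).real {ω | t ≤ h ω} := fun s t hst =>
    measureReal_mono fun ω (hω : t ≤ h ω) => hst.trans hω
  have i1 : IntegrableOn (fun t : ℝ => Pr.real {ω | t ≤ h ω}) (Set.Ioc 0 K) :=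
    ((anti1.intervalIntegrable (μ := volume) (a := 0) (b := K))).1
  have i2 : IntegrableOn (fun t : ℝ => (Pr.restrict A).real {ω | t ≤ h ω}) (Set.Ioc 0 K) :=
    ((anti2.intervalIntegrable (μ := volume) (a := 0) (b := K))).1
  rw [e1, e2, ← integral_const_mul, ← integral_sub i2 (i1.const_mul _)]
  calc _ ≤ ∫ _ in Set.Ioc 0 K, β := by
        refine integral_mono (i2.sub (i1.const_mul _)) (integrable_const _) fun t => ?_
        have hm := hset t
        rw [measureReal_restrict_apply (h𝓖 _ hm), Set.inter_comm]
        exact hβ _ hm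
    _ = K * β := by simp [hK]

/-- If the conditional probabilities of the events of `𝓖` given `m` are in the mean `β`-close to
their probabilities, then so are conditional means of bounded functions. -/
theorem integral_abs_condExp_sub_le (hm : m ≤ mΩ) (h𝓖 : 𝓖 ≤ mΩ)
    {β c : ℝ} (hc : 0 ≤ c) {g : Ω → ℝ} (hg : ∀ ω, |g ω| ≤ c) (hgm : Measurable[𝓖] g)
    (hβ : ∀ B, MeasurableSet[𝓖] B → ∫ ω, |(Pr⟦B|m⟧) ω - Pr.real B| ∂Pr ≤ β) :
    ∫ ω, |(Pr[g|m]) ω - ∫ ω', g ω' ∂Pr| ∂Pr ≤ 4 * c * β := by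
  have hgint : Integrable g Pr := Integrable.of_bound (hgm.mono h𝓖 le_rfl).aestronglyMeasurable c
    (Eventually.of_forall hg)
  set u : Ω → ℝ := fun ω => (Pr[g|m]) ω - ∫ ω', g ω' ∂Pr with hu
  have huint : Integrable u Pr := integrable_condExp.sub (integrable_const _)
  -- The deviation u has mean zero, so its L¹ norm is twice its integral over A, and A belongs to m.
  -- This reduces the claim to a covariance bound for the fixed event A; shifting g by c makes it
  -- range in [0, 2c], whence 2 · 2c · β.
  set A : Set Ω := {ω | 0 ≤ u ω} with hA
  have hAm : MeasurableSet[m] A :=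
    (stronglyMeasurable_condExp.measurable.sub_const _) measurableSet_Ici
  have hAm' : MeasurableSet A := hm _ hAm
  have hu0 : ∫ ω, u ω ∂Pr = 0 := by
    rw [hu, integral_sub integrable_condExp (integrable_const _), integral_condExp hm]
    simp
  have habs : ∫ ω, |u ω| ∂Pr = 2 * ∫ ω in A, u ω ∂Pr := by
    have e1 := integral_add_compl hAm' huint
    have e2 := integral_add_compl hAm' huint.abs
    have e3 : ∫ ω in A, |u ω| ∂Pr = ∫ ω in A, u ω ∂Pr :=
      setIntegral_congr_fun hAm' fun ω (hω : 0 ≤ u ω) => abs_of_nonneg hω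
    have e4 : ∫ ω in Aᶜ, |u ω| ∂Pr = -∫ ω in Aᶜ, u ω ∂Pr := by
      rw [← integral_neg]
      exact setIntegral_congr_fun hAm'.compl fun ω (hω : ¬ 0 ≤ u ω) => abs_of_neg (not_le.1 hω)
    rw [← e2, e3, e4]
    linarith
  have hev : ∀ B, MeasurableSet[𝓖] B → Pr.real (A ∩ B) - Pr.real A * Pr.real B ≤ β := by
    intro B hB
    have hB' := h𝓖 _ hB
    have hi : Integrable (B.indicator fun _ => (1 : ℝ)) Pr :=
      (integrable_const (1 : ℝ)).indicator hB'
    have hi2 : Integrable (fun ω => (Pr⟦B|m⟧) ω - Pr.real B) Pr :=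
      integrable_condExp.sub (integrable_const _)
    have e1 : ∫ ω in A, ((Pr⟦B|m⟧) ω - Pr.real B) ∂Pr =
        Pr.real (A ∩ B) - Pr.real A * Pr.real B := by
      rw [integral_sub integrable_condExp.integrableOn (integrable_const _).integrableOn,
        setIntegral_condExp hm hi hAm, setIntegral_indicator hB']
      simp
    rw [← e1]
    calc _ ≤ ∫ ω in A, |(Pr⟦B|m⟧) ω - Pr.real B| ∂Pr :=
          integral_mono hi2.integrableOn hi2.abs.integrableOn fun ω => le_abs_self _
      _ ≤ ∫ ω, |(Pr⟦B|m⟧) ω - Pr.real B| ∂Pr :=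
          setIntegral_le_integral hi2.abs (Eventually.of_forall fun ω => abs_nonneg _)
      _ ≤ β := hβ B hB
  have hmain := setIntegral_sub_le_of_mixing (h := fun ω => g ω + c) h𝓖
    (by positivity : 0 ≤ 2 * c) (fun ω => by linarith [(abs_le.1 (hg ω)).1])
    (fun ω => by linarith [(abs_le.1 (hg ω)).2]) (hgm.add_const c) hev
  have e5 : ∫ ω in A, u ω ∂Pr =
      ∫ ω in A, (g ω + c) ∂Pr - Pr.real A * ∫ ω, (g ω + c) ∂Pr := by
    rw [hu, integral_sub integrable_condExp.integrableOn (integrable_const _).integrableOn,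
      setIntegral_condExp hm hgint hAm,
      integral_add hgint.integrableOn (integrable_const _).integrableOn,
      integral_add hgint (integrable_const _)]
    simp
    ring
  rw [habs, e5]
  linarith

variable {S : Type*} [MeasurableSpace S] {X : ℕ → Ω → S}

theorem past_le (hX : ∀ n ≥ 1, Measurable (X n)) (t : ℕ) : past X t ≤ mΩ :=
  iSup₂_le fun k hk => (hX k hk.1).comap_le

theorem future_le (hX : ∀ n ≥ 1, Measurable (X n)) {t : ℕ} (ht : 1 ≤ t) : future X t ≤ mΩ :=
  iSup₂_le fun k hk => (hX k (ht.trans hk)).comap_le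

theorem past_mono : Monotone (past X) := fun _ _ hst =>
  biSup_mono fun _ hk => ⟨hk.1, hk.2.trans hst⟩

theorem measurable_past {t k : ℕ} (h1 : 1 ≤ k) (h2 : k ≤ t) : Measurable[past X t] (X k) :=
  Measurable.of_comap_le (le_iSup₂_of_le k ⟨h1, h2⟩ le_rfl)

theorem measurable_future {t k : ℕ} (h : t ≤ k) : Measurable[future X t] (X k) :=
  Measurable.of_comap_le (le_iSup₂_of_le k h le_rfl)

theorem past_zero : past X 0 = ⊥ := by
  rw [eq_bot_iff]
  refine iSup₂_le fun k hk => ?_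
  obtain ⟨h1, h2⟩ := hk
  omega

theorem IsExpBetaMixing.integral_abs_condExp_indicator_le {βbar b κ : ℝ} (hβbar : 0 ≤ βbar)
    (h : IsExpBetaMixing Pr X βbar b κ) {t i : ℕ} (ht : 1 ≤ t) (hi : 1 ≤ i) {B : Set Ω}
    (hB : MeasurableSet[future X (t + i)] B) :
    ∫ ω, |(Pr⟦B|past X t⟧) ω - Pr.real B| ∂Pr ≤ βbar * Real.exp (-b * (i : ℝ) ^ κ) := by
  have h1 : ∫⁻ ω, ENNReal.ofReal |(Pr⟦B|past X t⟧) ω - Pr.real B| ∂Pr ≤ betaCoeff Pr X i := by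
    refine le_trans (lintegral_mono fun ω => ?_) (le_iSup₂ (f := fun t (_ : 1 ≤ t) =>
      ∫⁻ ω, ⨆ B : Set Ω, ⨆ _ : MeasurableSet[future X (t + i)] B,
        ENNReal.ofReal |(Pr⟦B | past X t⟧) ω - Pr.real B| ∂Pr) t ht)
    exact le_iSup₂ (f := fun (B : Set Ω) (_ : MeasurableSet[future X (t + i)] B) =>
      ENNReal.ofReal |(Pr⟦B | past X t⟧) ω - Pr.real B|) B hB
  have h2 := h1.trans (h.2 i hi)
  have hint : Integrable (fun ω => |(Pr⟦B|past X t⟧) ω - Pr.real B|) Pr :=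
    (integrable_condExp.sub (integrable_const _)).abs
  rw [← ofReal_integral_eq_lintegral_ofReal hint (Eventually.of_forall fun ω => abs_nonneg _),
    ENNReal.ofReal_le_ofReal_iff (by positivity)] at h2
  exact h2

/-- The case t = 0 is included for summands too early to have a past a steps before: there the
conditioning is trivial and the difference vanishes. -/
theorem IsExpBetaMixing.integral_abs_condExp_past_sub_le {βbar b κ : ℝ} (hβbar : 0 ≤ βbar)
    (h : IsExpBetaMixing Pr X βbar b κ) (hX : ∀ n ≥ 1, Measurable (X n)) {t i : ℕ} (hi : 1 ≤ i)
    {c : ℝ} (hc : 0 ≤ c) {g : Ω → ℝ} (hg : ∀ ω, |g ω| ≤ c)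
    (hgm : 1 ≤ t → Measurable[future X (t + i)] g) :
    ∫ ω, |(Pr[g|past X t]) ω - ∫ ω', g ω' ∂Pr| ∂Pr ≤
      4 * c * (βbar * Real.exp (-b * (i : ℝ) ^ κ)) := by
  rcases Nat.eq_zero_or_pos t with rfl | ht
  · rw [past_zero, condExp_bot]
    simp only [sub_self, abs_zero, integral_zero]
    positivity
  · exact integral_abs_condExp_sub_le (past_le hX t) (future_le hX (by omega)) hc hg (hgm ht)
      fun B hB => h.integral_abs_condExp_indicator_le hβbar ht hi hB

end Mixing

/-! ### Concentration of vector-valued sums -/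

section Concentration

variable {S Ω : Type*} [MeasurableSpace S] {mΩ : MeasurableSpace Ω} {Pr : Measure Ω}
  [IsProbabilityMeasure Pr] {X : ℕ → Ω → S} {ι : Type*} [Fintype ι] [Nonempty ι]
  {βbar b κ : ℝ}

/-- Minkowski for a vector M bounded coordinatewise and a vector R bounded in ℓ¹; the ℓ¹ bound
dominates the Euclidean one, so R carries no dimension factor. -/
theorem sum_sq_add_le {M R : ι → ℝ} {T₁ T₂ : ℝ} (hT : 0 ≤ T₁) (hM : ∀ i, |M i| ≤ T₁)
    (hR : ∑ i, |R i| ≤ T₂) :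
    ∑ i, (M i + R i) ^ 2 ≤ (Real.sqrt (Fintype.card ι) * T₁ + T₂) ^ 2 := by
  have hs : (1 : ℝ) ≤ Real.sqrt (Fintype.card ι) :=
    Real.one_le_sqrt.2 (by exact_mod_cast Fintype.card_pos)
  have hR0 : 0 ≤ ∑ i, |R i| := Finset.sum_nonneg fun i _ => abs_nonneg _
  have h1 : ∀ i, (M i + R i) ^ 2 ≤ T₁ ^ 2 + 2 * T₁ * |R i| + |R i| * ∑ j, |R j| := by
    intro i
    have a1 : |M i + R i| ≤ T₁ + |R i| := (abs_add_le _ _).trans (by linarith [hM i])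
    have a2 : |R i| ≤ ∑ j, |R j| :=
      Finset.single_le_sum (f := fun j => |R j|) (fun j _ => abs_nonneg _) (Finset.mem_univ i)
    have a3 : (M i + R i) ^ 2 ≤ (T₁ + |R i|) ^ 2 := by
      rw [← sq_abs (M i + R i)]
      exact pow_le_pow_left₀ (abs_nonneg _) a1 2
    nlinarith [abs_nonneg (R i)]
  calc ∑ i, (M i + R i) ^ 2 ≤ ∑ i, (T₁ ^ 2 + 2 * T₁ * |R i| + |R i| * ∑ j, |R j|) :=
        Finset.sum_le_sum fun i _ => h1 i
    _ = Fintype.card ι * T₁ ^ 2 + 2 * T₁ * (∑ i, |R i|) + (∑ i, |R i|) * ∑ i, |R i| := by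
        rw [Finset.sum_add_distrib, Finset.sum_add_distrib, ← Finset.mul_sum, ← Finset.sum_mul]
        simp
    _ ≤ Fintype.card ι * T₁ ^ 2 + 2 * (Real.sqrt (Fintype.card ι) * T₁) * T₂ + T₂ * T₂ := by
        have b1 : 2 * T₁ * (∑ i, |R i|) ≤ 2 * (Real.sqrt (Fintype.card ι) * T₁) * T₂ := by
          have : T₁ ≤ Real.sqrt (Fintype.card ι) * T₁ := le_mul_of_one_le_left hT hs
          exact mul_le_mul (by linarith) hR hR0 (by positivity)
        have b2 : (∑ i, |R i|) * ∑ i, |R i| ≤ T₂ * T₂ := mul_self_le_mul_self hR0 hR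
        linarith
    _ = (Real.sqrt (Fintype.card ι) * T₁ + T₂) ^ 2 := by
        have : Real.sqrt (Fintype.card ι) ^ 2 = Fintype.card ι := Real.sq_sqrt (Nat.cast_nonneg _)
        rw [add_sq, mul_pow, this]
        ring

/-- The centred sum splits into M, deviations from conditional means given the past w+k steps
earlier, and R, the deviations of those conditional means from the means. A union bound over
coordinates with Azuma controls M, and Markov's inequality with mixing over the gap k controls R. -/
theorem IsExpBetaMixing.measure_not_sum_sq_le (hmix : IsExpBetaMixing Pr X βbar b κ)
    (hβbar : 0 ≤ βbar) (hX : ∀ n ≥ 1, Measurable (X n)) {c : ℝ} (hc : 0 < c)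
    {G : ι → ℕ → Ω → ℝ} (hG : ∀ j i ω, |G j i ω| ≤ c) {w k : ℕ} (hk : 1 ≤ k)
    (hpast : ∀ j i, Measurable[past X (i + 2)] (G j i))
    (hfut : ∀ j i, w + k ≤ i + 1 → Measurable[future X (i + 2 - w)] (G j i)) (N : ℕ)
    {T₁ T₂ : ℝ} (hT₁ : 0 < T₁) (hT₂ : 0 < T₂) :
    Pr.real {ω | ¬ ∑ j, (∑ i ∈ Finset.range N, (G j i ω - ∫ ω', G j i ω' ∂Pr)) ^ 2 ≤
        (Real.sqrt (Fintype.card ι) * T₁ + T₂) ^ 2} ≤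
      Fintype.card ι * ((w + k : ℕ) * (2 * Real.exp (-((T₁ / (w + k : ℕ)) ^ 2 /
        (2 * ((N / (w + k) + 1 : ℕ) : ℝ) * (2 * c) ^ 2))))) +
      Fintype.card ι * N * (4 * c * (βbar * Real.exp (-b * (k : ℝ) ^ κ))) / T₂ := by
  set a : ℕ := w + k with ha
  set M : ι → Ω → ℝ := fun j ω =>
    ∑ i ∈ Finset.range N, (G j i ω - (Pr[G j i|past X (i + 2 - a)]) ω) with hM
  set R : ι → Ω → ℝ := fun j ω =>
    ∑ i ∈ Finset.range N, ((Pr[G j i|past X (i + 2 - a)]) ω - ∫ ω', G j i ω' ∂Pr) with hR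
  set β : ℝ := βbar * Real.exp (-b * (k : ℝ) ^ κ) with hβ
  have hint : ∀ j i, Integrable
      (fun ω => (Pr[G j i|past X (i + 2 - a)]) ω - ∫ ω', G j i ω' ∂Pr) Pr := fun j i =>
    integrable_condExp.sub (integrable_const _)
  have hRint : ∀ j, Integrable (R j) Pr := fun j => integrable_finsetSum _ fun i _ => hint j i
  have hRle : ∀ j, ∫ ω, |R j ω| ∂Pr ≤ N * (4 * c * β) := fun j => by
    calc ∫ ω, |R j ω| ∂Pr ≤ ∫ ω, ∑ i ∈ Finset.range N,
          |(Pr[G j i|past X (i + 2 - a)]) ω - ∫ ω', G j i ω' ∂Pr| ∂Pr :=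
          integral_mono (hRint j).abs (integrable_finsetSum _ fun i _ => (hint j i).abs)
            fun ω => Finset.abs_sum_le_sum_abs _ _
      _ = ∑ i ∈ Finset.range N,
          ∫ ω, |(Pr[G j i|past X (i + 2 - a)]) ω - ∫ ω', G j i ω' ∂Pr| ∂Pr :=
          integral_finsetSum _ fun i _ => (hint j i).abs
      _ ≤ ∑ _i ∈ Finset.range N, 4 * c * β := by
          refine Finset.sum_le_sum fun i _ =>
            hmix.integral_abs_condExp_past_sub_le hβbar hX hk hc.le (hG j i) fun ht => ?_
          -- This needs the conditioning time i + 2 - a to be positive, the only case in which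
          -- measurability in the future is asked for.
          have e : i + 2 - a + k = i + 2 - w := by omega
          rw [e]
          exact hfut j i (by omega)
      _ = N * (4 * c * β) := by simp
  have hRsum : ∫ ω, ∑ j, |R j ω| ∂Pr ≤ Fintype.card ι * N * (4 * c * β) := by
    rw [integral_finsetSum _ fun j _ => (hRint j).abs]
    refine (Finset.sum_le_sum fun j _ => hRle j).trans (le_of_eq ?_)
    rw [Finset.sum_const, Finset.card_univ, nsmul_eq_mul]
    ring
  have hmarkov : Pr.real {ω | T₂ ≤ ∑ j, |R j ω|} ≤ Fintype.card ι * N * (4 * c * β) / T₂ := by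
    rw [le_div_iff₀ hT₂, mul_comm]
    exact (mul_meas_ge_le_integral_of_nonneg
      (Eventually.of_forall fun ω => Finset.sum_nonneg fun j _ => abs_nonneg _)
      (integrable_finsetSum _ fun j _ => (hRint j).abs) T₂).trans hRsum
  have hazuma : ∀ j, Pr.real {ω | T₁ ≤ |M j ω|} ≤ a * (2 * Real.exp (-((T₁ / a) ^ 2 /
        (2 * ((N / a + 1 : ℕ) : ℝ) * (2 * c) ^ 2)))) := fun j =>
    measure_abs_sum_sub_condExp_ge_le past_mono (past_le hX) hc (hG j) (hpast j) (by omega) N hT₁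
  have hsub : {ω | ¬ ∑ j, (∑ i ∈ Finset.range N, (G j i ω - ∫ ω', G j i ω' ∂Pr)) ^ 2 ≤
        (Real.sqrt (Fintype.card ι) * T₁ + T₂) ^ 2} ⊆
      (⋃ j ∈ Finset.univ, {ω | T₁ ≤ |M j ω|}) ∪ {ω | T₂ ≤ ∑ j, |R j ω|} := by
    intro ω hω
    by_contra hcon
    rw [Set.mem_union, not_or] at hcon
    obtain ⟨h1, h2⟩ := hcon
    simp only [Finset.mem_univ, Set.iUnion_true, Set.mem_iUnion, not_exists] at h1
    refine hω ?_
    have h := sum_sq_add_le (M := fun j => M j ω) (R := fun j => R j ω) hT₁.le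
      (fun j => (not_le.1 (h1 j)).le) (not_le.1 h2).le
    refine le_of_eq_of_le (Finset.sum_congr rfl fun j _ => ?_) h
    simp only [hM, hR]
    rw [← Finset.sum_add_distrib]
    simp only [sub_add_sub_cancel]
  calc _ ≤ _ := measureReal_mono hsub (measure_ne_top _ _)
    _ ≤ _ := measureReal_union_le _ _
    _ ≤ _ := add_le_add ((measureReal_biUnion_finset_le _ _).trans
      (Finset.sum_le_sum fun j _ => hazuma j)) hmarkov
    _ = _ := by rw [Finset.sum_const, Finset.card_univ, nsmul_eq_mul]

/-! #### The choice of the gap and of the thresholds -/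

theorem exp_neg_Lambda {N : ℕ} (hN : 1 ≤ N) {δ : ℝ} (hδ : 0 < δ) :
    Real.exp (-Lambda βbar N δ) =
      δ / (8 * (N : ℝ) ^ 2) / max (4 * Real.exp 1 ^ 2) (N * βbar) := by
  have hN' : (0 : ℝ) < N := by exact_mod_cast hN
  have hm : 0 < max (4 * Real.exp 1 ^ 2) (N * βbar) := lt_max_of_lt_left (by positivity)
  rw [Lambda, neg_add, Real.exp_add, ← Real.log_inv, ← Real.log_inv, Real.exp_log (by positivity),
    Real.exp_log (by positivity), inv_div, div_eq_mul_inv (δ / _)]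

theorem one_le_Lambda {N : ℕ} (hN : 1 ≤ N) {δ : ℝ} (hδ : δ ∈ Set.Ioo (0 : ℝ) 1) :
    1 ≤ Lambda βbar N δ := by
  have hN' : (1 : ℝ) ≤ N := by exact_mod_cast hN
  have h0 := hδ.1
  have h1 : 0 ≤ Real.log (8 * (N : ℝ) ^ 2 / δ) := by
    refine Real.log_nonneg ?_
    rw [le_div_iff₀ h0]
    nlinarith [hδ.2]
  have h2 : 1 ≤ Real.log (max (4 * Real.exp 1 ^ 2) (N * βbar)) := by
    rw [Real.le_log_iff_exp_le (lt_max_of_lt_left (by positivity))]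
    refine le_max_of_le_left ?_
    nlinarith [Real.add_one_le_exp (1 : ℝ)]
  rw [Lambda]
  linarith

theorem one_le_rpow_max {N : ℕ} {δ : ℝ} (hκ : 0 < κ) :
    1 ≤ max (Lambda βbar N δ / b) 1 ^ (1 / κ) :=
  Real.one_le_rpow (le_max_right _ _) (by positivity)

theorem le_mixI {N : ℕ} (hN : 1 ≤ N) {δ : ℝ} (hδ : δ ∈ Set.Ioo (0 : ℝ) 1) (hκ : 0 < κ) :
    32 ≤ mixI βbar b κ N δ := by
  have h1 := one_le_Lambda (βbar := βbar) hN hδ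
  have h2 := one_le_rpow_max (βbar := βbar) (b := b) (N := N) (δ := δ) hκ
  rw [mixI]
  nlinarith

theorem Lambda_le_mul_rpow {N : ℕ} {δ : ℝ} (hb : 0 < b) (hκ : 0 < κ) :
    Lambda βbar N δ ≤ b * ((⌈max (Lambda βbar N δ / b) 1 ^ (1 / κ)⌉₊ : ℕ) : ℝ) ^ κ := by
  have h1 : max (Lambda βbar N δ / b) 1 ≤
      ((⌈max (Lambda βbar N δ / b) 1 ^ (1 / κ)⌉₊ : ℕ) : ℝ) ^ κ := by
    have h0 : 0 ≤ max (Lambda βbar N δ / b) 1 := zero_le_one.trans (le_max_right _ _)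
    calc max (Lambda βbar N δ / b) 1 = (max (Lambda βbar N δ / b) 1 ^ (1 / κ)) ^ κ := by
          rw [← Real.rpow_mul h0, one_div_mul_cancel hκ.ne', Real.rpow_one]
      _ ≤ _ := Real.rpow_le_rpow (Real.rpow_nonneg h0 _) (Nat.le_ceil _) hκ.le
  have h2 := (le_max_left _ _).trans h1
  rwa [div_le_iff₀' hb] at h2

set_option maxHeartbeats 400000 in
/-- Concentration of a sum of `N` vectors with bounded coordinates that depend on windows of
length `w + 1`. -/
theorem IsExpBetaMixing.measure_not_sum_sq_le_mixI (hmix : IsExpBetaMixing Pr X βbar b κ)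
    (hβbar : 0 < βbar) (hb : 0 < b) (hκ : 0 < κ) (hX : ∀ n ≥ 1, Measurable (X n)) {c : ℝ}
    (hc : 0 < c) {G : ι → ℕ → Ω → ℝ} (hG : ∀ j i ω, |G j i ω| ≤ c) {w : ℕ}
    (hpast : ∀ j i, Measurable[past X (i + 2)] (G j i))
    (hfut : ∀ j i, w ≤ i → Measurable[future X (i + 2 - w)] (G j i)) {N : ℕ} (hN : 1 ≤ N)
    {δ : ℝ} (hδ : δ ∈ Set.Ioo (0 : ℝ) 1)
    (hbig : 16 * Fintype.card ι * ((w + 1) * mixI βbar b κ N δ) ≤ N) :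
    Pr.real {ω | ¬ ∑ j, (∑ i ∈ Finset.range N, (G j i ω - ∫ ω', G j i ω' ∂Pr)) ^ 2 ≤
        Fintype.card ι * (2 * c) ^ 2 * ((w + 1) * mixI βbar b κ N δ * N)} ≤
      δ / (8 * (N : ℝ) ^ 2) := by
  have hN' : (1 : ℝ) ≤ N := by exact_mod_cast hN
  set D : ℝ := (Fintype.card ι : ℝ) with hD
  have hD1 : 1 ≤ D := by
    have : 1 ≤ Fintype.card ι := Fintype.card_pos
    rw [hD]; exact_mod_cast this
  set Λ := Lambda βbar N δ with hΛ
  set E : ℝ := max (Λ / b) 1 ^ (1 / κ) with hE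
  have hΛ1 : 1 ≤ Λ := one_le_Lambda hN hδ
  have hE1 : 1 ≤ E := one_le_rpow_max hκ
  have hI : mixI βbar b κ N δ = 32 * Λ * E := rfl
  set W : ℝ := (w + 1) * mixI βbar b κ N δ with hW
  have hw0 : (0 : ℝ) ≤ w := Nat.cast_nonneg w
  have hW32 : 32 ≤ W := by
    have h := le_mixI (βbar := βbar) (b := b) hN hδ hκ
    exact h.trans (le_mul_of_one_le_left (by linarith) (by linarith))
  -- The gap is the least integer above (max(Λ/b, 1))^(1/κ), which makes b k^κ ≥ Λ.
  set k : ℕ := ⌈E⌉₊ with hk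
  have hkE : (k : ℝ) < E + 1 := Nat.ceil_lt_add_one (by linarith)
  have hk1 : 1 ≤ k := Nat.one_le_ceil_iff.2 (by linarith)
  set a : ℝ := ((w + k : ℕ) : ℝ) with ha
  have ha0 : 1 ≤ a := by rw [ha]; exact_mod_cast (by omega : 1 ≤ w + k)
  have haW : 16 * Λ * a ≤ W := by
    have h1 : a ≤ w + 1 + E := by rw [ha]; push_cast; linarith
    have h2 : w + 1 + E ≤ 2 * ((w + 1) * E) := by
      have e1 : 0 ≤ (w + 1) * (E - 1) := mul_nonneg (by linarith) (by linarith)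
      have e2 : 0 ≤ w * E := mul_nonneg hw0 (by linarith)
      linarith
    have h3 := mul_le_mul_of_nonneg_left (h1.trans h2) (by positivity : 0 ≤ 16 * Λ)
    rw [hW, hI]
    linarith
  set Q : ℝ := W * N with hQ
  have hQ0 : 0 < Q := by positivity
  have hsQ := Real.sqrt_pos.2 hQ0
  have hsQ2 : Real.sqrt Q ^ 2 = Q := Real.sq_sqrt hQ0.le
  have hsD : 0 < Real.sqrt D := Real.sqrt_pos.2 (by linarith)
  have hsD2 : Real.sqrt D ^ 2 = D := Real.sq_sqrt (by linarith)
  -- The target 2c√(DQ) is shared as 3/2 for the martingale part and 1/2 for the bias.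
  set T₁ : ℝ := 3 / 2 * c * Real.sqrt Q with hT₁
  set T₂ : ℝ := Real.sqrt D * (1 / 2 * c * Real.sqrt Q) with hT₂
  have hT₁0 : 0 < T₁ := by positivity
  have hT₂0 : 0 < T₂ := by positivity
  have hmain := hmix.measure_not_sum_sq_le hβbar.le hX hc hG hk1 hpast
    (fun j i hi => hfut j i (by omega)) N hT₁0 hT₂0
  have hsum : (Real.sqrt D * T₁ + T₂) ^ 2 = D * (2 * c) ^ 2 * Q := by
    rw [hT₁, hT₂]
    calc _ = Real.sqrt D ^ 2 * (2 * c) ^ 2 * Real.sqrt Q ^ 2 := by ring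
      _ = _ := by rw [hsD2, hsQ2]
  rw [hsum] at hmain
  refine hmain.trans ?_
  have hδ0 := hδ.1
  have hmax : 4 ≤ max (4 * Real.exp 1 ^ 2) (N * βbar) := by
    refine le_max_of_le_left ?_
    nlinarith [Real.add_one_le_exp (1 : ℝ)]
  have hexp := exp_neg_Lambda (βbar := βbar) hN hδ0
  rw [← hΛ] at hexp
  set p : ℝ := δ / (8 * (N : ℝ) ^ 2) with hp
  have hp0 : 0 < p := by positivity
  have hpN : p * N ≤ 1 / 8 := by
    rw [hp, div_mul_eq_mul_div, div_le_iff₀ (by positivity)]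
    have e1 : δ * N ≤ 1 * N := mul_le_mul_of_nonneg_right hδ.2.le (by linarith)
    have e2 : (N : ℝ) * 1 ≤ N * N := mul_le_mul_of_nonneg_left hN' (by linarith)
    linarith
  have hexp1 : Real.exp (-Λ) ≤ p := by
    rw [hexp]
    exact div_le_self hp0.le (by linarith)
  have hexp2 : N * βbar * Real.exp (-Λ) ≤ p := by
    rw [hexp, mul_div_assoc', div_le_iff₀ (by linarith), mul_comm]
    exact mul_le_mul_of_nonneg_left (le_max_right _ _) hp0.le
  -- the martingale part
  have hDaN : 256 * D * a ≤ N := by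
    calc 256 * D * a ≤ 256 * D * a * Λ := le_mul_of_one_le_right (by positivity) hΛ1
      _ = 16 * D * (16 * Λ * a) := by ring
      _ ≤ 16 * D * W := mul_le_mul_of_nonneg_left haW (by positivity)
      _ ≤ N := hbig
  have hJ : (((N / (w + k) + 1 : ℕ)) : ℝ) ≤ 9 / 8 * (N / a) := by
    have h1 : ((N / (w + k) : ℕ) : ℝ) ≤ N / a := Nat.cast_div_le
    have h2 : 8 ≤ N / a := by
      rw [le_div_iff₀ (by linarith)]
      have : a ≤ D * a := le_mul_of_one_le_left (by linarith) hD1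
      linarith
    push_cast at h1 ⊢
    linarith
  have hJ0 : (0 : ℝ) < ((N / (w + k) + 1 : ℕ) : ℝ) := by positivity
  -- An exponent 2Λ instead of Λ makes each Azuma term at most p². One factor p then pays for the
  -- union bound over the D·a pairs of a coordinate and a residue class, because D·a ≤ N and pN ≤
  -- 1/8.
  have hexpo : 2 * Λ ≤ (T₁ / a) ^ 2 / (2 * ((N / (w + k) + 1 : ℕ) : ℝ) * (2 * c) ^ 2) := by
    rw [le_div_iff₀ (by positivity), div_pow, le_div_iff₀ (by positivity)]
    have e1 : T₁ ^ 2 = 9 / 4 * c ^ 2 * Q := by rw [hT₁, mul_pow, mul_pow, hsQ2]; ring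
    rw [e1, hQ]
    calc 2 * Λ * (2 * ((N / (w + k) + 1 : ℕ) : ℝ) * (2 * c) ^ 2) * a ^ 2
        ≤ 2 * Λ * (2 * (9 / 8 * (N / a)) * (2 * c) ^ 2) * a ^ 2 := by gcongr
      _ = 9 / 8 * c ^ 2 * (16 * Λ * a * N) := by field_simp; ring
      _ ≤ 9 / 4 * c ^ 2 * (W * N) := by
          have : 16 * Λ * a * N ≤ W * N := mul_le_mul_of_nonneg_right haW (by linarith)
          have h0 : 0 ≤ c ^ 2 * (W * N) := by positivity
          have h1 := mul_le_mul_of_nonneg_left this (sq_nonneg c)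
          linarith
  have hpart1 : D * (a * (2 * Real.exp (-((T₁ / a) ^ 2 /
      (2 * ((N / (w + k) + 1 : ℕ) : ℝ) * (2 * c) ^ 2))))) ≤ p / 2 := by
    have h1 : Real.exp (-((T₁ / a) ^ 2 / (2 * ((N / (w + k) + 1 : ℕ) : ℝ) * (2 * c) ^ 2))) ≤
        p * p := by
      calc _ ≤ Real.exp (-Λ + -Λ) := Real.exp_le_exp.2 (by linarith)
        _ = Real.exp (-Λ) * Real.exp (-Λ) := Real.exp_add _ _
        _ ≤ p * p := mul_le_mul hexp1 hexp1 (Real.exp_pos _).le hp0.le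
    calc _ ≤ D * (a * (2 * (p * p))) := by gcongr
      _ = (D * a) * (2 * p * p) := by ring
      _ ≤ N * (2 * p * p) := by
          refine mul_le_mul_of_nonneg_right ?_ (by positivity)
          have : 0 ≤ D * a := by positivity
          linarith
      _ = (p * N) * (2 * p) := by ring
      _ ≤ 1 / 8 * (2 * p) := mul_le_mul_of_nonneg_right hpN (by positivity)
      _ ≤ p / 2 := by linarith
  -- the bias part
  have hT₂ge : 2 * D * c * W ≤ T₂ := by
    have h1 : 4 * Real.sqrt D * W ≤ Real.sqrt Q := by
      refine Real.le_sqrt_of_sq_le ?_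
      calc (4 * Real.sqrt D * W) ^ 2 = 16 * Real.sqrt D ^ 2 * W * W := by ring
        _ = W * (16 * D * W) := by rw [hsD2]; ring
        _ ≤ W * N := mul_le_mul_of_nonneg_left hbig (by linarith)
    calc 2 * D * c * W = Real.sqrt D * (1 / 2 * c * (4 * Real.sqrt D * W)) := by
          nth_rewrite 1 [← hsD2]; ring
      _ ≤ T₂ := by rw [hT₂]; gcongr
  have hpart2 : D * N * (4 * c * (βbar * Real.exp (-b * (k : ℝ) ^ κ))) / T₂ ≤ p / 2 := by
    have h1 : Real.exp (-b * (k : ℝ) ^ κ) ≤ Real.exp (-Λ) := by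
      rw [Real.exp_le_exp, neg_mul, neg_le_neg_iff]
      exact Lambda_le_mul_rpow hb hκ
    rw [div_le_iff₀ hT₂0]
    calc D * N * (4 * c * (βbar * Real.exp (-b * (k : ℝ) ^ κ)))
        ≤ D * N * (4 * c * (βbar * Real.exp (-Λ))) := by gcongr
      _ = 4 * D * c * (N * βbar * Real.exp (-Λ)) := by ring
      _ ≤ 4 * D * c * p := by gcongr
      _ ≤ p / 2 * (2 * D * c * W) := by
          have h0 : 0 < D * c * p := by positivity
          have h1 := mul_le_mul_of_nonneg_left hW32 h0.le
          linarith
      _ ≤ p / 2 * T₂ := by gcongr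
  linarith

end Concentration

/-! ### Concentration of the temporal-difference sums -/

section TDSum

variable {S : Type*}

/-- The eligibility trace of `ψ` at time `i + 1`, cut to the last `w` terms. -/
def cutTrace (α : ℝ) (ψ : S → ℝ) (X : ℕ → S) (w i : ℕ) : ℝ :=
  ∑ l ∈ Finset.range w, α ^ l * ψ (X (i + 1 - l))

/-- The sum over times `1, …, N` of the products of the eligibility trace of `ψ` and the temporal
difference `f(X_i) - γ g(X_{i+1})`. -/
def tdSum (α γ : ℝ) (ψ f g : S → ℝ) (X : ℕ → S) (N : ℕ) : ℝ :=
  ∑ i ∈ Finset.range N, cutTrace α ψ X (i + 1) i * (f (X (i + 1)) - γ * g (X (i + 2)))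

theorem sum_pow_le {α : ℝ} (h0 : 0 ≤ α) (h1 : α < 1) (w : ℕ) :
    ∑ l ∈ Finset.range w, α ^ l ≤ 1 / (1 - α) := by
  rw [one_div, ← tsum_geometric_of_lt_one h0 h1]
  exact (summable_geometric_of_lt_one h0 h1).sum_le_tsum _ fun l _ => pow_nonneg h0 l

theorem abs_cutTrace_le {α : ℝ} (h0 : 0 ≤ α) (h1 : α < 1) {ψ : S → ℝ} {L : ℝ} (hL : 0 ≤ L)
    (hψ : ∀ x, |ψ x| ≤ L) (X : ℕ → S) (w i : ℕ) : |cutTrace α ψ X w i| ≤ L / (1 - α) := by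
  calc |cutTrace α ψ X w i| ≤ ∑ l ∈ Finset.range w, |α ^ l * ψ (X (i + 1 - l))| :=
        Finset.abs_sum_le_sum_abs _ _
    _ ≤ ∑ l ∈ Finset.range w, α ^ l * L := Finset.sum_le_sum fun l _ => by
        rw [abs_mul, abs_of_nonneg (pow_nonneg h0 l)]
        exact mul_le_mul_of_nonneg_left (hψ _) (pow_nonneg h0 l)
    _ ≤ 1 / (1 - α) * L := by
        rw [← Finset.sum_mul]; exact mul_le_mul_of_nonneg_right (sum_pow_le h0 h1 w) hL
    _ = L / (1 - α) := by ring

theorem abs_cutTrace_sub_le {α : ℝ} (h0 : 0 ≤ α) (h1 : α < 1) {ψ : S → ℝ} {L : ℝ} (hL : 0 ≤ L)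
    (hψ : ∀ x, |ψ x| ≤ L) (X : ℕ → S) (w i : ℕ) :
    |cutTrace α ψ X (i + 1) i - cutTrace α ψ X (min (i + 1) w) i| ≤ L / (1 - α) * α ^ w := by
  have hc : 0 ≤ L / (1 - α) * α ^ w :=
    mul_nonneg (div_nonneg hL (by linarith)) (pow_nonneg h0 w)
  rcases le_total (i + 1) w with h | h
  · rw [min_eq_left h, sub_self, abs_zero]; exact hc
  · rw [min_eq_right h]
    obtain ⟨m, hm⟩ := Nat.exists_eq_add_of_le h
    have e : cutTrace α ψ X (i + 1) i - cutTrace α ψ X w i =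
        ∑ l ∈ Finset.range m, α ^ (w + l) * ψ (X (i + 1 - (w + l))) := by
      simp only [cutTrace]
      conv_lhs => rw [show Finset.range (i + 1) = Finset.range (w + m) by rw [hm]]
      rw [Finset.sum_range_add, add_sub_cancel_left]
    rw [e]
    calc _ ≤ ∑ l ∈ Finset.range m, |α ^ (w + l) * ψ (X (i + 1 - (w + l)))| :=
          Finset.abs_sum_le_sum_abs _ _
      _ ≤ ∑ l ∈ Finset.range m, α ^ l * (α ^ w * L) := Finset.sum_le_sum fun l _ => by
          rw [abs_mul, abs_of_nonneg (pow_nonneg h0 _), pow_add, mul_comm (α ^ w), mul_assoc]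
          exact mul_le_mul_of_nonneg_left (mul_le_mul_of_nonneg_left (hψ _) (pow_nonneg h0 w))
            (pow_nonneg h0 l)
      _ ≤ 1 / (1 - α) * (α ^ w * L) := by
          rw [← Finset.sum_mul]
          exact mul_le_mul_of_nonneg_right (sum_pow_le h0 h1 m)
            (mul_nonneg (pow_nonneg h0 w) hL)
      _ = L / (1 - α) * α ^ w := by ring

theorem sum_sq_add_le_of_abs_le {ι : Type*} [Fintype ι] {u v : ι → ℝ} {A B : ℝ} (hA : 0 ≤ A)
    (hB : 0 ≤ B) (hu : ∑ i, u i ^ 2 ≤ A ^ 2) (hv : ∀ i, |v i| ≤ B) :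
    ∑ i, (u i + v i) ^ 2 ≤ (A + Real.sqrt (Fintype.card ι) * B) ^ 2 := by
  have hs2 : Real.sqrt (Fintype.card ι) ^ 2 = Fintype.card ι := Real.sq_sqrt (Nat.cast_nonneg _)
  have hv2 : ∑ i, v i ^ 2 ≤ (Real.sqrt (Fintype.card ι) * B) ^ 2 := by
    rw [mul_pow, hs2]
    calc ∑ i, v i ^ 2 ≤ ∑ _i : ι, B ^ 2 := Finset.sum_le_sum fun i _ => by
          rw [← sq_abs]; exact pow_le_pow_left₀ (abs_nonneg _) (hv i) 2
      _ = _ := by simp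
  have huv : ∑ i, u i * v i ≤ A * (Real.sqrt (Fintype.card ι) * B) := by
    refine le_of_sq_le_sq ?_ (by positivity)
    rw [mul_pow]
    exact (Finset.sum_mul_sq_le_sq_mul_sq _ _ _).trans
      (mul_le_mul hu hv2 (Finset.sum_nonneg fun i _ => sq_nonneg _) (sq_nonneg _))
  have e : ∑ i, (u i + v i) ^ 2 = ∑ i, u i ^ 2 + 2 * ∑ i, u i * v i + ∑ i, v i ^ 2 := by
    rw [Finset.mul_sum, ← Finset.sum_add_distrib, ← Finset.sum_add_distrib]
    exact Finset.sum_congr rfl fun i _ => by ring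
  rw [e, add_sq]
  linarith

variable [MeasurableSpace S] [Countable S] [MeasurableSingletonClass S]
  {P : Kernel S S} [IsMarkovKernel P] {μ : Measure S} [IsProbabilityMeasure μ]
  {Ω : Type*} {mΩ : MeasurableSpace Ω} {Pr : Measure Ω} [IsProbabilityMeasure Pr]
  {X : ℕ → Ω → S} {α γ L U : ℝ} {ψ f g : S → ℝ}

theorem measurable_cutTrace {m : MeasurableSpace Ω} {w i : ℕ}
    (h : ∀ l < w, Measurable[m] (X (i + 1 - l))) :
    Measurable[m] fun ω => cutTrace α ψ (fun k => X k ω) w i := by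
  simp only [cutTrace]
  refine Finset.measurable_fun_sum _ fun l hl => Measurable.const_mul ?_ _
  exact (Measurable.of_discrete (f := ψ)).comp (h l (Finset.mem_range.1 hl))

theorem measurable_cutTrace_mul {m : MeasurableSpace Ω} {w i : ℕ}
    (h : ∀ l < w, Measurable[m] (X (i + 1 - l))) (h1 : Measurable[m] (X (i + 1)))
    (h2 : Measurable[m] (X (i + 2))) :
    Measurable[m] fun ω => cutTrace α ψ (fun k => X k ω) w i *
      (f (X (i + 1) ω) - γ * g (X (i + 2) ω)) := by
  refine (measurable_cutTrace h).mul (Measurable.sub ?_ (Measurable.const_mul ?_ _))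
  · exact (Measurable.of_discrete (f := f)).comp h1
  · exact (Measurable.of_discrete (f := g)).comp h2

theorem IsMarkovChain.integral_mul_td (hX : IsMarkovChain Pr P X) (hP : P.Invariant μ)
    (h1 : Pr.map (X 1) = μ) (hψ : IsBdd ψ) (hf : IsBdd f) (hg : IsBdd g) {k : ℕ} (hk : 1 ≤ k)
    (l : ℕ) : Integrable (fun ω => ψ (X k ω) * (f (X (k + l) ω) - γ * g (X (k + l + 1) ω))) Pr ∧
      ∫ ω, ψ (X k ω) * (f (X (k + l) ω) - γ * g (X (k + l + 1) ω)) ∂Pr =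
        stepCorr P μ l ψ f - γ * stepCorr P μ (l + 1) ψ g := by
  have hint : ∀ {q : S → ℝ} (_ : IsBdd q) (n : ℕ) (_ : 1 ≤ n),
      Integrable (fun ω => ψ (X k ω) * q (X n ω)) Pr := by
    intro q hq n hn
    obtain ⟨K, hK⟩ := hψ
    obtain ⟨M, hM⟩ := hq
    refine Integrable.of_bound (((Measurable.of_discrete (f := ψ)).comp (hX.1 k hk)).mul
      ((Measurable.of_discrete (f := q)).comp (hX.1 n hn))).aestronglyMeasurable (K * M)
      (Eventually.of_forall fun ω => ?_)
    rw [Real.norm_eq_abs, abs_mul]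
    exact mul_le_mul (hK _) (hM _) (abs_nonneg _) ((abs_nonneg _).trans (hK (X k ω)))
  have i1 := hint hf (k + l) (by omega)
  have i2 := hint hg (k + l + 1) (by omega)
  have e : (fun ω => ψ (X k ω) * (f (X (k + l) ω) - γ * g (X (k + l + 1) ω))) =
      fun ω => ψ (X k ω) * f (X (k + l) ω) - γ * (ψ (X k ω) * g (X (k + l + 1) ω)) := by
    funext ω; ring
  rw [e]
  refine ⟨i1.sub (i2.const_mul γ), ?_⟩
  rw [integral_sub i1 (i2.const_mul γ), integral_const_mul,
    hX.integral_mul_eval hP h1 hk hψ hf l, add_assoc, hX.integral_mul_eval hP h1 hk hψ hg (l + 1)]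

theorem IsMarkovChain.abs_corr_le (hX : IsMarkovChain Pr P X) (hP : P.Invariant μ)
    (h1 : Pr.map (X 1) = μ) (hf : IsBdd f) (hg : IsBdd g) (hL : 0 ≤ L)
    (hψL : ∀ x, |ψ x| ≤ L) (hU : ∀ x y, |f x - γ * g y| ≤ U) (l : ℕ) :
    |stepCorr P μ l ψ f - γ * stepCorr P μ (l + 1) ψ g| ≤ L * U := by
  rw [← (hX.integral_mul_td hP h1 ⟨L, hψL⟩ hf hg le_rfl l).2]
  have h := norm_integral_le_of_norm_le_const (μ := Pr)
    (f := fun ω => ψ (X 1 ω) * (f (X (1 + l) ω) - γ * g (X (1 + l + 1) ω))) (C := L * U)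
    (Eventually.of_forall fun ω => by
      rw [Real.norm_eq_abs, abs_mul]
      exact mul_le_mul (hψL _) (hU _ _) (abs_nonneg _) hL)
  simpa using h

theorem IsMarkovChain.integral_cutTrace_mul (hX : IsMarkovChain Pr P X) (hP : P.Invariant μ)
    (h1 : Pr.map (X 1) = μ) (hψ : IsBdd ψ) (hf : IsBdd f) (hg : IsBdd g) {w i : ℕ}
    (hw : w ≤ i + 1) :
    ∫ ω, cutTrace α ψ (fun k => X k ω) w i * (f (X (i + 1) ω) - γ * g (X (i + 2) ω)) ∂Pr =
      ∑ l ∈ Finset.range w, α ^ l * (stepCorr P μ l ψ f - γ * stepCorr P μ (l + 1) ψ g) := by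
  have key : ∀ l ∈ Finset.range w,
      Integrable (fun ω => ψ (X (i + 1 - l) ω) * (f (X (i + 1) ω) - γ * g (X (i + 2) ω))) Pr ∧
      ∫ ω, ψ (X (i + 1 - l) ω) * (f (X (i + 1) ω) - γ * g (X (i + 2) ω)) ∂Pr =
        stepCorr P μ l ψ f - γ * stepCorr P μ (l + 1) ψ g := by
    intro l hl
    rw [Finset.mem_range] at hl
    have h := hX.integral_mul_td (γ := γ) hP h1 hψ hf hg (k := i + 1 - l) (by omega) l
    rwa [Nat.sub_add_cancel (by omega : l ≤ i + 1)] at h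
  simp only [cutTrace]
  simp_rw [Finset.sum_mul, mul_assoc]
  rw [integral_finsetSum _ fun l hl => (key l hl).1.const_mul _]
  exact Finset.sum_congr rfl fun l hl => by rw [integral_const_mul, (key l hl).2]

theorem IsMarkovChain.abs_integral_cutTrace_mul_sub_le (hX : IsMarkovChain Pr P X)
    (hP : P.Invariant μ) (h1 : Pr.map (X 1) = μ) (h0 : 0 ≤ α) (hα1 : α < 1) (hf : IsBdd f)
    (hg : IsBdd g) (hL : 0 ≤ L) (hψL : ∀ x, |ψ x| ≤ L) (hU : ∀ x y, |f x - γ * g y| ≤ U)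
    {w i : ℕ} (hw : w ≤ i + 1) :
    |∫ ω, cutTrace α ψ (fun k => X k ω) w i * (f (X (i + 1) ω) - γ * g (X (i + 2) ω)) ∂Pr -
      tdMean P μ α γ ψ f g| ≤ L * U / (1 - α) * α ^ w := by
  rw [hX.integral_cutTrace_mul hP h1 ⟨L, hψL⟩ hf hg hw, tdMean]
  have hb := hX.abs_corr_le (γ := γ) hP h1 hf hg hL hψL hU
  have hs := summable_pow_mul_of_abs_le h0 hα1 hb
  rw [← hs.sum_add_tsum_nat_add w, sub_add_cancel_left, abs_neg]
  have e : ∑' l, α ^ (l + w) * (stepCorr P μ (l + w) ψ f - γ * stepCorr P μ (l + w + 1) ψ g) =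
      α ^ w * ∑' l, α ^ l * (stepCorr P μ (l + w) ψ f - γ * stepCorr P μ (l + w + 1) ψ g) := by
    rw [← tsum_mul_left]
    exact tsum_congr fun l => by rw [pow_add]; ring
  rw [e, abs_mul, abs_of_nonneg (pow_nonneg h0 w), mul_comm]
  exact mul_le_mul_of_nonneg_right (abs_tsum_pow_mul_le h0 hα1 fun l => hb (l + w))
    (pow_nonneg h0 w)

/-- Cutting the traces to windows of length `w` and replacing the means by the stationary ones
changes the sum by at most `2w + 1/(1-α)` times the bound of the summands. -/
theorem IsMarkovChain.abs_tdSum_sub_le (hX : IsMarkovChain Pr P X) (hP : P.Invariant μ)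
    (h1 : Pr.map (X 1) = μ) (h0 : 0 ≤ α) (hα1 : α < 1) (hf : IsBdd f) (hg : IsBdd g)
    (hL : 0 ≤ L) (hU0 : 0 ≤ U) (hψL : ∀ x, |ψ x| ≤ L) (hU : ∀ x y, |f x - γ * g y| ≤ U)
    {w N : ℕ} (hw1 : 1 ≤ w) (hw : N * α ^ w ≤ 1) (ω : Ω) :
    |tdSum α γ ψ f g (fun k => X k ω) N - N * tdMean P μ α γ ψ f g -
      ∑ i ∈ Finset.range N, (cutTrace α ψ (fun k => X k ω) (min (i + 1) w) i *
        (f (X (i + 1) ω) - γ * g (X (i + 2) ω)) -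
        ∫ ω', cutTrace α ψ (fun k => X k ω') (min (i + 1) w) i *
          (f (X (i + 1) ω') - γ * g (X (i + 2) ω')) ∂Pr)| ≤
      L * U / (1 - α) * (2 * w + 1 / (1 - α)) := by
  set c := L * U / (1 - α) with hc
  have hα : 0 < 1 - α := by linarith
  have hc0 : 0 ≤ c := by positivity
  have hterm : ∀ i, |cutTrace α ψ (fun k => X k ω) (i + 1) i *
        (f (X (i + 1) ω) - γ * g (X (i + 2) ω)) - tdMean P μ α γ ψ f g -
      (cutTrace α ψ (fun k => X k ω) (min (i + 1) w) i *
        (f (X (i + 1) ω) - γ * g (X (i + 2) ω)) -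
        ∫ ω', cutTrace α ψ (fun k => X k ω') (min (i + 1) w) i *
          (f (X (i + 1) ω') - γ * g (X (i + 2) ω')) ∂Pr)| ≤ c * (2 * α ^ w + α ^ i) := by
    intro i
    have b1 := abs_cutTrace_sub_le h0 hα1 hL hψL (fun k => X k ω) w i
    have b2 := hX.abs_integral_cutTrace_mul_sub_le hP h1 h0 hα1 hf hg hL hψL hU
      (Nat.min_le_left (i + 1) w)
    have b3 : |(cutTrace α ψ (fun k => X k ω) (i + 1) i -
        cutTrace α ψ (fun k => X k ω) (min (i + 1) w) i) *
        (f (X (i + 1) ω) - γ * g (X (i + 2) ω))| ≤ c * α ^ w := by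
      rw [abs_mul]
      refine (mul_le_mul b1 (hU _ _) (abs_nonneg _) (by positivity)).trans (le_of_eq ?_)
      rw [hc]; ring
    -- At early times the window is not yet full and the mean is off by a multiple of α^(i+1); these
    -- errors sum to the term 1/(1-α).
    have b4 : α ^ (min (i + 1) w) ≤ α ^ w + α ^ i := by
      rcases le_total (i + 1) w with h | h
      · rw [min_eq_left h, pow_succ]
        have := pow_nonneg h0 w
        have := mul_le_of_le_one_right (pow_nonneg h0 i) hα1.le
        linarith
      · rw [min_eq_right h]
        have := pow_nonneg h0 i
        linarith
    have b5 := mul_le_mul_of_nonneg_left b4 hc0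
    rw [sub_mul] at b3
    rw [abs_le] at b2 b3 ⊢
    constructor <;> linarith [b2.1, b2.2, b3.1, b3.2]
  have e : tdSum α γ ψ f g (fun k => X k ω) N - N * tdMean P μ α γ ψ f g -
      ∑ i ∈ Finset.range N, (cutTrace α ψ (fun k => X k ω) (min (i + 1) w) i *
        (f (X (i + 1) ω) - γ * g (X (i + 2) ω)) -
        ∫ ω', cutTrace α ψ (fun k => X k ω') (min (i + 1) w) i *
          (f (X (i + 1) ω') - γ * g (X (i + 2) ω')) ∂Pr) =
      ∑ i ∈ Finset.range N, (cutTrace α ψ (fun k => X k ω) (i + 1) i *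
        (f (X (i + 1) ω) - γ * g (X (i + 2) ω)) - tdMean P μ α γ ψ f g -
      (cutTrace α ψ (fun k => X k ω) (min (i + 1) w) i *
        (f (X (i + 1) ω) - γ * g (X (i + 2) ω)) -
        ∫ ω', cutTrace α ψ (fun k => X k ω') (min (i + 1) w) i *
          (f (X (i + 1) ω') - γ * g (X (i + 2) ω')) ∂Pr)) := by
    rw [Finset.sum_sub_distrib (f := fun i => cutTrace α ψ (fun k => X k ω) (i + 1) i *
        (f (X (i + 1) ω) - γ * g (X (i + 2) ω)) - tdMean P μ α γ ψ f g),
      Finset.sum_sub_distrib (g := fun _ => tdMean P μ α γ ψ f g), Finset.sum_const,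
      Finset.card_range, nsmul_eq_mul, tdSum]
  rw [e]
  calc _ ≤ ∑ i ∈ Finset.range N, c * (2 * α ^ w + α ^ i) :=
        (Finset.abs_sum_le_sum_abs _ _).trans (Finset.sum_le_sum fun i _ => hterm i)
    _ = c * (2 * (N * α ^ w) + ∑ i ∈ Finset.range N, α ^ i) := by
        rw [← Finset.mul_sum, Finset.sum_add_distrib, Finset.sum_const, Finset.card_range,
          nsmul_eq_mul]
        ring
    -- Here 2Nα^w ≤ 2 ≤ 2w.
    _ ≤ c * (2 * w + 1 / (1 - α)) := by
        refine mul_le_mul_of_nonneg_left (add_le_add ?_ (sum_pow_le h0 hα1 N)) hc0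
        have : (1 : ℝ) ≤ w := by exact_mod_cast hw1
        linarith

end TDSum

/-! ### Deviation probabilities of temporal-difference sums from their stationary means -/

section TDConcentration

variable {S : Type*} [MeasurableSpace S] [Countable S] [MeasurableSingletonClass S]
  {P : Kernel S S} [IsMarkovKernel P] {μ : Measure S} [IsProbabilityMeasure μ]
  {Ω : Type*} {mΩ : MeasurableSpace Ω} {Pr : Measure Ω} [IsProbabilityMeasure Pr]
  {X : ℕ → Ω → S} {α γ L U βbar b κ : ℝ} {ι : Type*} [Fintype ι] [Nonempty ι]
  {ψ f g : ι → S → ℝ}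

theorem IsMarkovChain.measure_not_sum_sq_tdSum_le (hX : IsMarkovChain Pr P X)
    (hP : P.Invariant μ) (h1 : Pr.map (X 1) = μ) (hmix : IsExpBetaMixing Pr X βbar b κ)
    (hβbar : 0 < βbar) (hb : 0 < b) (hκ : 0 < κ) (h0 : 0 ≤ α) (hα1 : α < 1)
    (hf : ∀ j, IsBdd (f j)) (hg : ∀ j, IsBdd (g j)) (hL : 0 < L) (hU0 : 0 ≤ U)
    (hψL : ∀ j x, |ψ j x| ≤ L) (hU : ∀ j x y, |f j x - γ * g j y| ≤ U)
    {w N : ℕ} (hN : 1 ≤ N) (hw1 : 1 ≤ w) (hw : N * α ^ w ≤ 1)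
    {δ : ℝ} (hδ : δ ∈ Set.Ioo (0 : ℝ) 1)
    (hbig : 16 * Fintype.card ι * ((w + 1) * mixI βbar b κ N δ) ≤ N) :
    Pr.real {ω | ¬ ∑ j, (tdSum α γ (ψ j) (f j) (g j) (fun k => X k ω) N -
        N * tdMean P μ α γ (ψ j) (f j) (g j)) ^ 2 ≤
      (N * (Real.sqrt (Fintype.card ι) * (L * U / (1 - α)) *
        (2 / Real.sqrt N * Real.sqrt ((w + 1) * mixI βbar b κ N δ) + 1 / (N * (1 - α)) +
          2 / N * w))) ^ 2} ≤ δ / (8 * (N : ℝ) ^ 2) := by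
  have hα : 0 < 1 - α := by linarith
  rcases hU0.eq_or_lt with rfl | hU0
  -- The concentration lemma needs a positive bound on the summands; for U = 0 the sums and their
  -- means vanish identically.
  · have hz : ∀ j x y, f j x - γ * g j y = 0 := fun j x y =>
      abs_nonpos_iff.1 (hU j x y)
    have hs : ∀ j ω, tdSum α γ (ψ j) (f j) (g j) (fun k => X k ω) N = 0 := fun j ω => by
      simp [tdSum, hz]
    have hm : ∀ j, tdMean P μ α γ (ψ j) (f j) (g j) = 0 := fun j => by
      have h := hX.abs_corr_le (γ := γ) hP h1 (hf j) (hg j) hL.le (hψL j) (hU j)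
      simp only [mul_zero, abs_nonpos_iff] at h
      simp [tdMean, h]
    have hempty : {ω | ¬ ∑ j, (tdSum α γ (ψ j) (f j) (g j) (fun k => X k ω) N -
        N * tdMean P μ α γ (ψ j) (f j) (g j)) ^ 2 ≤
      (N * (Real.sqrt (Fintype.card ι) * (L * 0 / (1 - α)) *
        (2 / Real.sqrt N * Real.sqrt ((w + 1) * mixI βbar b κ N δ) + 1 / (N * (1 - α)) +
          2 / N * w))) ^ 2} = ∅ := by
      ext ω
      simp [hs, hm]
    rw [hempty, measureReal_empty]
    have := hδ.1
    positivity
  set c := L * U / (1 - α) with hc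
  have hc0 : 0 < c := by positivity
  have hN' : (0 : ℝ) < N := by exact_mod_cast hN
  set G : ι → ℕ → Ω → ℝ := fun j i ω => cutTrace α (ψ j) (fun k => X k ω) (min (i + 1) w) i *
    (f j (X (i + 1) ω) - γ * g j (X (i + 2) ω)) with hG
  have hGb : ∀ j i ω, |G j i ω| ≤ c := by
    intro j i ω
    simp only [hG]
    rw [abs_mul]
    refine (mul_le_mul (abs_cutTrace_le h0 hα1 hL.le (hψL j) _ _ _) (hU j _ _) (abs_nonneg _)
      (by positivity)).trans (le_of_eq ?_)
    rw [hc]; ring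
  have hmain := hmix.measure_not_sum_sq_le_mixI hβbar hb hκ hX.1 hc0 hGb (w := w)
    (fun j i => measurable_cutTrace_mul
      (fun l hl => measurable_past (by omega) (by omega)) (measurable_past (by omega) (by omega))
      (measurable_past (by omega) (by omega)))
    (fun j i hi => measurable_cutTrace_mul
      (fun l hl => measurable_future (by omega)) (measurable_future (by omega))
      (measurable_future (by omega))) hN hδ hbig
  refine (measureReal_mono (fun ω hω => ?_) (measure_ne_top _ _)).trans hmain
  intro hgood
  refine hω ?_
  set W := (w + 1) * mixI βbar b κ N δ with hW
  have hI := le_mixI (βbar := βbar) (b := b) hN hδ hκ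
  have hW0 : 0 ≤ W := by positivity
  have hD0 : (0 : ℝ) ≤ Fintype.card ι := Nat.cast_nonneg _
  have hA : Fintype.card ι * (2 * c) ^ 2 * (W * N) =
      (Real.sqrt (Fintype.card ι) * (2 * c) * (Real.sqrt W * Real.sqrt N)) ^ 2 := by
    rw [mul_pow (Real.sqrt _ * _), mul_pow (Real.sqrt (Fintype.card ι : ℝ)),
      mul_pow (Real.sqrt W), Real.sq_sqrt hD0, Real.sq_sqrt hW0,
      Real.sq_sqrt hN'.le]
  rw [hA] at hgood
  have h := sum_sq_add_le_of_abs_le (by positivity) (B := c * (2 * w + 1 / (1 - α)))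
    (by positivity) hgood (fun j => hX.abs_tdSum_sub_le hP h1 h0 hα1 (hf j) (hg j) hL.le hU0.le
      (hψL j) (hU j) hw1 hw ω)
  refine le_of_eq_of_le (Finset.sum_congr rfl fun j _ => ?_) (h.trans (le_of_eq ?_))
  · simp only [hG]
    congr 1
    ring
  · congr 1
    have hs : Real.sqrt N ≠ 0 := (Real.sqrt_pos.2 hN').ne'
    have hs2 : (N : ℝ) = Real.sqrt N * Real.sqrt N := (Real.mul_self_sqrt hN'.le).symm
    have e1 : (N : ℝ) * (2 / Real.sqrt N) = 2 * Real.sqrt N := by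
      nth_rewrite 1 [hs2]; field_simp
    calc _ = Real.sqrt (Fintype.card ι) * c *
          ((2 * Real.sqrt N) * Real.sqrt W + 1 / (1 - α) + 2 * w) := by ring
      _ = _ := by
          rw [← e1]
          field_simp

end TDConcentration

/-! ### Soft-O calculus -/

section SoftO

theorem eventually_one_le_log : ∀ᶠ n : ℕ in atTop, 1 ≤ Real.log (n : ℝ) :=
  (Real.tendsto_log_atTop.comp tendsto_natCast_atTop_atTop).eventually_ge_atTop 1

theorem isBigO_log_pow_div {k l : ℕ} (h : k ≤ l) :
    (fun n : ℕ => Real.log n ^ k / n) =O[atTop] fun n : ℕ => Real.log n ^ l / n := by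
  refine IsBigO.of_bound' ?_
  filter_upwards [eventually_one_le_log] with n hn
  rw [Real.norm_of_nonneg (by positivity), Real.norm_of_nonneg (by positivity)]
  exact div_le_div_of_nonneg_right (pow_le_pow_right₀ hn h) (Nat.cast_nonneg n)

theorem IsSoftOInv.add {u v : ℕ → ℝ} (hu : IsSoftOInv u) (hv : IsSoftOInv v) :
    IsSoftOInv fun n => u n + v n := by
  obtain ⟨k, hk⟩ := hu
  obtain ⟨l, hl⟩ := hv
  exact ⟨max k l, (hk.trans (isBigO_log_pow_div (le_max_left _ _))).add
    (hl.trans (isBigO_log_pow_div (le_max_right _ _)))⟩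

theorem IsSoftOInv.of_isBigO {u v : ℕ → ℝ} (hv : IsSoftOInv v) (h : u =O[atTop] v) :
    IsSoftOInv u := by
  obtain ⟨k, hk⟩ := hv
  exact ⟨k, h.trans hk⟩

theorem IsSoftOInv.bounded_mul {u v : ℕ → ℝ} (hu : IsSoftOInv u)
    (hv : v =O[atTop] fun _ => (1 : ℝ)) : IsSoftOInv fun n => v n * u n :=
  hu.of_isBigO (by simpa using hv.mul (isBigO_refl u atTop))

theorem IsSoftOInv.const_mul {u : ℕ → ℝ} (hu : IsSoftOInv u) (c : ℝ) :
    IsSoftOInv fun n => c * u n :=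
  hu.bounded_mul (isBigO_const_const c one_ne_zero _)

theorem IsSoftOInv.tendsto {u : ℕ → ℝ} (hu : IsSoftOInv u) : Tendsto u atTop (𝓝 0) := by
  obtain ⟨k, hk⟩ := hu
  refine hk.trans_tendsto ?_
  exact ((Real.isLittleO_pow_log_id_atTop (n := k)).comp_tendsto
    tendsto_natCast_atTop_atTop).tendsto_div_nhds_zero

end SoftO

/-! ### Growth of the quantities in the bound -/

section Growth

variable {γ lam βbar b κ δ : ℝ}

/-- The bracket of the sample size condition. -/
def bracket (γ lam βbar b κ δ : ℝ) (n : ℕ) : ℝ :=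
  2 / Real.sqrt ((n : ℝ) - 1) * Real.sqrt ((window lam γ n + 1) * mixI βbar b κ (n - 1) δ) +
    1 / (((n : ℝ) - 1) * (1 - lam * γ)) + 2 / ((n : ℝ) - 1) * window lam γ n

theorem isBigO_Lambda (hβ : 0 < βbar) (hδ : δ ∈ Set.Ioo (0 : ℝ) 1) :
    (fun n : ℕ => Lambda βbar (n - 1) δ) =O[atTop] fun n : ℕ => Real.log n := by
  have hδ0 := hδ.1
  refine IsBigO.of_bound (|Real.log (8 / δ)| + 3 + |Real.log (4 * Real.exp 1 ^ 2 + βbar)|) ?_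
  filter_upwards [eventually_one_le_log, eventually_ge_atTop 2] with n hlog hn
  have hN : 1 ≤ n - 1 := by omega
  have hN1 : (1 : ℝ) ≤ ((n - 1 : ℕ) : ℝ) := by exact_mod_cast hN
  have hNn : Real.log ((n - 1 : ℕ) : ℝ) ≤ Real.log n :=
    Real.log_le_log (by linarith) (by exact_mod_cast Nat.sub_le n 1)
  have h1 := one_le_Lambda (βbar := βbar) hN hδ
  rw [Real.norm_of_nonneg (by linarith), Real.norm_of_nonneg (by linarith), Lambda]
  have e1 : Real.log (8 * ((n - 1 : ℕ) : ℝ) ^ 2 / δ) =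
      Real.log (8 / δ) + 2 * Real.log ((n - 1 : ℕ) : ℝ) := by
    rw [mul_div_right_comm, Real.log_mul (by positivity) (by positivity), Real.log_pow]
    norm_num
  have e2 : Real.log (max (4 * Real.exp 1 ^ 2) (((n - 1 : ℕ) : ℝ) * βbar)) ≤
      Real.log ((n - 1 : ℕ) : ℝ) + Real.log (4 * Real.exp 1 ^ 2 + βbar) := by
    rw [← Real.log_mul (by positivity) (by positivity)]
    refine Real.log_le_log (lt_max_of_lt_left (by positivity)) (max_le ?_ ?_)
    · have : 0 ≤ (((n - 1 : ℕ) : ℝ) - 1) * (4 * Real.exp 1 ^ 2) :=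
        mul_nonneg (by linarith) (by positivity)
      have : 0 ≤ ((n - 1 : ℕ) : ℝ) * βbar := by positivity
      linarith
    · have : 0 ≤ ((n - 1 : ℕ) : ℝ) * (4 * Real.exp 1 ^ 2) := by positivity
      linarith
  have e3 := le_abs_self (Real.log (8 / δ))
  have e4 := le_abs_self (Real.log (4 * Real.exp 1 ^ 2 + βbar))
  have e5 := mul_le_mul_of_nonneg_left hlog (abs_nonneg (Real.log (8 / δ)))
  have e6 := mul_le_mul_of_nonneg_left hlog (abs_nonneg (Real.log (4 * Real.exp 1 ^ 2 + βbar)))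
  linarith

theorem isBigO_mixI (hβ : 0 < βbar) (hδ : δ ∈ Set.Ioo (0 : ℝ) 1) :
    ∃ k : ℕ, (fun n : ℕ => mixI βbar b κ (n - 1) δ) =O[atTop] fun n : ℕ => Real.log n ^ k := by
  have hΛ := isBigO_Lambda hβ hδ
  have hone : (fun _ : ℕ => (1 : ℝ)) =O[atTop] fun n : ℕ => Real.log n := by
    refine IsBigO.of_bound' ?_
    filter_upwards [eventually_one_le_log] with n hn
    rw [norm_one]
    exact hn.trans (le_abs_self _)
  have hmax : (fun n : ℕ => max (Lambda βbar (n - 1) δ / b) 1) =O[atTop]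
      fun n : ℕ => Real.log n := by
    have h1 : (fun n : ℕ => |b⁻¹ * Lambda βbar (n - 1) δ| + 1) =O[atTop]
        fun n : ℕ => Real.log n := ((hΛ.const_mul_left b⁻¹).abs_left).add hone
    refine IsBigO.trans (IsBigO.of_bound' (Eventually.of_forall fun n => ?_)) h1
    rw [Real.norm_of_nonneg (zero_le_one.trans (le_max_right _ _)),
      Real.norm_of_nonneg (by positivity), div_eq_inv_mul]
    have h0 := abs_nonneg (b⁻¹ * Lambda βbar (n - 1) δ)
    exact max_le ((le_abs_self _).trans (by linarith)) (by linarith)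
  have hpow : (fun n : ℕ => max (Lambda βbar (n - 1) δ / b) 1 ^ (1 / κ)) =O[atTop]
      fun n : ℕ => Real.log n ^ ⌈1 / κ⌉₊ := by
    have h1 := hmax.pow ⌈1 / κ⌉₊
    refine IsBigO.trans (IsBigO.of_bound' (Eventually.of_forall fun n => ?_)) h1
    have hle : 1 ≤ max (Lambda βbar (n - 1) δ / b) 1 := le_max_right _ _
    rw [Real.norm_of_nonneg (Real.rpow_nonneg (by linarith) _),
      Real.norm_of_nonneg (by positivity), ← Real.rpow_natCast]
    exact Real.rpow_le_rpow_of_exponent_le hle (Nat.le_ceil _)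
  refine ⟨1 + ⌈1 / κ⌉₊, ?_⟩
  have h := (hΛ.const_mul_left 32).mul hpow
  refine h.congr (fun n => rfl) fun n => ?_
  rw [pow_add, pow_one]

theorem window_nonneg (hγ : γ ∈ Set.Ioo (0 : ℝ) 1) (hlam : lam ∈ Set.Ioo (0 : ℝ) 1) {n : ℕ}
    (hn : 2 ≤ n) : 0 ≤ window lam γ n := by
  have hn' : (2 : ℝ) ≤ n := by exact_mod_cast hn
  have h1 : 0 < lam * γ := mul_pos hlam.1 hγ.1
  have h2 : lam * γ < 1 := by nlinarith [hlam.2, hγ.2, hγ.1, hlam.1]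
  have h3 : 0 ≤ Real.log ((n : ℝ) - 1) / Real.log (1 / (lam * γ)) :=
    div_nonneg (Real.log_nonneg (by linarith))
      (Real.log_nonneg (by rw [le_div_iff₀ h1]; linarith))
  exact Int.cast_nonneg (Int.ceil_nonneg h3)

theorem isBigO_window (hγ : γ ∈ Set.Ioo (0 : ℝ) 1) (hlam : lam ∈ Set.Ioo (0 : ℝ) 1) :
    (fun n : ℕ => window lam γ n) =O[atTop] fun n : ℕ => Real.log n := by
  have h1 : 0 < lam * γ := mul_pos hlam.1 hγ.1
  have h2 : lam * γ < 1 := by nlinarith [hlam.2, hγ.2, hγ.1, hlam.1]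
  have hc : 0 < Real.log (1 / (lam * γ)) := Real.log_pos (by rw [lt_div_iff₀ h1]; linarith)
  refine IsBigO.of_bound (1 / Real.log (1 / (lam * γ)) + 1) ?_
  filter_upwards [eventually_one_le_log, eventually_ge_atTop 2] with n hlog hn
  have hn' : (2 : ℝ) ≤ n := by exact_mod_cast hn
  rw [Real.norm_of_nonneg (window_nonneg hγ hlam hn), Real.norm_of_nonneg (by linarith)]
  have h3 : window lam γ n < Real.log ((n : ℝ) - 1) / Real.log (1 / (lam * γ)) + 1 :=
    Int.ceil_lt_add_one _
  have h4 : Real.log ((n : ℝ) - 1) / Real.log (1 / (lam * γ)) ≤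
      Real.log n / Real.log (1 / (lam * γ)) :=
    div_le_div_of_nonneg_right (Real.log_le_log (by linarith) (by linarith)) hc.le
  rw [add_mul, one_div_mul_eq_div]
  linarith

theorem isBigO_inv_sub_one :
    (fun n : ℕ => 1 / ((n : ℝ) - 1)) =O[atTop] fun n : ℕ => 1 / (n : ℝ) := by
  refine IsBigO.of_bound 2 ?_
  filter_upwards [eventually_ge_atTop 2] with n hn
  have hn' : (2 : ℝ) ≤ n := by exact_mod_cast hn
  rw [Real.norm_of_nonneg (div_nonneg zero_le_one (by linarith)), Real.norm_of_nonneg (by positivity),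
    mul_one_div, div_le_div_iff₀ (by linarith) (by linarith)]
  linarith

theorem isSoftOInv_of_isBigO_log_pow {u : ℕ → ℝ} {k : ℕ}
    (hu : u =O[atTop] fun n : ℕ => Real.log n ^ k) :
    IsSoftOInv fun n : ℕ => 1 / ((n : ℝ) - 1) * u n :=
  ⟨k, (isBigO_inv_sub_one.mul hu).congr (fun _ => rfl) fun n => by ring⟩

theorem isSoftOInv_bracket_tail (hγ : γ ∈ Set.Ioo (0 : ℝ) 1) (hlam : lam ∈ Set.Ioo (0 : ℝ) 1) :
    IsSoftOInv fun n : ℕ =>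
      1 / (((n : ℝ) - 1) * (1 - lam * γ)) + 2 / ((n : ℝ) - 1) * window lam γ n := by
  have h1 := (isSoftOInv_of_isBigO_log_pow (u := fun _ => 1 / (1 - lam * γ)) (k := 0)
    (by simpa using isBigO_const_const (1 / (1 - lam * γ)) (one_ne_zero (α := ℝ)) atTop))
  have h2 := (isSoftOInv_of_isBigO_log_pow (k := 1) (u := fun n => 2 * window lam γ n)
    (by simpa using (isBigO_window hγ hlam).const_mul_left 2))
  refine (h1.add h2).of_isBigO (IsBigO.of_bound' (Eventually.of_forall fun n => le_of_eq ?_))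
  congr 1
  rw [one_div_mul_one_div]
  ring

theorem isSoftOInv_sq_bracket_head (hγ : γ ∈ Set.Ioo (0 : ℝ) 1)
    (hlam : lam ∈ Set.Ioo (0 : ℝ) 1) (hβ : 0 < βbar) (hκ : 0 < κ)
    (hδ : δ ∈ Set.Ioo (0 : ℝ) 1) :
    IsSoftOInv fun n : ℕ => (2 / Real.sqrt ((n : ℝ) - 1) *
      Real.sqrt ((window lam γ n + 1) * mixI βbar b κ (n - 1) δ)) ^ 2 := by
  obtain ⟨k, hk⟩ := isBigO_mixI (b := b) (κ := κ) hβ hδ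
  have hone : (fun _ : ℕ => (1 : ℝ)) =O[atTop] fun n : ℕ => Real.log n := by
    refine IsBigO.of_bound' ?_
    filter_upwards [eventually_one_le_log] with n hn
    rw [norm_one]
    exact hn.trans (le_abs_self _)
  have hW : (fun n : ℕ => 4 * ((window lam γ n + 1) * mixI βbar b κ (n - 1) δ)) =O[atTop]
      fun n : ℕ => Real.log n ^ (1 + k) := by
    refine ((((isBigO_window hγ hlam).add hone).mul hk).const_mul_left 4).congr
      (fun _ => rfl) fun n => ?_
    rw [pow_add, pow_one]
  refine (isSoftOInv_of_isBigO_log_pow hW).of_isBigO (IsBigO.of_bound' ?_)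
  filter_upwards [eventually_ge_atTop 2] with n hn
  have hn' : (2 : ℝ) ≤ n := by exact_mod_cast hn
  have hI := le_mixI (βbar := βbar) (b := b) (by omega : 1 ≤ n - 1) hδ hκ
  have hw := window_nonneg hγ hlam hn
  refine le_of_eq (congrArg _ ?_)
  rw [mul_pow, div_pow, Real.sq_sqrt (by linarith), Real.sq_sqrt (by positivity)]
  ring

variable (K V : ℝ)

theorem isSoftOInv_sq_bracket (hγ : γ ∈ Set.Ioo (0 : ℝ) 1)
    (hlam : lam ∈ Set.Ioo (0 : ℝ) 1) (hβ : 0 < βbar) (hκ : 0 < κ)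
    (hδ : δ ∈ Set.Ioo (0 : ℝ) 1) :
    IsSoftOInv fun n : ℕ => (K * bracket γ lam βbar b κ δ n) ^ 2 := by
  have ha := isSoftOInv_sq_bracket_head (b := b) hγ hlam hβ hκ hδ
  have hr := isSoftOInv_bracket_tail hγ hlam
  have hrr := hr.bounded_mul (hr.tendsto.isBigO_one ℝ)
  refine ((ha.const_mul (2 * K ^ 2)).add (hrr.const_mul (2 * K ^ 2))).of_isBigO
    (IsBigO.of_bound' (Eventually.of_forall fun n => ?_))
  rw [Real.norm_of_nonneg (sq_nonneg _)]
  refine le_trans ?_ (le_abs_self _)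
  rw [bracket, mul_pow]
  set a := 2 / Real.sqrt ((n : ℝ) - 1) *
    Real.sqrt ((window lam γ n + 1) * mixI βbar b κ (n - 1) δ)
  set r := 1 / (((n : ℝ) - 1) * (1 - lam * γ)) + 2 / ((n : ℝ) - 1) * window lam γ n with hr
  rw [add_assoc, ← hr]
  -- This is K²(a+r)² ≤ 2K²a² + 2K²r².
  have := mul_nonneg (sq_nonneg K) (sq_nonneg (a - r))
  linarith

theorem tendsto_bracket (hγ : γ ∈ Set.Ioo (0 : ℝ) 1)
    (hlam : lam ∈ Set.Ioo (0 : ℝ) 1) (hβ : 0 < βbar) (hκ : 0 < κ)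
    (hδ : δ ∈ Set.Ioo (0 : ℝ) 1) :
    Tendsto (fun n : ℕ => K * bracket γ lam βbar b κ δ n) atTop (𝓝 0) := by
  have h := (isSoftOInv_sq_bracket (b := b) K hγ hlam hβ hκ hδ).tendsto.sqrt
  simp only [Real.sqrt_sq_eq_abs, Real.sqrt_zero] at h
  exact (tendsto_zero_iff_abs_tendsto_zero _).2 h

/-- The lower order term of the error bound. -/
def lowerOrder (K V γ lam βbar b κ δ : ℝ) (n : ℕ) : ℝ :=
  V * (K * bracket γ lam βbar b κ δ n / (1 - K * bracket γ lam βbar b κ δ n) -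
    K * (2 / Real.sqrt ((n : ℝ) - 1) *
      Real.sqrt ((window lam γ n + 1) * mixI βbar b κ (n - 1) δ)))

theorem isSoftOInv_lowerOrder (hγ : γ ∈ Set.Ioo (0 : ℝ) 1)
    (hlam : lam ∈ Set.Ioo (0 : ℝ) 1) (hβ : 0 < βbar) (hκ : 0 < κ)
    (hδ : δ ∈ Set.Ioo (0 : ℝ) 1) : IsSoftOInv (lowerOrder K V γ lam βbar b κ δ) := by
  have ht := tendsto_bracket (b := b) K hγ hlam hβ hκ hδ
  have hinv : Tendsto (fun n : ℕ => (1 - K * bracket γ lam βbar b κ δ n)⁻¹) atTop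
      (𝓝 (1 - 0)⁻¹) := (tendsto_const_nhds.sub ht).inv₀ (by norm_num)
  have h1 := (isSoftOInv_sq_bracket (b := b) K hγ hlam hβ hκ hδ).bounded_mul (hinv.isBigO_one ℝ)
  have h2 := ((isSoftOInv_bracket_tail hγ hlam).const_mul K).add h1
  refine (h2.const_mul V).of_isBigO (IsBigO.of_bound' ?_)
  filter_upwards [ht.eventually_lt_const (zero_lt_one : (0 : ℝ) < 1)] with n hn
  refine le_of_eq (congrArg _ ?_)
  rw [lowerOrder]
  congr 1
  have hne : 1 - K * bracket γ lam βbar b κ δ n ≠ 0 := by linarith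
  -- With ρ = K · bracket, ρ/(1-ρ) = ρ + ρ²/(1-ρ). Removing the square-root part of ρ leaves the
  -- tail of the bracket and the quadratic term, both Õ(1/n).
  have h3 : ∀ B : ℝ, 1 - B ≠ 0 → B / (1 - B) = B + (1 - B)⁻¹ * B ^ 2 := fun B hB => by
    field_simp
    ring
  rw [h3 _ hne]
  have h4 : ∀ a r t : ℝ, K * (a + r) + t - K * a = K * r + t := fun a r t => by ring
  have h5 : bracket γ lam βbar b κ δ n = 2 / Real.sqrt ((n : ℝ) - 1) *
      Real.sqrt ((window lam γ n + 1) * mixI βbar b κ (n - 1) δ) +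
      (1 / (((n : ℝ) - 1) * (1 - lam * γ)) + 2 / ((n : ℝ) - 1) * window lam γ n) := by
    rw [bracket, add_assoc]
  generalize (1 - K * bracket γ lam βbar b κ δ n)⁻¹ * (K * bracket γ lam βbar b κ δ n) ^ 2 = t
  rw [h5]
  exact h4 _ _ _

theorem nZero_spec {d : ℕ} {L ν : ℝ} (hγ : γ ∈ Set.Ioo (0 : ℝ) 1)
    (hlam : lam ∈ Set.Ioo (0 : ℝ) 1) (hβ : 0 < βbar) (hκ : 0 < κ)
    (hδ : δ ∈ Set.Ioo (0 : ℝ) 1) {n : ℕ} (hn : nZero d L γ lam ν βbar b κ δ ≤ n) :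
    2 ≤ n ∧ 2 * d * L ^ 2 / ((1 - γ) * ν) * bracket γ lam βbar b κ δ n < 1 := by
  have ht := tendsto_bracket (b := b) (2 * d * L ^ 2 / ((1 - γ) * ν)) hγ hlam hβ hκ hδ
  obtain ⟨M, hM⟩ := eventually_atTop.1 (ht.eventually_lt_const (zero_lt_one : (0 : ℝ) < 1))
  -- The bracket tends to zero, so the set defining `nZero` is nonempty and its infimum is attained;
  -- for an empty set `sInf` would return 0.
  have hne : {N : ℕ | 2 ≤ N ∧ ∀ n ≥ N, SampleCond d L γ lam ν βbar b κ δ n}.Nonempty :=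
    ⟨max 2 M, le_max_left _ _, fun n hn => hM n ((le_max_right _ _).trans hn)⟩
  have hmem := Nat.sInf_mem hne
  exact ⟨hmem.1.trans hn, hmem.2 n hn⟩

end Growth

/-! ### The estimate as a perturbed linear system -/

section Estimate

variable {S : Type*} {d : ℕ} {φ : Fin d → S → ℝ} {lam γ : ℝ} {X : ℕ → S}

theorem trace_succ_eq_cutTrace (i : ℕ) (j : Fin d) :
    trace φ lam γ X (i + 1) j = cutTrace (lam * γ) (φ j) X (i + 1) i := by
  rw [trace, cutTrace]
  refine Finset.sum_nbij' (fun k => i + 1 - k) (fun l => i + 1 - l) ?_ ?_ ?_ ?_ ?_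
  · intro k hk
    rw [Finset.mem_Icc] at hk
    rw [Finset.mem_range]; omega
  · intro l hl
    rw [Finset.mem_range] at hl
    rw [Finset.mem_Icc]; omega
  · intro k hk
    rw [Finset.mem_Icc] at hk
    omega
  · intro l hl
    rw [Finset.mem_range] at hl
    omega
  · intro k hk
    rw [Finset.mem_Icc] at hk
    rw [Nat.sub_sub_self hk.2]

theorem sum_Icc_one_eq_sum_range (F : ℕ → ℝ) (N : ℕ) :
    ∑ i ∈ Finset.Icc 1 N, F i = ∑ i ∈ Finset.range N, F (i + 1) := by
  rw [Finset.range_eq_Ico, Finset.sum_Ico_add' F 0 N 1]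
  rfl

theorem Ahat_apply {n : ℕ} (hn : 1 ≤ n) (j k : Fin d) :
    Ahat φ lam γ X n j k =
      1 / ((n - 1 : ℕ) : ℝ) * tdSum (lam * γ) γ (φ j) (φ k) (φ k) X (n - 1) := by
  rw [Ahat, Matrix.smul_apply, Matrix.sum_apply, sum_Icc_one_eq_sum_range, smul_eq_mul,
    Nat.cast_sub hn, Nat.cast_one, tdSum]
  congr 1
  exact Finset.sum_congr rfl fun i _ => by
    rw [Matrix.vecMulVec_apply, trace_succ_eq_cutTrace]

theorem bhat_apply {r : S → ℝ} {n : ℕ} (hn : 1 ≤ n) (j : Fin d) :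
    bhat φ r lam γ X n j = 1 / ((n - 1 : ℕ) : ℝ) *
      ∑ i ∈ Finset.range (n - 1), cutTrace (lam * γ) (φ j) X (i + 1) i * r (X (i + 1)) := by
  rw [bhat, Pi.smul_apply, Finset.sum_apply, sum_Icc_one_eq_sum_range, smul_eq_mul,
    Nat.cast_sub hn, Nat.cast_one]
  congr 1
  exact Finset.sum_congr rfl fun i _ => by
    rw [Pi.smul_apply, trace_succ_eq_cutTrace, smul_eq_mul, mul_comm]

/-- At a fixed θ the errors of Â and b̂ are estimated jointly: the reward enters only the first
function of the temporal difference, hence the two separate function arguments of `tdSum`. -/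
theorem residual_apply {r : S → ℝ} {n : ℕ} (hn : 1 ≤ n) (θ : Fin d → ℝ) (j : Fin d) :
    (Ahat φ lam γ X n *ᵥ θ) j - bhat φ r lam γ X n j = 1 / ((n - 1 : ℕ) : ℝ) *
      tdSum (lam * γ) γ (φ j) (fun x => featureMap φ θ x - r x) (featureMap φ θ) X (n - 1) := by
  have h : (Ahat φ lam γ X n *ᵥ θ) j = 1 / ((n - 1 : ℕ) : ℝ) *
      ∑ i ∈ Finset.range (n - 1), cutTrace (lam * γ) (φ j) X (i + 1) i *
        (featureMap φ θ (X (i + 1)) - γ * featureMap φ θ (X (i + 2))) := by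
    simp only [Matrix.mulVec, dotProduct]
    simp_rw [Ahat_apply hn, mul_assoc, tdSum, Finset.sum_mul]
    rw [← Finset.mul_sum, Finset.sum_comm]
    congr 1
    refine Finset.sum_congr rfl fun i _ => ?_
    simp only [featureMap]
    rw [Finset.mul_sum, ← Finset.sum_sub_distrib, Finset.mul_sum]
    exact Finset.sum_congr rfl fun k _ => by ring
  rw [h, bhat_apply hn, ← mul_sub, ← Finset.sum_sub_distrib, tdSum]
  congr 1
  exact Finset.sum_congr rfl fun i _ => by ring

theorem sum_sq_div_le {ι : Type*} [Fintype ι] {u m : ι → ℝ} {N E : ℝ} (hN : 0 < N)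
    (h : ∑ i, (u i - N * m i) ^ 2 ≤ (N * E) ^ 2) : ∑ i, (1 / N * u i - m i) ^ 2 ≤ E ^ 2 := by
  have e : ∀ i, (1 / N * u i - m i) ^ 2 = (1 / N) ^ 2 * (u i - N * m i) ^ 2 := fun i => by
    field_simp
  simp_rw [e]
  rw [← Finset.mul_sum]
  calc _ ≤ (1 / N) ^ 2 * (N * E) ^ 2 := mul_le_mul_of_nonneg_left h (sq_nonneg _)
    _ = E ^ 2 := by field_simp

variable [MeasurableSpace S] [Countable S] [MeasurableSingletonClass S]
  {P : Kernel S S} [IsMarkovKernel P] {μ : Measure S} [IsProbabilityMeasure μ]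
  {L ν V R : ℝ} {r v : S → ℝ} {θ : Fin d → ℝ}

/-- Concentration of the residual needs a pointwise bound, not one in L²(μ). Cauchy-Schwarz combines
|θ|² ≤ V²/ν with |φ(x)|² ≤ dL². -/
theorem abs_featureMap_le (hφ : ∀ j x, |φ j x| ≤ L) (hL : 0 ≤ L) (hν : 0 < ν)
    (hs : ∀ c, ν * (c ⬝ᵥ c) ≤ muNorm μ (featureMap φ c) ^ 2) (hV : 0 ≤ V)
    (hθ : muNorm μ (featureMap φ θ) ≤ V) (x : S) :
    |featureMap φ θ x| ≤ Real.sqrt d * L * V / Real.sqrt ν := by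
  have h1 : θ ⬝ᵥ θ ≤ V ^ 2 / ν := by
    rw [le_div_iff₀ hν, mul_comm]
    exact (hs θ).trans (pow_le_pow_left₀ (muNorm_nonneg _ _) hθ 2)
  refine abs_le_of_sq_le_sq ?_ (by positivity)
  rw [div_pow, mul_pow, mul_pow, Real.sq_sqrt (Nat.cast_nonneg d), Real.sq_sqrt hν.le]
  calc featureMap φ θ x ^ 2 ≤ (∑ j, θ j ^ 2) * ∑ j, φ j x ^ 2 :=
        Finset.sum_mul_sq_le_sq_mul_sq _ _ _
    _ ≤ V ^ 2 / ν * (d * L ^ 2) := by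
        refine mul_le_mul (by simpa [dotProduct, sq] using h1) ?_
          (Finset.sum_nonneg fun j _ => sq_nonneg _) (by positivity)
        calc ∑ j, φ j x ^ 2 ≤ ∑ _j : Fin d, L ^ 2 := Finset.sum_le_sum fun j _ => by
              rw [← sq_abs]; exact pow_le_pow_left₀ (abs_nonneg _) (hφ j x) 2
          _ = d * L ^ 2 := by simp
    _ = _ := by ring

/-- s + (1-γ)s + γs = 2s. -/
theorem abs_residual_le (hγ : γ ∈ Set.Ioo (0 : ℝ) 1) {s : ℝ} (hs : ∀ x, |featureMap φ θ x| ≤ s)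
    (hr : ∀ x, |r x| ≤ (1 - γ) * s) (x y : S) :
    |featureMap φ θ x - r x - γ * featureMap φ θ y| ≤ 2 * s := by
  have h1 := abs_le.1 (hs x)
  have h2 := abs_le.1 (hr x)
  have h3 : |γ * featureMap φ θ y| ≤ γ * s := by
    rw [abs_mul, abs_of_pos hγ.1]
    exact mul_le_mul_of_nonneg_left (hs y) hγ.1.le
  have h4 := abs_le.1 h3
  rw [abs_le]
  constructor <;> linarith [h1.1, h1.2, h2.1, h2.2, h4.1, h4.2]

/-- The error bound on the event where the empirical sums are close to their means. -/
theorem isUnit_and_muNorm_sub_vhat_le (hγ : γ ∈ Set.Ioo (0 : ℝ) 1)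
    (hlam : lam ∈ Set.Ioo (0 : ℝ) 1) (hP : P.Invariant μ) (hφ : ∀ j x, |φ j x| ≤ L)
    (hν : 0 < ν) (hs : ∀ c, ν * (c ⬝ᵥ c) ≤ muNorm μ (featureMap φ c) ^ 2)
    (hdet : IsUnit (gram μ φ).det) (hr : IsBdd r) (hv : IsBdd v)
    (hvr : ∀ x, v x = r x + γ * meanOp P v x)
    (hθ : ∀ j, tdMean P μ (lam * γ) γ (φ j) (fun x => featureMap φ θ x - v x)
      (fun x => featureMap φ θ x - v x) = 0) (hV : 0 ≤ V) {B : ℝ} (hB : 0 ≤ B)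
    (hρ : 2 * d * L ^ 2 / ((1 - γ) * ν) * B < 1) {n : ℕ} (hn : 2 ≤ n)
    (hA : ∑ p : Fin d × Fin d, (tdSum (lam * γ) γ (φ p.1) (φ p.2) (φ p.2) X (n - 1) -
        ((n - 1 : ℕ) : ℝ) * tdMean P μ (lam * γ) γ (φ p.1) (φ p.2) (φ p.2)) ^ 2 ≤
      (((n - 1 : ℕ) : ℝ) * (2 * d * L ^ 2 / (1 - lam * γ) * B)) ^ 2)
    (hb : ∑ j, (tdSum (lam * γ) γ (φ j) (fun x => featureMap φ θ x - r x) (featureMap φ θ) X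
        (n - 1) - ((n - 1 : ℕ) : ℝ) * tdMean P μ (lam * γ) γ (φ j)
          (fun x => featureMap φ θ x - r x) (featureMap φ θ)) ^ 2 ≤
      (((n - 1 : ℕ) : ℝ) * (2 * d * L ^ 2 * V / (Real.sqrt ν * (1 - lam * γ)) * B)) ^ 2) :
    IsUnit (Ahat φ lam γ X n) ∧
      muNorm μ (fun x => v x - vhat φ r lam γ X n x) ≤
        (1 - lam * γ) / (1 - γ) * muNorm μ (fun x => v x - proj μ φ v x) +
          V * (2 * d * L ^ 2 / ((1 - γ) * ν) * B /
            (1 - 2 * d * L ^ 2 / ((1 - γ) * ν) * B)) := by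
  have h0 : 0 < lam * γ := mul_pos hlam.1 hγ.1
  have hαγ : lam * γ < γ := mul_lt_of_lt_one_left hγ.1 hlam.2
  have h1 : lam * γ < 1 := hαγ.trans hγ.2
  have hα1 : 0 < 1 - lam * γ := by linarith
  have hγ1 : 0 < 1 - γ := by linarith [hγ.2]
  have hφb : ∀ j, IsBdd (φ j) := fun j => ⟨L, hφ j⟩
  have hN : (0 : ℝ) < ((n - 1 : ℕ) : ℝ) := by exact_mod_cast (by omega : 0 < n - 1)
  set τ : ℝ := (1 - γ) / (1 - lam * γ) with hτ
  have hτ0 : 0 < τ := div_pos hγ1 hα1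
  set ε : ℝ := 2 * d * L ^ 2 / (1 - lam * γ) * B with hε
  set η : ℝ := 2 * d * L ^ 2 * V / (Real.sqrt ν * (1 - lam * γ)) * B with hη
  have hε0 : 0 ≤ ε := by positivity
  have hη0 : 0 ≤ η := by positivity
  have hερ : ε / (τ * ν) = 2 * d * L ^ 2 / ((1 - γ) * ν) * B := by
    rw [hε, hτ]; field_simp
  have hA' : ∑ p : Fin d × Fin d, (Ahat φ lam γ X n p.1 p.2 -
      tdMatrix P μ (lam * γ) γ φ p.1 p.2) ^ 2 ≤ ε ^ 2 := by
    have := sum_sq_div_le hN hA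
    simpa only [Ahat_apply (by omega : 1 ≤ n), tdMatrix, Matrix.of_apply] using this
  have hpos := le_dotProduct_tdMatrix h0.le h1 hαγ.le hP hφb
  rw [← hερ] at hρ
  have hunit : IsUnit (Ahat φ lam γ X n) :=
    isUnit_of_perturbation hτ0 hν hpos hs hε0 hA' hρ
  refine ⟨hunit, ?_⟩
  set θ' : Fin d → ℝ := (Ahat φ lam γ X n)⁻¹ *ᵥ bhat φ r lam γ X n with hθ'
  have hAθ' : Ahat φ lam γ X n *ᵥ θ' = bhat φ r lam γ X n := by
    rw [hθ', Matrix.mulVec_mulVec,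
      Matrix.mul_nonsing_inv _ ((Matrix.isUnit_iff_isUnit_det _).1 hunit), Matrix.one_mulVec]
  -- Since Âθ' = b̂, the vector Â(θ - θ') is the residual at θ, and its stationary mean vanishes by
  -- the Galerkin equations.
  have hres : ∑ j, (Ahat φ lam γ X n *ᵥ (θ - θ')) j ^ 2 ≤ η ^ 2 := by
    have h2 := sum_sq_div_le hN hb
    refine le_of_eq_of_le (Finset.sum_congr rfl fun j _ => ?_) h2
    have hz : tdMean P μ (lam * γ) γ (φ j) (fun x => featureMap φ θ x - r x)
        (featureMap φ θ) = 0 := by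
      rw [tdMean_sub_reward (hφb j) (isBdd_featureMap hφb θ) hr hv hvr, hθ j]
    rw [hz, sub_zero, Matrix.mulVec_sub, hAθ', Pi.sub_apply,
      residual_apply (by omega : 1 ≤ n)]
  have hfin := norm_le_of_perturbation (s := fun c => muNorm μ (featureMap φ c)) hτ0 hν
    (fun c => muNorm_nonneg _ _) hpos hs hε0 hA' hρ hη0 hres
  have hsν := Real.sqrt_pos.2 hν
  have hfin' : η / (Real.sqrt ν * τ * (1 - ε / (τ * ν))) =
      V * (ε / (τ * ν) / (1 - ε / (τ * ν))) := by
    have hne : 1 - ε / (τ * ν) ≠ 0 := by linarith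
    -- The radii match: η is V times the relative error ρ times √ν τ, so the bound becomes Vρ/(1-ρ).
    have e1 : η = V * (ε / (τ * ν)) * (Real.sqrt ν * τ) := by
      have e2 : ν = Real.sqrt ν * Real.sqrt ν := (Real.mul_self_sqrt hν.le).symm
      rw [hη, hε]
      rw [show τ * ν = τ * (Real.sqrt ν * Real.sqrt ν) by rw [← e2]]
      field_simp
    rw [e1]
    generalize ε / (τ * ν) = x at hne
    field_simp
  rw [hfin'] at hfin
  rw [← hερ]
  have happ := muNorm_sub_fixedPoint_le h0.le h1 hαγ.le hγ.2 hP hφ hdet hv hθ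
  have htri := muNorm_add_le (hv.sub (isBdd_featureMap hφb θ))
    (isBdd_featureMap hφb (θ - θ')) μ
  have e : (fun x => v x - vhat φ r lam γ X n x) =
      fun x => v x - featureMap φ θ x + featureMap φ (θ - θ') x := by
    funext x
    rw [featureMap_sub, vhat]
    ring
  rw [e]
  exact htri.trans (add_le_add happ hfin)

end Estimate

/-! ### The event where the error bound holds -/

section Event

variable {γ lam βbar b κ δ : ℝ}

/-- The window length is the least integer w with N α^w ≤ 1; N ≥ 2 makes log N positive, hence w ≥
1. -/
theorem exists_nat_eq_window (hγ : γ ∈ Set.Ioo (0 : ℝ) 1) (hlam : lam ∈ Set.Ioo (0 : ℝ) 1)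
    {N : ℕ} (hN : 2 ≤ N) :
    ∃ w : ℕ, window lam γ (N + 1) = w ∧ 1 ≤ w ∧ (N : ℝ) * (lam * γ) ^ w ≤ 1 := by
  have h0 : 0 < lam * γ := mul_pos hlam.1 hγ.1
  have h1 : lam * γ < 1 := (mul_lt_of_lt_one_left hγ.1 hlam.2).trans hγ.2
  have hN' : (2 : ℝ) ≤ N := by exact_mod_cast hN
  have hN0 : (0 : ℝ) < N := by linarith
  have hlog : 0 < Real.log (1 / (lam * γ)) := Real.log_pos (one_lt_one_div h0 h1)
  set x : ℝ := Real.log N / Real.log (1 / (lam * γ)) with hx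
  have hx0 : 0 < x := div_pos (Real.log_pos (by linarith)) hlog
  have hwin : window lam γ (N + 1) = ((⌈x⌉ : ℤ) : ℝ) := by
    rw [window, Nat.cast_add_one, add_sub_cancel_right]
  have hc : 0 < ⌈x⌉ := Int.ceil_pos.2 hx0
  have hw : ((⌈x⌉.toNat : ℕ) : ℤ) = ⌈x⌉ := Int.toNat_of_nonneg hc.le
  have hwR : ((⌈x⌉.toNat : ℕ) : ℝ) = ((⌈x⌉ : ℤ) : ℝ) := by
    exact_mod_cast congrArg (Int.cast : ℤ → ℝ) hw
  refine ⟨⌈x⌉.toNat, by rw [hwin, hwR], by omega, ?_⟩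
  have h2 : x ≤ ((⌈x⌉.toNat : ℕ) : ℝ) := by rw [hwR]; exact Int.le_ceil x
  have h3 := (div_le_iff₀ hlog).1 h2
  rw [← Real.log_pow, Real.log_le_log_iff hN0 (by positivity), one_div, inv_pow] at h3
  calc (N : ℝ) * (lam * γ) ^ ⌈x⌉.toNat
      ≤ ((lam * γ) ^ ⌈x⌉.toNat)⁻¹ * (lam * γ) ^ ⌈x⌉.toNat := by gcongr
    _ = 1 := inv_mul_cancel₀ (by positivity)

theorem bracket_succ (N w : ℕ) (hw : window lam γ (N + 1) = w) :
    bracket γ lam βbar b κ δ (N + 1) =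
      2 / Real.sqrt N * Real.sqrt ((w + 1) * mixI βbar b κ N δ) + 1 / (N * (1 - lam * γ)) +
        2 / N * w := by
  rw [bracket, hw, Nat.cast_add_one, add_sub_cancel_right, Nat.add_sub_cancel]

theorem head_le_bracket (hγ : γ ∈ Set.Ioo (0 : ℝ) 1) (hlam : lam ∈ Set.Ioo (0 : ℝ) 1)
    {N : ℕ} (hN : 1 ≤ N) :
    2 / Real.sqrt N * Real.sqrt ((window lam γ (N + 1) + 1) * mixI βbar b κ N δ) ≤
      bracket γ lam βbar b κ δ (N + 1) := by
  have h1 : lam * γ < 1 := (mul_lt_of_lt_one_left hγ.1 hlam.2).trans hγ.2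
  have hw := window_nonneg hγ hlam (by omega : 2 ≤ N + 1)
  have h2 : 0 ≤ 1 / ((N : ℝ) * (1 - lam * γ)) := by
    have : 0 < 1 - lam * γ := by linarith
    positivity
  have h3 : 0 ≤ 2 / (N : ℝ) * window lam γ (N + 1) := by positivity
  rw [bracket, Nat.cast_add_one, add_sub_cancel_right, Nat.add_sub_cancel]
  linarith

/-- The sample size condition already contains the largeness needed for concentration: its head
gives 4d√W ≤ √N, where W is the product of the window length plus one and `mixI`. -/
theorem mul_le_of_mul_bracket_lt_one (hγ : γ ∈ Set.Ioo (0 : ℝ) 1)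
    (hlam : lam ∈ Set.Ioo (0 : ℝ) 1) (hκ : 0 < κ) (hδ : δ ∈ Set.Ioo (0 : ℝ) 1) {d K : ℝ}
    (hd : 0 ≤ d) (hK : 2 * d ≤ K) {N : ℕ} (hN : 1 ≤ N)
    (h : K * bracket γ lam βbar b κ δ (N + 1) < 1) :
    16 * d ^ 2 * ((window lam γ (N + 1) + 1) * mixI βbar b κ N δ) ≤ N := by
  have hN0 : (0 : ℝ) < N := by exact_mod_cast hN
  have hs : 0 < Real.sqrt N := Real.sqrt_pos.2 hN0
  have hw := window_nonneg hγ hlam (by omega : 2 ≤ N + 1)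
  have hI := le_mixI (βbar := βbar) (b := b) hN hδ hκ
  have hle := head_le_bracket (βbar := βbar) (b := b) (κ := κ) (δ := δ) hγ hlam hN
  set W := (window lam γ (N + 1) + 1) * mixI βbar b κ N δ with hW
  have hW0 : 0 ≤ W := mul_nonneg (by linarith) (by linarith)
  have h0 : 0 ≤ 2 / Real.sqrt N * Real.sqrt W := by positivity
  have h1 : 2 * d * (2 / Real.sqrt N * Real.sqrt W) ≤ 1 :=
    (mul_le_mul hK hle h0 (by linarith)).trans h.le
  have h2 : 4 * d * Real.sqrt W ≤ Real.sqrt N := by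
    have e : 2 * d * (2 / Real.sqrt N * Real.sqrt W) = 4 * d * Real.sqrt W / Real.sqrt N := by ring
    rwa [e, div_le_one hs] at h1
  have h3 := pow_le_pow_left₀ (by positivity) h2 2
  rw [Real.sq_sqrt hN0.le, mul_pow, Real.sq_sqrt hW0] at h3
  linarith

/-- The leading term and `lowerOrder` recombine to Vρ/(1-ρ), by construction. -/
theorem main_add_lowerOrder (d : ℕ) (L ν Rmax : ℝ) (n : ℕ) :
    4 * (Rmax / (1 - γ)) * d * L ^ 2 / (Real.sqrt ((n : ℝ) - 1) * (1 - γ) * ν) *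
        Real.sqrt ((window lam γ n + 1) * mixI βbar b κ (n - 1) δ) +
      lowerOrder (2 * d * L ^ 2 / ((1 - γ) * ν)) (Rmax / (1 - γ)) γ lam βbar b κ δ n =
    Rmax / (1 - γ) * (2 * d * L ^ 2 / ((1 - γ) * ν) * bracket γ lam βbar b κ δ n /
      (1 - 2 * d * L ^ 2 / ((1 - γ) * ν) * bracket γ lam βbar b κ δ n)) := by
  rw [lowerOrder]
  generalize 1 - 2 * d * L ^ 2 / ((1 - γ) * ν) * bracket γ lam βbar b κ δ n = D
  generalize bracket γ lam βbar b κ δ n = B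
  generalize 1 - γ = g
  ring

variable {S : Type*} [MeasurableSpace S] [Countable S] [MeasurableSingletonClass S]
  {P : Kernel S S} [IsMarkovKernel P] {μ : Measure S} [IsProbabilityMeasure μ]
  {Ω : Type*} [MeasurableSpace Ω] {Pr : Measure Ω} [IsProbabilityMeasure Pr] {X : ℕ → Ω → S}
  {d : ℕ} {φ : Fin d → S → ℝ} {r : S → ℝ} {L ν Rmax : ℝ}

/-- The concentration bound is applied to the d² entries of Â and to the d entries of the residual
at θ. The latter is legitimate because the population solution θ is deterministic. -/
theorem IsMarkovChain.measure_not_error_le (hX : IsMarkovChain Pr P X)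
    (hP : P.Invariant μ) (h1 : Pr.map (X 1) = μ) (hmix : IsExpBetaMixing Pr X βbar b κ)
    (hβ : 0 < βbar) (hb : 0 < b) (hκ : 0 < κ) (hγ : γ ∈ Set.Ioo (0 : ℝ) 1)
    (hlam : lam ∈ Set.Ioo (0 : ℝ) 1) (hr : ∀ x, |r x| ≤ Rmax) (hφ : ∀ j x, |φ j x| ≤ L)
    (hd : 0 < d) (hν : 0 < ν) (hνL : ν ≤ L ^ 2) (hL : 0 < L) (hR : 0 ≤ Rmax)
    (hs : ∀ c, ν * (c ⬝ᵥ c) ≤ muNorm μ (featureMap φ c) ^ 2) (hdet : IsUnit (gram μ φ).det)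
    (hδ : δ ∈ Set.Ioo (0 : ℝ) 1) {N : ℕ} (hN : 1 ≤ N)
    (hρ : 2 * d * L ^ 2 / ((1 - γ) * ν) * bracket γ lam βbar b κ δ (N + 1) < 1) :
    Pr.real {ω | ¬ (IsUnit (Ahat φ lam γ (fun k => X k ω) (N + 1)) ∧
      muNorm μ (fun x => valueFun P γ r x - vhat φ r lam γ (fun k => X k ω) (N + 1) x) ≤
        (1 - lam * γ) / (1 - γ) *
          muNorm μ (fun x => valueFun P γ r x - proj μ φ (valueFun P γ r) x) +
        Rmax / (1 - γ) * (2 * d * L ^ 2 / ((1 - γ) * ν) * bracket γ lam βbar b κ δ (N + 1) /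
          (1 - 2 * d * L ^ 2 / ((1 - γ) * ν) * bracket γ lam βbar b κ δ (N + 1))))} ≤
      δ / (4 * (N : ℝ) ^ 2) := by
  have h0 : 0 < lam * γ := mul_pos hlam.1 hγ.1
  have hαγ : lam * γ < γ := mul_lt_of_lt_one_left hγ.1 hlam.2
  have hα1 : lam * γ < 1 := hαγ.trans hγ.2
  have hα1' : 0 < 1 - lam * γ := by linarith
  have hγ1 : 0 < 1 - γ := by linarith [hγ.2]
  have hsν := Real.sqrt_pos.2 hν
  have : Nonempty (Fin d) := ⟨⟨0, hd⟩⟩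
  have hd1 : (1 : ℝ) ≤ d := by exact_mod_cast hd
  have hφb : ∀ j, IsBdd (φ j) := fun j => ⟨L, hφ j⟩
  have hrb : IsBdd r := ⟨_, hr⟩
  have hvb : IsBdd (valueFun P γ r) := ⟨_, abs_valueFun_le P hγ.1.le hγ.2 hr⟩
  have hvr := fun x => valueFun_eq_add P hγ.1.le hγ.2 hr x
  set V : ℝ := Rmax / (1 - γ) with hV
  have hV0 : 0 ≤ V := div_nonneg hR hγ1.le
  have hunit : IsUnit (tdMatrix P μ (lam * γ) γ φ) := by
    refine isUnit_of_le_dotProduct (τ := (1 - γ) / (1 - lam * γ) * ν) (by positivity) fun c => ?_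
    refine le_trans ?_ (le_dotProduct_tdMatrix h0.le hα1 hαγ.le hP hφb c)
    rw [mul_assoc]
    exact mul_le_mul_of_nonneg_left (hs c) (by positivity)
  obtain ⟨θ, hθ⟩ := exists_fixedPoint h0.le hα1 hP hφb hunit hvb
  have hθV : muNorm μ (featureMap φ θ) ≤ V :=
    muNorm_fixedPoint_le h0.le hα1 hαγ.le hγ.2 hP hφb hR hr hvb hvr hθ
  set s : ℝ := Real.sqrt d * L * V / Real.sqrt ν with hs_def
  have hs0 : 0 ≤ s := by positivity
  have hθs : ∀ x, |featureMap φ θ x| ≤ s := abs_featureMap_le hφ hL.le hν hs hV0 hθV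
  -- From √ν ≤ L and d ≥ 1. It gives |r| ≤ (1-γ)V ≤ (1-γ)s, so the residual summands are governed by
  -- s alone.
  have hVs : V ≤ s := by
    rw [hs_def, le_div_iff₀ hsν, mul_comm V]
    have h2 : Real.sqrt ν ≤ L := Real.sqrt_le_iff.2 ⟨hL.le, hνL⟩
    have h3 : 1 ≤ Real.sqrt d := Real.one_le_sqrt.2 hd1
    exact mul_le_mul_of_nonneg_right (h2.trans (le_mul_of_one_le_left hL.le h3)) hV0
  have hrs : ∀ x, |r x| ≤ (1 - γ) * s := fun x => (hr x).trans (by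
    rw [hV, div_le_iff₀ hγ1] at hVs
    linarith)
  -- Because (1-γ)ν ≤ ν ≤ L².
  have hK : 2 * (d : ℝ) ≤ 2 * d * L ^ 2 / ((1 - γ) * ν) := by
    rw [le_div_iff₀ (by positivity)]
    refine mul_le_mul_of_nonneg_left ?_ (by positivity)
    exact (mul_le_of_le_one_left hν.le (by linarith [hγ.1])).trans hνL
  have hbig := mul_le_of_mul_bracket_lt_one hγ hlam hκ hδ (Nat.cast_nonneg d) hK hN hρ
  have hI := le_mixI (βbar := βbar) (b := b) hN hδ hκ
  have hN2 : 2 ≤ N := by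
    have hw := window_nonneg hγ hlam (by omega : 2 ≤ N + 1)
    have h2 : 32 ≤ (window lam γ (N + 1) + 1) * mixI βbar b κ N δ := by nlinarith
    have h3 : (1 : ℝ) ≤ (d : ℝ) ^ 2 := one_le_pow₀ hd1
    have h4 : (2 : ℝ) ≤ N := by nlinarith
    exact_mod_cast h4
  obtain ⟨w, hw, hw1, hwN⟩ := exists_nat_eq_window hγ hlam hN2
  have hbr := bracket_succ (βbar := βbar) (b := b) (κ := κ) (δ := δ) N w hw
  rw [hw] at hbig
  have hB0 : 0 ≤ bracket γ lam βbar b κ δ (N + 1) := by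
    rw [hbr]; positivity
  set B : ℝ := bracket γ lam βbar b κ δ (N + 1) with hB
  have hUA : ∀ (p : Fin d × Fin d) x y, |φ p.2 x - γ * φ p.2 y| ≤ 2 * L := fun p x y => by
    have a1 := abs_le.1 (hφ p.2 x)
    have a2 : |γ * φ p.2 y| ≤ L := by
      rw [abs_mul, abs_of_pos hγ.1]
      exact (mul_le_of_le_one_left (abs_nonneg _) hγ.2.le).trans (hφ p.2 y)
    have a3 := abs_le.1 a2
    exact abs_le.2 ⟨by linarith, by linarith⟩
  have hA := hX.measure_not_sum_sq_tdSum_le (ι := Fin d × Fin d) (ψ := fun p => φ p.1)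
    (f := fun p => φ p.2) (g := fun p => φ p.2) hP h1 hmix hβ hb hκ h0.le hα1
    (fun p => hφb p.2) (fun p => hφb p.2) hL (by positivity : 0 ≤ 2 * L) (fun p => hφ p.1) hUA
    hN hw1 hwN hδ (by
      rw [Fintype.card_prod, Fintype.card_fin, Nat.cast_mul, ← sq]
      exact hbig)
  have hb' := hX.measure_not_sum_sq_tdSum_le (ι := Fin d) (ψ := φ)
    (f := fun _ x => featureMap φ θ x - r x) (g := fun _ => featureMap φ θ) hP h1 hmix hβ hb hκ
    h0.le hα1 (fun _ => (isBdd_featureMap hφb θ).sub hrb) (fun _ => isBdd_featureMap hφb θ) hL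
    (by positivity : 0 ≤ 2 * s) hφ (fun _ => abs_residual_le hγ hθs hrs) hN hw1 hwN hδ (by
      rw [Fintype.card_fin]
      refine le_trans (mul_le_mul_of_nonneg_right ?_ (by positivity)) hbig
      nlinarith)
  rw [← hbr, Fintype.card_prod, Fintype.card_fin, Nat.cast_mul, Real.sqrt_mul_self
    (Nat.cast_nonneg d), show (d : ℝ) * (L * (2 * L) / (1 - lam * γ)) * B =
      2 * d * L ^ 2 / (1 - lam * γ) * B by ring] at hA
  have e2 : Real.sqrt d * (L * (2 * s) / (1 - lam * γ)) * B =
      2 * d * L ^ 2 * V / (Real.sqrt ν * (1 - lam * γ)) * B := by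
    have e3 : (d : ℝ) = Real.sqrt d * Real.sqrt d := (Real.mul_self_sqrt (Nat.cast_nonneg d)).symm
    rw [hs_def]
    nth_rewrite 3 [e3]
    field_simp
  rw [← hbr, Fintype.card_fin, e2] at hb'
  refine le_trans ((measureReal_mono ?_).trans ((measureReal_union_le _ _).trans
    (add_le_add hA hb'))) (le_of_eq (by ring))
  intro ω hω
  by_contra hcon
  rw [Set.mem_union, not_or, Set.mem_ofPred_eq, Set.mem_ofPred_eq, not_not, not_not] at hcon
  exact hω (isUnit_and_muNorm_sub_vhat_le (n := N + 1) hγ hlam hP hφ hν hs hdet hrb hvb hvr hθ hV0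
    hB0 hρ (by omega) hcon.1 hcon.2)

end Event

/-! ### Union bound over all sample sizes -/

theorem tsum_ofReal_le {δ : ℝ} (hδ : 0 ≤ δ) :
    ∑' k : ℕ, ENNReal.ofReal (δ / (4 * ((k + 1 : ℕ) : ℝ) ^ 2)) ≤ ENNReal.ofReal δ := by
  have h1 := ((hasSum_nat_add_iff' 1).2 hasSum_zeta_two).mul_left (δ / 4)
  have e : ∀ k : ℕ, δ / (4 * ((k + 1 : ℕ) : ℝ) ^ 2) = δ / 4 * (1 / ((k + 1 : ℕ) : ℝ) ^ 2) :=
    fun k => by ring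
  simp_rw [e]
  rw [← ENNReal.ofReal_tsum_of_nonneg (fun k => by positivity) h1.summable, h1.tsum_eq]
  refine ENNReal.ofReal_le_ofReal ?_
  -- The sum is δπ²/24, so the crude bound π ≤ 4 is enough.
  have h2 : Real.pi ^ 2 ≤ 4 ^ 2 := pow_le_pow_left₀ Real.pi_pos.le Real.pi_le_four 2
  have h3 := mul_le_mul_of_nonneg_left h2 hδ
  simp only [Finset.range_one, Finset.sum_singleton]
  norm_num
  linarith

theorem ofReal_one_sub_le_measure {Ω : Type*} [MeasurableSpace Ω] {Pr : Measure Ω}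
    [IsProbabilityMeasure Pr] {G : ℕ → Set Ω} {δ : ℝ} (hδ : 0 ≤ δ) {n₀ : ℕ} (h2 : 2 ≤ n₀)
    (hG : ∀ N : ℕ, n₀ ≤ N + 1 → Pr.real (G (N + 1))ᶜ ≤ δ / (4 * (N : ℝ) ^ 2)) :
    ENNReal.ofReal (1 - δ) ≤ Pr {ω | ∀ n ≥ n₀, ω ∈ G n} := by
  set A := {ω | ∀ n ≥ n₀, ω ∈ G n} with hA
  have hsub : Aᶜ ⊆ ⋃ k : ℕ, {ω | n₀ ≤ k + 1 + 1 ∧ ω ∈ (G (k + 1 + 1))ᶜ} := by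
    intro ω hω
    rw [Set.mem_compl_iff, hA, Set.mem_ofPred_eq] at hω
    push Not at hω
    obtain ⟨n, hn, hnG⟩ := hω
    obtain ⟨k, rfl⟩ : ∃ k, n = k + 1 + 1 := ⟨n - 2, by omega⟩
    exact Set.mem_iUnion.2 ⟨k, hn, hnG⟩
  have hc : Pr Aᶜ ≤ ENNReal.ofReal δ := by
    refine (measure_mono hsub).trans ((measure_iUnion_le _).trans
      (le_trans (ENNReal.tsum_le_tsum fun k => ?_) (tsum_ofReal_le hδ)))
    by_cases hk : n₀ ≤ k + 1 + 1
    · refine (measure_mono fun ω hω => hω.2).trans ?_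
      rw [← ofReal_measureReal]
      exact ENNReal.ofReal_le_ofReal (hG _ hk)
    · simp [hk]
  rw [ENNReal.ofReal_sub _ hδ, ENNReal.ofReal_one, tsub_le_iff_right]
  -- Subadditivity suffices here, so measurability of the good event is never needed.
  calc (1 : ℝ≥0∞) = Pr (A ∪ Aᶜ) := by rw [Set.union_compl_self, measure_univ]
    _ ≤ Pr A + Pr Aᶜ := measure_union_le _ _
    _ ≤ _ := by gcongr

end LSTD

/-! ### Assembly of the high-probability error bound -/

theorem corollary1 (d : ℕ) (L Rmax γ lam ν βbar b κ : ℝ)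
    (hγ : γ ∈ Set.Ioo (0 : ℝ) 1) (hlam : lam ∈ Set.Ioo (0 : ℝ) 1)
    (hβ : 0 < βbar) (hb : 0 < b) (hκ : 0 < κ) :
    ∃ h : ℕ → ℝ → ℝ,
      (∀ δ ∈ Set.Ioo (0 : ℝ) 1, LSTD.IsSoftOInv fun n => h n δ) ∧
      ∀ (S : Type*) [Countable S] [MeasurableSpace S] [MeasurableSingletonClass S]
        (P : Kernel S S) [IsMarkovKernel P] (μ : Measure S) [IsProbabilityMeasure μ]
        (r : S → ℝ) (φ : Fin d → S → ℝ)
        (Ω : Type*) [MeasurableSpace Ω] (Pr : Measure Ω) [IsProbabilityMeasure Pr]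
        (X : ℕ → Ω → S),
        LSTD.IsErgodic P →
        P.Invariant μ →
        (∀ x, |r x| ≤ Rmax) →
        (∀ j x, |φ j x| ≤ L) →
        LinearIndependent ℝ φ →
        IsLeast {a : ℝ | Module.End.HasEigenvalue (Matrix.toLin' (LSTD.gram μ φ)) a} ν →
        LSTD.IsMarkovChain Pr P X →
        Pr.map (X 1) = μ →
        LSTD.IsExpBetaMixing Pr X βbar b κ →
        ∀ δ ∈ Set.Ioo (0 : ℝ) 1,
          ENNReal.ofReal (1 - δ) ≤ Pr {ω | ∀ n ≥ LSTD.nZero d L γ lam ν βbar b κ δ,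
            IsUnit (LSTD.Ahat φ lam γ (fun k => X k ω) n) ∧
            LSTD.muNorm μ (fun x => LSTD.valueFun P γ r x -
                LSTD.vhat φ r lam γ (fun k => X k ω) n x) ≤
              (1 - lam * γ) / (1 - γ) *
                  LSTD.muNorm μ (fun x => LSTD.valueFun P γ r x -
                    LSTD.proj μ φ (LSTD.valueFun P γ r) x) +
                4 * (Rmax / (1 - γ)) * d * L ^ 2 /
                    (Real.sqrt ((n : ℝ) - 1) * (1 - γ) * ν) *
                  Real.sqrt ((LSTD.window lam γ n + 1) * LSTD.mixI βbar b κ (n - 1) δ) +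
                h n δ} := by
  -- The witness is the exact difference between Vρ/(1-ρ) and the leading term, a formula in the
  -- parameters alone.
  refine ⟨fun n δ => LSTD.lowerOrder (2 * d * L ^ 2 / ((1 - γ) * ν)) (Rmax / (1 - γ)) γ lam βbar
    b κ δ n, fun δ hδ => LSTD.isSoftOInv_lowerOrder _ _ hγ hlam hβ hκ hδ, ?_⟩
  intro S _ _ _ P _ μ _ r φ Ω _ Pr _ X herg hP hr hφ hli hν hX h1 hmix δ hδ
  have hφb : ∀ j, LSTD.IsBdd (φ j) := fun j => ⟨L, hφ j⟩
  have hd := LSTD.pos_of_eigenvalue hν.1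
  have hν0 := LSTD.eigenvalue_pos hφb (LSTD.measure_singleton_pos_of_isErgodic hP herg) hli hν.1
  have hνL := LSTD.smallest_eigenvalue_le_sq hd hφ hν.2
  obtain ⟨x⟩ : Nonempty S := by
    by_contra hS
    rw [not_nonempty_iff] at hS
    have h2 := measure_univ (μ := μ)
    rw [Set.univ_eq_empty_iff.2 hS, measure_empty] at h2
    exact zero_ne_one h2
  have hR : 0 ≤ Rmax := (abs_nonneg _).trans (hr x)
  have hL0 : 0 ≤ L := (abs_nonneg _).trans (hφ ⟨0, hd⟩ x)
  -- L = 0 would contradict 0 < ν ≤ L².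
  have hL : 0 < L := hL0.lt_of_ne fun h => by
    rw [← h] at hνL
    norm_num at hνL
    linarith
  refine LSTD.ofReal_one_sub_le_measure hδ.1.le
    (LSTD.nZero_spec (d := d) (L := L) (ν := ν) hγ hlam hβ hκ hδ le_rfl).1 (G := fun n => {ω |
      IsUnit (LSTD.Ahat φ lam γ (fun k => X k ω) n) ∧
      LSTD.muNorm μ (fun x => LSTD.valueFun P γ r x -
        LSTD.vhat φ r lam γ (fun k => X k ω) n x) ≤ _}) fun N hN => ?_
  obtain ⟨hN2, hρ⟩ := LSTD.nZero_spec hγ hlam hβ hκ hδ hN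
  refine le_of_eq_of_le ?_ (hX.measure_not_error_le hP h1 hmix hβ hb hκ hγ hlam hr hφ hd hν0 hνL hL hR
    (LSTD.mul_dotProduct_le_sq_muNorm hφb hν.2) (LSTD.isUnit_det_gram hφb hν0 hν.2) hδ
    (by omega) hρ)
  rw [← LSTD.main_add_lowerOrder]
  simp only [← add_assoc]
  rfl
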